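/- Let $L$ be a $\mathbb{Z}$-Lie algebra of rank 3, i.e. a Lie ring whose additive group is free of rank 3. For $R=\mathbb{Z}$ or $R=\mathbb{Z}_p$ and a finite-index $R$-submodule $\Lambda$ of a free $R$-module $M$ of rank 3, write $M/\Lambda\cong R/I_1\oplus R/I_2\oplus R/I_3$ with nonzero ideals $I_1\subseteq I_2\subseteq I_3$; the *cotype* of $\Lambda$ is $(\alpha_1,\alpha_2,\alpha_3)$ with $\alpha_i(\Lambda)=|R/I_i|$, and its *corank* is the largest $i$ with $\alpha_i(\Lambda)\ne1$ (and $0$ if there is none). For an $R$-Lie algebra $M$, free of rank 3 over $R$, put $$\zeta^{\mathrm{co}}_M(s_1,s_2,s_3)=\sum_{\Lambda}\alpha_1(\Lambda)^{-s_1}\alpha_2(\Lambda)^{-s_2}\alpha_3(\Lambda)^{-s_3},$$ the sum being over the finite-index $R$-Lie subalgebras $\Lambda$ of $M$. For $m\in\{1,2,3\}$ let $$\zeta^{(m)}_L(s)=\sum_{\Lambda}|L:\Lambda|^{-s},$$ the sum being over the finite-index subalgebras $\Lambda$ of $L$ of corank at most $m$. Write $L(\mathbb{Z}_p)=L\otimes_{\mathbb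 Z}\mathbb{Z}_p$. Given a $\mathbb{Z}$-basis $e_1,e_2,e_3$ of $L$, let $\mathcal{A}_L$ be the integer $3\times3$ matrix whose rows are the coordinate vectors of $[e_2,e_3]$, $[e_3,e_1]$, $[e_1,e_2]$, and let $f(\mathbf{x})=\mathbf{x}^t\mathcal{A}_L\mathbf{x}$. The rank of $f$ is the rank over $\mathbb{Q}$ of the symmetric matrix $\mathcal{A}_L+\mathcal{A}_L^t$. Call $f$ reducible if it is a product of two nonconstant polynomials in $\mathbb{Z}[x_1,x_2,x_3]$, and irreducible otherwise. Let $\mathbb{Z}^3$ carry the zero bracket and define Lie brackets on $\mathbb{Z}e_1\oplus\mathbb{Z}e_2\oplus\mathbb{Z}e_3$ (unlisted brackets of basis vectors being zero, up to antisymmetry) by - $H$: $[e_1,e_2]=e_3$; - $\mathrm{sl}_2(\mathbb{Z})$: $[e_1,e_2]=e_3$, $[e_1,e_3]=-2e_1$, $[e_2,e_3]=2e_2$; - $L_1$: $[e_1,e_2]=e_3$, $[e_1,e_3]=e_2$. "$\zeta^{(m)}_L$ has a pole of order $k$ at $s=a$" means that the series converges absolutely for $\mathrm{Re}(s)>a$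 and that its sum extends to a meromorphic function on a half-plane $\mathrm{Re}(s)>a-\delta$ with $\delta>0$, having a pole of order exactly $k$ at $s=a$. Then, for every choice of basis: 1. If $f$ has rank $0$, then $\zeta^{\mathrm{co}}_L(\mathbf{s})=\zeta^{\mathrm{co}}_{\mathbb{Z}^3}(\mathbf{s})$, and $\zeta^{(1)}_L,\zeta^{(2)}_L,\zeta^{(3)}_L$ all have a simple pole at $s=3$. 2. If $f$ has rank $1$, then $\zeta^{\mathrm{co}}_{L(\mathbb{Z}_p)}(\mathbf{s})=\zeta^{\mathrm{co}}_{H(\mathbb{Z}_p)}(\mathbf{s})$ for all but finitely many primes $p$, and $\zeta^{(1)}_L,\zeta^{(2)}_L,\zeta^{(3)}_L$ all have a double pole at $s=2$. 3. If $f$ has rank $3$, then $\zeta^{\mathrm{co}}_{L(\mathbb{Z}_p)}(\mathbf{s})=\zeta^{\mathrm{co}}_{\mathrm{sl}_2(\mathbb{Z}_p)}(\mathbf{s})$ for all but finitely many primes $p$, where $\mathrm{sl}_2(\mathbb{Z}_p)=\mathrm{sl}_2(\mathbb{Z})\otimes\mathbb{Z}_p$, and $\zeta^{(1)}_L,\zeta^{(2)}_L,\zeta^{(3)}_L$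 all have a simple pole at $s=2$. 4. If $f$ has rank $2$ and is reducible, then $\zeta^{\mathrm{co}}_{L(\mathbb{Z}_p)}(\mathbf{s})=\zeta^{\mathrm{co}}_{L_1(\mathbb{Z}_p)}(\mathbf{s})$ for all but finitely many primes $p$, and $\zeta^{(1)}_L,\zeta^{(2)}_L,\zeta^{(3)}_L$ all have a double pole at $s=2$. 5. If $f$ has rank $2$ and is irreducible, then $\zeta^{(1)}_L,\zeta^{(2)}_L,\zeta^{(3)}_L$ all have a simple pole at $s=2$. Here an equality of cotype zeta functions means that both series converge absolutely when all $\mathrm{Re}(s_i)$ are sufficiently large, that they converge absolutely at the same points of $\mathbb{C}^3$, and that their sums agree there. -/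

import Mathlib

open scoped TensorProduct

noncomputable section

namespace CotypeZeta

section Cotype

variable {R : Type*} [CommRing R]

/-- `a` is a cotype of the submodule `N ≤ M`: there are nonzero ideals `I 0 ≤ I 1 ≤ … ≤ I (d-1)` of
`R` with `M / N ≅ R / I 0 ⊕ … ⊕ R / I (d-1)` and `a i = |R / I i|`. -/
def IsCotype {M : Type*} [AddCommGroup M] [Module R M] (d : ℕ) (N : Submodule R M)
    (a : Fin d → ℕ) : Prop :=
  ∃ I : Fin d → Ideal R, Monotone I ∧ (∀ i, I i ≠ ⊥) ∧
    Nonempty ((M ⧸ N) ≃ₗ[R] (∀ i, R ⧸ I i)) ∧ ∀ i, a i = Nat.card (R ⧸ I i)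

open Classical in
/-- The cotype `(α_1(N), …, α_d(N))` of a finite-index submodule `N` of a free module of rank `d`
(indices start at `0` here). It exists and is unique over `ℤ` and `ℤ_p`;
the second branch is never reached there. -/
def cotype {M : Type*} [AddCommGroup M] [Module R M] (d : ℕ) (N : Submodule R M) : Fin d → ℕ :=
  if h : ∃ a, IsCotype d N a then h.choose else fun _ => 1

/-- The corank: the largest `i ∈ {1, …, d}` with `α_i(N) ≠ 1`, and `0` if there is none. -/
def corank {M : Type*} [AddCommGroup M] [Module R M] (d : ℕ) (N : Submodule R M) : ℕ :=
  Finset.univ.sup fun i : Fin d => if cotype d N i ≠ 1 then (i : ℕ) + 1 else 0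

variable (R) (L : Type*) [LieRing L] [LieAlgebra R L]

/-- The finite-index Lie subalgebras of `L`. -/
abbrev FinIndexSubalgebra : Type _ :=
  {S : LieSubalgebra R L // Finite (L ⧸ S.toSubmodule)}

/-- The term `α_1(Λ)^{-s_1} ⋯ α_d(Λ)^{-s_d}` of the subalgebra cotype zeta series. -/
def cotypeTerm (d : ℕ) (s : Fin d → ℂ) (S : FinIndexSubalgebra R L) : ℂ :=
  ∏ i, ((cotype d S.1.toSubmodule i : ℕ) : ℂ) ^ (-(s i))

/-- The subalgebra cotype zeta function of an `R`-Lie algebra `L` of rank `d`. -/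
def cotypeZeta (d : ℕ) (s : Fin d → ℂ) : ℂ :=
  ∑' S : FinIndexSubalgebra R L, cotypeTerm R L d s S

/-- The subalgebra cotype zeta functions of `L` and `L'` are the same: both series converge
absolutely when all real parts are large, they converge absolutely at the same points of `ℂ^d`, and
they have the same sum. -/
def SameCotypeZeta (L' : Type*) [LieRing L'] [LieAlgebra R L'] (d : ℕ) : Prop :=
  (∃ σ : ℝ, ∀ s : Fin d → ℂ, (∀ i, σ < (s i).re) →
    Summable (cotypeTerm R L d s) ∧ Summable (cotypeTerm R L' d s)) ∧
  ∀ s : Fin d → ℂ, (Summable (cotypeTerm R L d s) ↔ Summable (cotypeTerm R L' d s)) ∧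
    cotypeZeta R L d s = cotypeZeta R L' d s

/-- The finite-index Lie subalgebras of `L` of corank at most `m`. -/
abbrev CorankSubalgebra (d m : ℕ) : Type _ :=
  {S : FinIndexSubalgebra R L // corank d S.1.toSubmodule ≤ m}

/-- The term `|L : Λ|^{-s}`. -/
def corankTerm (d m : ℕ) (s : ℂ) (S : CorankSubalgebra R L d m) : ℂ :=
  ((Nat.card (L ⧸ S.1.1.toSubmodule) : ℕ) : ℂ) ^ (-s)

/-- The Dirichlet series `ζ_L^{(m)}(s)` counting the finite-index subalgebras of `L` of corank
at most `m` by their index. -/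
def corankZeta (d m : ℕ) (s : ℂ) : ℂ :=
  ∑' S : CorankSubalgebra R L d m, corankTerm R L d m s S

/-- `ζ_L^{(m)}` has a pole of order `k` at `a`: the series converges absolutely for `Re s > a` and
its sum continues to a meromorphic function on a half-plane `Re s > a - δ` with a pole of order
exactly `k` at `a`. -/
def CorankZetaHasPole (d m : ℕ) (a : ℝ) (k : ℕ) : Prop :=
  (∀ s : ℂ, a < s.re → Summable (corankTerm R L d m s)) ∧
  ∃ δ : ℝ, 0 < δ ∧ ∃ F : ℂ → ℂ,
    MeromorphicOn F {s : ℂ | a - δ < s.re} ∧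
    (∀ s : ℂ, a < s.re → F s = corankZeta R L d m s) ∧
    meromorphicOrderAt F (a : ℂ) = ((-(k : ℤ) : ℤ) : WithTop ℤ)

end Cotype

section QuadraticForm

/-- The matrix `𝓐_L` of structure constants with respect to the basis `b`: its rows are the
coordinate vectors of `[e_2, e_3]`, `[e_3, e_1]`, `[e_1, e_2]` (the indices are in `Fin 3`). -/
def structureMatrix {L : Type*} [LieRing L] (b : Module.Basis (Fin 3) ℤ L) :
    Matrix (Fin 3) (Fin 3) ℤ :=
  Matrix.of fun i k => b.repr ⁅b (i + 1), b (i + 2)⁆ k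

/-- The quadratic form `f(x) = xᵗ A x`, as a polynomial. -/
def quadPoly (A : Matrix (Fin 3) (Fin 3) ℤ) : MvPolynomial (Fin 3) ℤ :=
  ∑ i, ∑ j, MvPolynomial.C (A i j) * MvPolynomial.X i * MvPolynomial.X j

/-- The rank of the quadratic form `xᵗ A x`: the rank over `ℚ` of its symmetric Gram matrix
(`A` itself need not be symmetric). -/
def quadRank (A : Matrix (Fin 3) (Fin 3) ℤ) : ℕ :=
  ((A + A.transpose).map (Int.cast : ℤ → ℚ)).rank

/-- A product of two nonconstant integral polynomials (constant factors, such as the `2` in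
`2 (x ^ 2 + y ^ 2)`, do not count). -/
def IsReducibleForm (f : MvPolynomial (Fin 3) ℤ) : Prop :=
  ∃ g h : MvPolynomial (Fin 3) ℤ, g.totalDegree ≠ 0 ∧ h.totalDegree ≠ 0 ∧ f = g * h

end QuadraticForm

section Examples

/-- `L(ℤ_p) = ℤ_p ⊗ L`, a Lie algebra over `ℤ_p`; a Lie ring `L` is the same as a `ℤ`-Lie algebra. -/
abbrev AtPrime (p : ℕ) [Fact p.Prime] (L : Type*) [LieRing L] : Type _ :=
  ℤ_[p] ⊗[ℤ] L

/-- `ℤ³` with the zero bracket. -/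
def Abelian3 : Type := Fin 3 → ℤ

instance : AddCommGroup Abelian3 := inferInstanceAs (AddCommGroup (Fin 3 → ℤ))

instance : LieRing Abelian3 where
  bracket _ _ := 0
  add_lie _ _ _ := (add_zero _).symm
  lie_add _ _ _ := (add_zero _).symm
  lie_self _ := rfl
  leibniz_lie _ _ _ := (add_zero _).symm

/-- The bracket on `ℤ³` of the Lie algebra below. -/
def heisBracket (x y : Fin 3 → ℤ) : Fin 3 → ℤ :=
  ![0, 0, x 0 * y 1 - x 1 * y 0]

/-- The Heisenberg Lie algebra `H`: `[e_1, e_2] = e_3`. -/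
def Heisenberg : Type := Fin 3 → ℤ

instance : AddCommGroup Heisenberg := inferInstanceAs (AddCommGroup (Fin 3 → ℤ))

instance : LieRing Heisenberg where
  bracket := heisBracket
  add_lie := (by
    intro x y z; ext i; fin_cases i <;> simp [heisBracket] ; ring :
    ∀ x y z : Fin 3 → ℤ, heisBracket (x + y) z = heisBracket x z + heisBracket y z)
  lie_add := (by
    intro x y z; ext i; fin_cases i <;> simp [heisBracket] ; ring :
    ∀ x y z : Fin 3 → ℤ, heisBracket x (y + z) = heisBracket x y + heisBracket x z)
  lie_self := (by
    intro x; ext i; fin_cases i <;> simp [heisBracket] ; ring :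
    ∀ x : Fin 3 → ℤ, heisBracket x x = 0)
  leibniz_lie := (by
    intro x y z; ext i; fin_cases i <;> simp [heisBracket] :
    ∀ x y z : Fin 3 → ℤ, heisBracket x (heisBracket y z) =
      heisBracket (heisBracket x y) z + heisBracket y (heisBracket x z))

/-- The bracket on `ℤ³` of the Lie algebra below. -/
def sl2Bracket (x y : Fin 3 → ℤ) : Fin 3 → ℤ :=
  ![-2 * (x 0 * y 2 - x 2 * y 0), 2 * (x 1 * y 2 - x 2 * y 1), x 0 * y 1 - x 1 * y 0]

/-- The Lie algebra `sl_2(ℤ)`: `[e_1, e_2] = e_3`, `[e_1, e_3] = -2 e_1`, `[e_2, e_3] = 2 e_2`. -/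
def SL2 : Type := Fin 3 → ℤ

instance : AddCommGroup SL2 := inferInstanceAs (AddCommGroup (Fin 3 → ℤ))

instance : LieRing SL2 where
  bracket := sl2Bracket
  add_lie := (by
    intro x y z; ext i; fin_cases i <;> simp [sl2Bracket] <;> ring :
    ∀ x y z : Fin 3 → ℤ, sl2Bracket (x + y) z = sl2Bracket x z + sl2Bracket y z)
  lie_add := (by
    intro x y z; ext i; fin_cases i <;> simp [sl2Bracket] <;> ring :
    ∀ x y z : Fin 3 → ℤ, sl2Bracket x (y + z) = sl2Bracket x y + sl2Bracket x z)
  lie_self := (by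
    intro x; ext i; fin_cases i <;> simp [sl2Bracket] <;> ring :
    ∀ x : Fin 3 → ℤ, sl2Bracket x x = 0)
  leibniz_lie := (by
    intro x y z; ext i; fin_cases i <;> simp [sl2Bracket] <;> ring :
    ∀ x y z : Fin 3 → ℤ, sl2Bracket x (sl2Bracket y z) =
      sl2Bracket (sl2Bracket x y) z + sl2Bracket y (sl2Bracket x z))

/-- The bracket on `ℤ³` of the Lie algebra below. -/
def l1Bracket (x y : Fin 3 → ℤ) : Fin 3 → ℤ :=
  ![0, x 0 * y 2 - x 2 * y 0, x 0 * y 1 - x 1 * y 0]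

/-- The Lie algebra `L_1`: `[e_1, e_2] = e_3`, `[e_1, e_3] = e_2`, `[e_2, e_3] = 0`. -/
def L1 : Type := Fin 3 → ℤ

instance : AddCommGroup L1 := inferInstanceAs (AddCommGroup (Fin 3 → ℤ))

instance : LieRing L1 where
  bracket := l1Bracket
  add_lie := (by
    intro x y z; ext i; fin_cases i <;> simp [l1Bracket] <;> ring :
    ∀ x y z : Fin 3 → ℤ, l1Bracket (x + y) z = l1Bracket x z + l1Bracket y z)
  lie_add := (by
    intro x y z; ext i; fin_cases i <;> simp [l1Bracket] <;> ring :
    ∀ x y z : Fin 3 → ℤ, l1Bracket x (y + z) = l1Bracket x y + l1Bracket x z)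
  lie_self := (by
    intro x; ext i; fin_cases i <;> simp [l1Bracket] <;> ring :
    ∀ x : Fin 3 → ℤ, l1Bracket x x = 0)
  leibniz_lie := (by
    intro x y z; ext i; fin_cases i <;> simp [l1Bracket] <;> ring :
    ∀ x y z : Fin 3 → ℤ, l1Bracket x (l1Bracket y z) =
      l1Bracket (l1Bracket x y) z + l1Bracket y (l1Bracket x z))

end Examples

end CotypeZeta

end

open CotypeZeta

open CotypeZeta

/-! In coordinates the bracket of a Lie algebra of rank 3 is `(x, y) ↦ (x × y) A`. If `K` is
alternating, `(x × y) K` is a combination of `x` and `y`, so a submodule is closed under the bracket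
of `A` if and only if it is closed under that of `A + K`. Hence the set of subalgebras depends only
on the quadratic form `f`, and a linear change of variables that multiplies `f` by a unit carries
subalgebras to subalgebras of the same cotype (`closedUnder_map_iff`). Completing squares brings `f`
over `ℤ_p`, for all but finitely many `p`, to a unit multiple of `z²` in rank 1, of `z² - y²` in
rank 2 with square discriminant, and of `4xy + z²` in rank 3. These are the forms of `H`, `L_1` and
`sl_2`. In rank 3 the last step needs a solution of `d r² + D s² = 1` with units `d`, `D`, which
exists modulo `p` and lifts by Hensel's lemma. In rank 2 the discriminant is a square exactly when
`f` is reducible.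

For the poles, let `a(n)` be the number of subalgebras of index `n` and corank at most `m`. It is
multiplicative. A lower bound comes from the lattices `v₂ ≡ y v₀ + z v₁` modulo `p ^ e`, which have
cyclic quotient and are subalgebras once `f(-y, -z, 1) ≡ 0`. An upper bound comes from Hermite
normal forms: in a subalgebra, `f(a × b)` is the determinant of `a`, `b` and their bracket, so the
index divides it. Both bounds hold for every `m ≥ 1`, which is why the three series have the same
pole. For `f ≠ 0`, after a change of basis, `a(p)` is the number of zeros of `f(-y, -z, 1)` modulo
`p` up to `O(1)`, `a(p²)` is the number of zeros modulo `p²` up to `O(p²)`, and `a(p ^ n)` is at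
most a constant times `(n + 1)² p ^ (n + ⌊n / 2⌋)`.

Counting zeros gives `p` and `p³` in rank 1, `p + χ(p)(p - 1)` and `O(p²)` in rank 2, where `χ` is
the quadratic character of the discriminant, and `p + O(1)` and `O(p²)` in rank 3. So the series
equals, up to an Euler product that converges for `Re s > 19/10` and does not vanish at `2`,
respectively `ζ(s - 1) ζ(2s - 3)`, `ζ(s - 1) L(χ, s - 1)` and `ζ(s - 1)`. In rank 2 the second
factor has a pole at `2` if the discriminant is a square, and is otherwise entire with `L(χ, 1) ≠
0`. For `f = 0` the coefficients `a(n) / n` are treated like those of rank 3, and the pole moves to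
`3`. The analytic core is `dirichletSeriesHasPole_of_local`. -/

namespace CotypeZeta

open Matrix

/-! ### Brackets in coordinates and the role of the quadratic form -/

section LieMatrix

variable {R : Type*} [CommRing R]

/-- The submodules of `R ^ 3` closed under the bracket `(x, y) ↦ (x × y) A`. -/
def ClosedUnder (A : Matrix (Fin 3) (Fin 3) R) (N : Submodule R (Fin 3 → R)) : Prop :=
  ∀ x ∈ N, ∀ y ∈ N, crossProduct x y ᵥ* A ∈ N

/-- The quadratic form `xᵗ A x`. -/
def quadForm (A : Matrix (Fin 3) (Fin 3) R) (x : Fin 3 → R) : R := x ⬝ᵥ A *ᵥ x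

theorem quadForm_eq (A : Matrix (Fin 3) (Fin 3) R) (x : Fin 3 → R) :
    quadForm A x = A 0 0 * x 0 ^ 2 + (A 0 1 + A 1 0) * (x 0 * x 1) + (A 0 2 + A 2 0) * (x 0 * x 2)
      + A 1 1 * x 1 ^ 2 + (A 1 2 + A 2 1) * (x 1 * x 2) + A 2 2 * x 2 ^ 2 := by
  simp only [quadForm, dotProduct, mulVec, Fin.sum_univ_three]
  ring

/-- Values at `e_i` and `e_i + e_j` recover the relations without dividing by 2, so they hold over
every commutative ring. -/
theorem alternating_of_quadForm_eq_zero {K : Matrix (Fin 3) (Fin 3) R}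
    (h : ∀ x, quadForm K x = 0) :
    K 0 0 = 0 ∧ K 1 1 = 0 ∧ K 2 2 = 0 ∧ K 1 0 = -K 0 1 ∧ K 2 0 = -K 0 2 ∧ K 2 1 = -K 1 2 := by
  simp only [quadForm_eq] at h
  have h0 := h ![1, 0, 0]
  have h1 := h ![0, 1, 0]
  have h2 := h ![0, 0, 1]
  have h01 := h ![1, 1, 0]
  have h02 := h ![1, 0, 1]
  have h12 := h ![0, 1, 1]
  simp at h0 h1 h2 h01 h02 h12
  refine ⟨h0, h1, h2, ?_, ?_, ?_⟩
  · linear_combination h01 - h0 - h1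
  · linear_combination h02 - h0 - h2
  · linear_combination h12 - h1 - h2

/-- Up to sign, an alternating matrix acts as the cross product with a fixed vector `k`, and `(x ×
y) × k` is a combination of `x` and `y`. Alternating summands of `A` are therefore invisible to
submodules. -/
theorem vecMul_crossProduct_of_alternating {K : Matrix (Fin 3) (Fin 3) R}
    (h : ∀ x, quadForm K x = 0) (x y : Fin 3 → R) :
    ∃ r s : R, crossProduct x y ᵥ* K = r • x + s • y := by
  obtain ⟨h0, h1, h2, h3, h4, h5⟩ := alternating_of_quadForm_eq_zero h
  refine ⟨K 1 2 * y 0 - K 0 2 * y 1 + K 0 1 * y 2, -(K 1 2 * x 0 - K 0 2 * x 1 + K 0 1 * x 2), ?_⟩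
  ext i
  fin_cases i <;>
    simp [cross_apply, vecMul, dotProduct, Fin.sum_univ_three, h0, h1, h2, h3, h4, h5] <;> ring

/-- The cofactor matrix is the action of `P` on the exterior square. -/
theorem crossProduct_vecMul (P : Matrix (Fin 3) (Fin 3) R) (x y : Fin 3 → R) :
    crossProduct (x ᵥ* P) (y ᵥ* P) = crossProduct x y ᵥ* P.adjugateᵀ := by
  ext i
  fin_cases i <;>
    simp [cross_apply, vecMul, dotProduct, Fin.sum_univ_three, adjugate_fin_three] <;> ring

theorem quadForm_conj (A P : Matrix (Fin 3) (Fin 3) R) (x : Fin 3 → R) :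
    quadForm (Pᵀ * A * P) x = quadForm A (P *ᵥ x) := by
  simp only [quadForm, ← mulVec_mulVec, dotProduct_mulVec, vecMul_transpose]

/-- Proportional quadratic forms give rise to the same subalgebras. -/
theorem closedUnder_map_iff {A A' P : Matrix (Fin 3) (Fin 3) R} {c : R} (hc : IsUnit c)
    (hP : IsUnit P.det) (h : ∀ x, quadForm A' (P *ᵥ x) = c * quadForm A x)
    (N : Submodule R (Fin 3 → R)) :
    ClosedUnder A (N.map P.vecMulLinear) ↔ ClosedUnder A' N := by
  -- The matrix `Pᵀ A' P - c A` is alternating by `h`, so up to multiples of the images of `x` and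
  -- `y` the two brackets correspond, with the unit factors `det P` and `c`. The determinant appears
  -- through `adj(P)ᵀ Pᵀ = det P`.
  have key : ∀ x y : Fin 3 → R, ∃ r s : R,
      P.det • (crossProduct x y ᵥ* A') ᵥ* P =
        c • crossProduct (x ᵥ* P) (y ᵥ* P) ᵥ* A + (r • (x ᵥ* P) + s • (y ᵥ* P)) := by
    intro x y
    obtain ⟨r, s, hrs⟩ := vecMul_crossProduct_of_alternating (K := Pᵀ * A' * P - c • A) (by
      intro x
      have := h x
      rw [← quadForm_conj] at this
      simp only [quadForm, sub_mulVec, dotProduct_sub, smul_mulVec, dotProduct_smul,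
        smul_eq_mul] at this ⊢
      rw [this, sub_self]) (x ᵥ* P) (y ᵥ* P)
    refine ⟨r, s, ?_⟩
    rw [← hrs, vecMul_sub, vecMul_smul, add_sub_cancel, crossProduct_vecMul]
    simp only [vecMul_vecMul]
    have : P.adjugateᵀ * (Pᵀ * A' * P) = P.det • (A' * P) := by
      rw [← Matrix.mul_assoc, ← Matrix.mul_assoc, ← transpose_mul, mul_adjugate, transpose_smul,
        transpose_one, smul_mul, smul_mul, Matrix.one_mul]
    rw [this, vecMul_smul]
  have hinj : Function.Injective P.vecMulLinear := by
    intro x y hxy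
    have := congrArg (· ᵥ* P⁻¹) hxy
    simpa [vecMul_vecMul, mul_nonsing_inv _ hP] using this
  obtain ⟨u, hu⟩ := hc
  obtain ⟨v, hv⟩ := hP
  constructor
  · intro hA x hx y hy
    obtain ⟨r, s, hrs⟩ := key x y
    have h1 : P.det • (crossProduct x y ᵥ* A') ᵥ* P ∈ N.map P.vecMulLinear := by
      rw [hrs]
      exact add_mem (Submodule.smul_mem _ _ (hA _ ⟨x, hx, rfl⟩ _ ⟨y, hy, rfl⟩))
        (add_mem (Submodule.smul_mem _ _ ⟨x, hx, rfl⟩) (Submodule.smul_mem _ _ ⟨y, hy, rfl⟩))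
    rw [← hv] at h1
    have h2 := (Submodule.smul_mem_iff_of_isUnit _ v.isUnit).1 h1
    obtain ⟨z, hz, hzz⟩ := h2
    rwa [← hinj hzz]
  · rintro hA _ ⟨x, hx, rfl⟩ _ ⟨y, hy, rfl⟩
    obtain ⟨r, s, hrs⟩ := key x y
    rw [← hu] at hrs
    refine (Submodule.smul_mem_iff_of_isUnit _ u.isUnit).1 ?_
    change (u : R) • crossProduct (x ᵥ* P) (y ᵥ* P) ᵥ* A ∈ _
    rw [eq_sub_of_add_eq hrs.symm]
    exact sub_mem (Submodule.smul_mem _ _ ⟨_, hA x hx y hy, rfl⟩)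
        (add_mem (Submodule.smul_mem _ _ ⟨x, hx, rfl⟩) (Submodule.smul_mem _ _ ⟨y, hy, rfl⟩))

variable {M : Type*} [LieRing M] [LieAlgebra R M]

/-- The matrix of structure constants of a Lie algebra of rank `3`. -/
noncomputable def lieMatrix (b : Module.Basis (Fin 3) R M) : Matrix (Fin 3) (Fin 3) R :=
  Matrix.of fun i k => b.repr ⁅b (i + 1), b (i + 2)⁆ k

theorem equivFun_lie (b : Module.Basis (Fin 3) R M) (x y : M) :
    b.equivFun ⁅x, y⁆ = crossProduct (b.equivFun x) (b.equivFun y) ᵥ* lieMatrix b := by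
  have hx : x = ∑ i, b.equivFun x i • b i := (b.sum_equivFun x).symm
  have hy : y = ∑ i, b.equivFun y i • b i := (b.sum_equivFun y).symm
  generalize b.equivFun x = u at *
  generalize b.equivFun y = v at *
  subst hx hy
  have h10 : ⁅b 1, b 0⁆ = -⁅b 0, b 1⁆ := (lie_skew _ _).symm
  have h02 : ⁅b 0, b 2⁆ = -⁅b 2, b 0⁆ := (lie_skew _ _).symm
  have h21 : ⁅b 2, b 1⁆ = -⁅b 1, b 2⁆ := (lie_skew _ _).symm
  ext k
  simp only [Fin.sum_univ_three, lie_add, add_lie, smul_lie, lie_smul, lie_self, h10, h02, h21,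
    smul_zero, smul_neg, map_add, map_neg, map_smul, Pi.add_apply, Pi.neg_apply, Pi.smul_apply,
    map_zero, Pi.zero_apply, smul_eq_mul, cross_apply, vecMul, dotProduct, lieMatrix, of_apply]
  simp
  ring

theorem closedUnder_map_equivFun (b : Module.Basis (Fin 3) R M) (S : Submodule R M) :
    ClosedUnder (lieMatrix b) (S.map b.equivFun.toLinearMap) ↔
      ∀ x ∈ S, ∀ y ∈ S, ⁅x, y⁆ ∈ S := by
  constructor
  · intro h x hx y hy
    have := h _ ⟨x, hx, rfl⟩ _ ⟨y, hy, rfl⟩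
    simp only [LinearEquiv.coe_coe] at this
    rw [← equivFun_lie] at this
    obtain ⟨z, hz, hzz⟩ := this
    rwa [← b.equivFun.injective hzz]
  · rintro h _ ⟨x, hx, rfl⟩ _ ⟨y, hy, rfl⟩
    simp only [LinearEquiv.coe_coe]
    rw [← equivFun_lie]
    exact ⟨_, h x hx y hy, rfl⟩

end LieMatrix

/-! ### Invariance of cotype, corank and index under linear equivalences -/

section CotypeEquiv

variable {R : Type*} [CommRing R] {M M' : Type*} [AddCommGroup M] [Module R M]
  [AddCommGroup M'] [Module R M']

theorem isCotype_map (e : M ≃ₗ[R] M') (d : ℕ) (N : Submodule R M) (a : Fin d → ℕ) :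
    IsCotype d (N.map e.toLinearMap) a ↔ IsCotype d N a := by
  have f : (M ⧸ N) ≃ₗ[R] (M' ⧸ N.map e.toLinearMap) := Submodule.Quotient.equiv _ _ e rfl
  constructor
  · rintro ⟨I, h1, h2, ⟨g⟩, h3⟩
    exact ⟨I, h1, h2, ⟨f.trans g⟩, h3⟩
  · rintro ⟨I, h1, h2, ⟨g⟩, h3⟩
    exact ⟨I, h1, h2, ⟨f.symm.trans g⟩, h3⟩

theorem cotype_map (e : M ≃ₗ[R] M') (d : ℕ) (N : Submodule R M) :
    cotype d (N.map e.toLinearMap) = cotype d N := by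
  have : IsCotype d (N.map e.toLinearMap) = IsCotype d N := by
    funext a
    exact propext (isCotype_map e d N a)
  unfold cotype
  rw [this]

theorem corank_map (e : M ≃ₗ[R] M') (d : ℕ) (N : Submodule R M) :
    corank d (N.map e.toLinearMap) = corank d N := by
  unfold corank
  rw [cotype_map]

theorem card_quotient_map (e : M ≃ₗ[R] M') (N : Submodule R M) :
    Nat.card (M' ⧸ N.map e.toLinearMap) = Nat.card (M ⧸ N) :=
  (Nat.card_congr (Submodule.Quotient.equiv N _ e rfl).toEquiv).symm

theorem finite_quotient_map (e : M ≃ₗ[R] M') (N : Submodule R M) :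
    Finite (M' ⧸ N.map e.toLinearMap) ↔ Finite (M ⧸ N) :=
  (Submodule.Quotient.equiv N _ e rfl).toEquiv.finite_iff.symm

end CotypeEquiv

/-! ### Equality of cotype zeta functions from proportional forms -/

section SameZeta

variable {R : Type*} [CommRing R] {M M' : Type*} [LieRing M] [LieAlgebra R M] [LieRing M']
  [LieAlgebra R M']

/-- A linear equivalence that preserves subalgebras induces an equivalence of the sets of
finite-index subalgebras. -/
def subalgebraEquiv (e : M ≃ₗ[R] M')
    (h : ∀ S : Submodule R M, (∀ x ∈ S, ∀ y ∈ S, ⁅x, y⁆ ∈ S) ↔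
      ∀ x ∈ S.map e.toLinearMap, ∀ y ∈ S.map e.toLinearMap, ⁅x, y⁆ ∈ S.map e.toLinearMap) :
    FinIndexSubalgebra R M ≃ FinIndexSubalgebra R M' where
  toFun S := ⟨{ S.1.toSubmodule.map e.toLinearMap with
    lie_mem' := fun {x y} hx hy =>
      (h S.1.toSubmodule).1 (fun _ hx _ hy => S.1.lie_mem hx hy) x hx y hy },
    (finite_quotient_map e _).2 S.2⟩
  invFun S := ⟨{ S.1.toSubmodule.comap e.toLinearMap with
    lie_mem' := fun {x y} hx hy =>
      (h (S.1.toSubmodule.comap e.toLinearMap)).2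
        (by
          rw [Submodule.map_comap_eq_of_surjective e.surjective]
          exact fun _ hx _ hy => S.1.lie_mem hx hy) x hx y hy },
    (finite_quotient_map e _).1 (by
      have := S.2
      change Finite (M' ⧸ Submodule.map e.toLinearMap (S.1.toSubmodule.comap e.toLinearMap))
      rwa [Submodule.map_comap_eq_of_surjective e.surjective])⟩
  left_inv S := by
    apply Subtype.ext
    apply LieSubalgebra.toSubmodule_injective
    exact Submodule.comap_map_eq_of_injective e.injective _
  right_inv S := by
    apply Subtype.ext
    apply LieSubalgebra.toSubmodule_injective
    exact Submodule.map_comap_eq_of_surjective e.surjective _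

theorem cotypeTerm_subalgebraEquiv (e : M ≃ₗ[R] M')
    (h : ∀ S : Submodule R M, (∀ x ∈ S, ∀ y ∈ S, ⁅x, y⁆ ∈ S) ↔
      ∀ x ∈ S.map e.toLinearMap, ∀ y ∈ S.map e.toLinearMap, ⁅x, y⁆ ∈ S.map e.toLinearMap)
    (d : ℕ) (s : Fin d → ℂ) (S : FinIndexSubalgebra R M) :
    cotypeTerm R M' d s (subalgebraEquiv e h S) = cotypeTerm R M d s S := by
  have : cotype d (subalgebraEquiv e h S).1.toSubmodule = cotype d S.1.toSubmodule :=
    cotype_map e d _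
  simp only [cotypeTerm, this]

theorem sameCotypeZeta_of_equiv (e : M ≃ₗ[R] M')
    (h : ∀ S : Submodule R M, (∀ x ∈ S, ∀ y ∈ S, ⁅x, y⁆ ∈ S) ↔
      ∀ x ∈ S.map e.toLinearMap, ∀ y ∈ S.map e.toLinearMap, ⁅x, y⁆ ∈ S.map e.toLinearMap)
    (d : ℕ) {σ : ℝ}
    (hσ : ∀ s : Fin d → ℂ, (∀ i, σ < (s i).re) → Summable (cotypeTerm R M d s)) :
    SameCotypeZeta R M M' d := by
  have key : ∀ s, cotypeTerm R M d s = cotypeTerm R M' d s ∘ subalgebraEquiv e h := fun s =>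
    funext fun S => (cotypeTerm_subalgebraEquiv e h d s S).symm
  have key2 : ∀ s, (Summable (cotypeTerm R M d s) ↔ Summable (cotypeTerm R M' d s)) := fun s => by
    rw [key, Equiv.summable_iff]
  refine ⟨⟨σ, fun s hs => ⟨hσ s hs, (key2 s).1 (hσ s hs)⟩⟩, fun s => ⟨key2 s, ?_⟩⟩
  unfold cotypeZeta
  rw [key]
  exact Equiv.tsum_eq _ _

/-- Lie algebras of rank `3` with proportional quadratic forms have the same cotype zeta
functions. -/
theorem sameCotypeZeta_of_quadForm (b : Module.Basis (Fin 3) R M) (b' : Module.Basis (Fin 3) R M')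
    {P : Matrix (Fin 3) (Fin 3) R} {c : R} (hc : IsUnit c) (hP : IsUnit P.det)
    (h : ∀ x, quadForm (lieMatrix b') (P *ᵥ x) = c * quadForm (lieMatrix b) x) {σ : ℝ}
    (hσ : ∀ s : Fin 3 → ℂ, (∀ i, σ < (s i).re) → Summable (cotypeTerm R M 3 s)) :
    SameCotypeZeta R M M' 3 := by
  let g : (Fin 3 → R) ≃ₗ[R] (Fin 3 → R) := LinearEquiv.ofBijective P.vecMulLinear (by
    constructor
    · intro x y hxy
      have := congrArg (· ᵥ* P⁻¹) hxy
      simpa [vecMul_vecMul, mul_nonsing_inv _ hP] using this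
    · intro x
      exact ⟨x ᵥ* P⁻¹, by simp [vecMul_vecMul, nonsing_inv_mul _ hP]⟩)
  have hg : g.toLinearMap = P.vecMulLinear := rfl
  -- The map `x ↦ x P` carries submodules closed for `b'` to submodules closed for `b`, so the
  -- equivalence from `M` to `M'` uses its inverse.
  refine sameCotypeZeta_of_equiv (b.equivFun.trans (g.symm.trans b'.equivFun.symm)) ?_ 3 hσ
  intro S
  rw [← closedUnder_map_equivFun b, ← closedUnder_map_equivFun b', ← closedUnder_map_iff hc hP h,
    ← hg, ← Submodule.map_comp, ← Submodule.map_comp]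
  have : g.toLinearMap ∘ₗ b'.equivFun.toLinearMap ∘ₗ
      (b.equivFun.trans (g.symm.trans b'.equivFun.symm)).toLinearMap = b.equivFun.toLinearMap := by
    refine LinearMap.ext fun x => ?_
    change g (b'.equivFun (b'.equivFun.symm (g.symm (b.equivFun x)))) = b.equivFun x
    rw [LinearEquiv.apply_symm_apply, LinearEquiv.apply_symm_apply]
  rw [LinearMap.comp_assoc, this]

end SameZeta

end CotypeZeta

namespace CotypeZeta

/-! ### Existence of cotypes over principal ideal domains -/

section Existence

variable {R : Type*} [CommRing R] [IsDomain R] [IsPrincipalIdealRing R]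

open Submodule in
/-- `R / a ⊕ R / b ≅ R / lcm ⊕ R / gcd`. -/
theorem exists_quotient_span_prod_equiv {a b : R} (ha : a ≠ 0) (hb : b ≠ 0) :
    ∃ l g : R, l ≠ 0 ∧ g ≠ 0 ∧ g ∣ l ∧ g ∣ a ∧ g ∣ b ∧ (∀ m, a ∣ m → b ∣ m → l ∣ m) ∧
      a ∣ l ∧ b ∣ l ∧
      Nonempty (((R ⧸ span R {a}) × (R ⧸ span R {b})) ≃ₗ[R] (R ⧸ span R {l}) × (R ⧸ span R {g})) := by
  obtain ⟨g, hg⟩ := IsPrincipalIdealRing.principal (Ideal.span {a, b})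
  have hga : g ∣ a := Ideal.mem_span_singleton.1 (by
    change a ∈ Submodule.span R {g}; rw [← hg]; exact Ideal.subset_span (by simp))
  have hgb : g ∣ b := Ideal.mem_span_singleton.1 (by
    change b ∈ Submodule.span R {g}; rw [← hg]; exact Ideal.subset_span (by simp))
  have hgm : g ∈ Ideal.span {a, b} := by rw [hg]; exact Submodule.mem_span_singleton_self g
  obtain ⟨r, s, hrs⟩ := Ideal.mem_span_pair.1 hgm
  obtain ⟨a', rfl⟩ := hga
  obtain ⟨b', rfl⟩ := hgb
  have hg0 : g ≠ 0 := left_ne_zero_of_mul ha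
  have hb0 : b' ≠ 0 := right_ne_zero_of_mul hb
  have h1 : r * a' + s * b' = 1 := mul_left_cancel₀ hg0 (by linear_combination hrs)
  let l := g * a' * b'
  let π : ∀ c d : R, (R × R) →ₗ[R] (R ⧸ span R {c}) × (R ⧸ span R {d}) := fun c d =>
    (mkQ (span R {c})).prodMap (mkQ (span R {d}))
  have hπ : ∀ c d, Function.Surjective (π c d) := fun c d =>
    Prod.map_surjective.2 ⟨mkQ_surjective _, mkQ_surjective _⟩
  have hker : ∀ c d x y, π c d (x, y) = 0 ↔ c ∣ x ∧ d ∣ y := by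
    intro c d x y
    rw [← Ideal.mem_span_singleton, ← Ideal.mem_span_singleton]
    simp [π, Prod.ext_iff, Ideal.submodule_span_eq, Ideal.Quotient.eq_zero_iff_mem]
  -- The matrix with rows `(-b', a')` and `(r, s)` has determinant `-(r a' + s b') = -1`, so `φ` is
  -- invertible. It carries the sublattice `(g a') × (g b')` onto `(l) × (g)`.
  let φ : (R × R) →ₗ[R] (R × R) :=
    ((-b') • LinearMap.fst R R R + a' • LinearMap.snd R R R).prod
      (r • LinearMap.fst R R R + s • LinearMap.snd R R R)
  have hφ : ∀ x y, φ (x, y) = (-b' * x + a' * y, r * x + s * y) := fun x y => rfl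
  have hφs : Function.Surjective φ := by
    rintro ⟨x, y⟩
    refine ⟨(-s * x + a' * y, r * x + b' * y), ?_⟩
    rw [hφ]
    ext
    · linear_combination x * h1
    · linear_combination y * h1
  have hk : LinearMap.ker (π (g * a') (g * b')) = LinearMap.ker ((π l g).comp φ) := by
    ext ⟨x, y⟩
    rw [LinearMap.mem_ker, LinearMap.mem_ker, LinearMap.comp_apply, hφ, hker, hker]
    constructor
    · rintro ⟨⟨u, rfl⟩, ⟨v, rfl⟩⟩
      exact ⟨⟨-u + v, by ring⟩, ⟨r * a' * u + s * b' * v, by ring⟩⟩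
    · rintro ⟨⟨u, hu⟩, ⟨v, hv⟩⟩
      exact ⟨⟨-s * b' * u + v, by linear_combination (-s) * hu + a' * hv - x * h1⟩,
        ⟨r * a' * u + v, by linear_combination r * hu + b' * hv - y * h1⟩⟩
  refine ⟨l, g, mul_ne_zero ha hb0, hg0, ⟨a' * b', by ring⟩, ⟨a', rfl⟩, ⟨b', rfl⟩, ?_, ⟨b', rfl⟩,
    ⟨a', by ring⟩, ⟨((LinearMap.quotKerEquivOfSurjective _ (hπ _ _)).symm.trans
      (quotEquivOfEq _ _ hk)).trans
      (LinearMap.quotKerEquivOfSurjective ((π l g).comp φ) ((hπ l g).comp hφs))⟩⟩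
  rintro m ⟨u, hu⟩ ⟨v, hv⟩
  refine ⟨r * v + s * u, ?_⟩
  linear_combination (s * b') * hu + (r * a') * hv - m * h1

/-- The ideals in a cyclic decomposition of rank `3` can be chosen to form a chain. -/
theorem exists_chain_quotient_span_equiv {Q : Type*} [AddCommGroup Q] [Module R Q] {a b c : R}
    (ha : a ≠ 0) (hb : b ≠ 0) (hc : c ≠ 0)
    (e : Q ≃ₗ[R] (R ⧸ Ideal.span {a}) × (R ⧸ Ideal.span {b}) × (R ⧸ Ideal.span {c})) :
    ∃ a' b' c' : R, a' ≠ 0 ∧ b' ≠ 0 ∧ c' ≠ 0 ∧ b' ∣ a' ∧ c' ∣ b' ∧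
      Nonempty (Q ≃ₗ[R] (R ⧸ Ideal.span {a'}) × (R ⧸ Ideal.span {b'}) × (R ⧸ Ideal.span {c'})) := by
  -- Sorting three elements by three comparisons, with lcm and gcd in place of maximum and minimum.
  -- At the end `l2 ∣ l'`, because both `g'` and `g` divide `l'`.
  obtain ⟨l, g, hl, hg, hgl, hgb, hgc, -, hbl, hcl, ⟨e1⟩⟩ := exists_quotient_span_prod_equiv hb hc
  obtain ⟨l', g', hl', hg', hgl', hga', hgl2, -, hal', hll', ⟨e2⟩⟩ :=
    exists_quotient_span_prod_equiv ha hl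
  obtain ⟨l2, g2, hl2, hg2, hgl22, -, -, hlcm, -, -, ⟨e3⟩⟩ := exists_quotient_span_prod_equiv hg' hg
  refine ⟨l', l2, g2, hl', hl2, hg2, hlcm _ hgl' (hgl.trans hll'), hgl22, ⟨?_⟩⟩
  exact (((e.trans ((LinearEquiv.refl R _).prodCongr e1)).trans
    (LinearEquiv.prodAssoc R _ _ _).symm).trans (e2.prodCongr (LinearEquiv.refl R _))).trans
      ((LinearEquiv.prodAssoc R _ _ _).trans ((LinearEquiv.refl R _).prodCongr e3))

/-- Dependent functions on `Fin 3` as triples. -/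
def piFinThreeEquiv (M : Fin 3 → Type*) [∀ i, AddCommGroup (M i)] [∀ i, Module R (M i)] :
    (∀ i, M i) ≃ₗ[R] M 0 × M 1 × M 2 where
  toFun x := (x 0, x 1, x 2)
  invFun y := Fin.cons y.1 (Fin.cons y.2.1 (Fin.cons y.2.2 finZeroElim))
  map_add' _ _ := rfl
  map_smul' _ _ := rfl
  left_inv x := by ext i; fin_cases i <;> rfl
  right_inv y := rfl

variable [CharZero R] {M : Type*} [AddCommGroup M] [Module R M]

omit [IsPrincipalIdealRing R] in
-- A finite quotient is killed by its order, which is nonzero in characteristic zero, so it is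
-- torsion and has rank zero.
theorem finrank_eq_of_finite_quotient (b : Module.Basis (Fin 3) R M) (N : Submodule R M)
    [Finite (M ⧸ N)] : Module.finrank R N = Module.finrank R M := by
  have : Module.Finite R M := Module.Finite.of_basis b
  have h := Submodule.finrank_quotient_add_finrank N
  have h0 : Module.finrank R (M ⧸ N) = 0 := by
    rw [Module.finrank_eq_zero_iff_isTorsion]
    intro x
    have hn : ((Nat.card (M ⧸ N) : ℕ) : R) ≠ 0 := Nat.cast_ne_zero.2 Nat.card_pos.ne'
    refine ⟨⟨_, mem_nonZeroDivisors_of_ne_zero hn⟩, ?_⟩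
    change ((Nat.card (M ⧸ N) : ℕ) : R) • x = 0
    rw [Nat.cast_smul_eq_nsmul, card_nsmul_eq_zero']
  omega

/-- The Smith normal form used here yields a cyclic decomposition without divisibility relations;
exchanging pairs for lcm and gcd turns it into a chain. -/
theorem exists_isCotype (b : Module.Basis (Fin 3) R M) (N : Submodule R M) [Finite (M ⧸ N)] :
    ∃ a, IsCotype 3 N a := by
  have h := finrank_eq_of_finite_quotient b N
  obtain ⟨a₀, a₁, a₂, h₀, h₁, h₂, h10, h21, ⟨e⟩⟩ := exists_chain_quotient_span_equiv
    (Submodule.smithNormalFormCoeffs_ne_zero b h 0) (Submodule.smithNormalFormCoeffs_ne_zero b h 1)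
    (Submodule.smithNormalFormCoeffs_ne_zero b h 2)
    ((N.quotientEquivPiSpan b h).trans (piFinThreeEquiv _))
  let I : Fin 3 → Ideal R := ![Ideal.span {a₀}, Ideal.span {a₁}, Ideal.span {a₂}]
  refine ⟨fun i => Nat.card (R ⧸ I i), I, ?_, ?_,
    ⟨e.trans (piFinThreeEquiv fun i => R ⧸ I i).symm⟩, fun _ => rfl⟩
  · rw [Fin.monotone_iff_le_succ]
    intro i
    fin_cases i
    · exact Ideal.span_singleton_le_span_singleton.2 h10
    · exact Ideal.span_singleton_le_span_singleton.2 h21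
  · intro i
    fin_cases i
    · simpa [I] using h₀
    · simpa [I] using h₁
    · simpa [I] using h₂

theorem isCotype_cotype (b : Module.Basis (Fin 3) R M) (N : Submodule R M) [Finite (M ⧸ N)] :
    IsCotype 3 N (cotype 3 N) := by
  have h := exists_isCotype b N
  rw [cotype, dif_pos h]
  exact h.choose_spec

theorem prod_cotype (b : Module.Basis (Fin 3) R M) (N : Submodule R M) [Finite (M ⧸ N)] :
    ∏ i, cotype 3 N i = Nat.card (M ⧸ N) := by
  obtain ⟨I, -, -, ⟨e⟩, h⟩ := isCotype_cotype b N
  rw [Nat.card_congr e.toEquiv, Nat.card_pi]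
  exact Finset.prod_congr rfl fun i _ => h i

end Existence

/-! ### A crude count of submodules of given index -/

section Counting

variable {R : Type*} [CommRing R] [IsDomain R] [IsPrincipalIdealRing R] [CharZero R]

/-- A submodule of index `n` of `R ^ 3` is determined by the classes modulo `n` of the entries of
a generating matrix. -/
theorem card_submodule_le {n : ℕ} (hn : 0 < n) [Finite (R ⧸ Ideal.span {(n : R)})]
    (hR : Nat.card (R ⧸ Ideal.span {(n : R)}) ≤ n) :
    Finite {N : Submodule R (Fin 3 → R) // Nat.card ((Fin 3 → R) ⧸ N) = n} ∧
    Nat.card {N : Submodule R (Fin 3 → R) // Nat.card ((Fin 3 → R) ⧸ N) = n} ≤ n ^ 9 := by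
  have key : ∀ N : {N : Submodule R (Fin 3 → R) // Nat.card ((Fin 3 → R) ⧸ N) = n},
      ∃ v : Fin 3 → Fin 3 → R, Submodule.span R (Set.range v) = N.1 := by
    rintro ⟨N, hN⟩
    have : Finite ((Fin 3 → R) ⧸ N) := Nat.finite_of_card_ne_zero (by omega)
    have h := finrank_eq_of_finite_quotient (Pi.basisFun R (Fin 3)) N
    let B := Submodule.smithNormalFormBotBasis (Pi.basisFun R (Fin 3)) h
    refine ⟨fun i => B i, ?_⟩
    have := congrArg (Submodule.map N.subtype) B.span_eq
    rw [Submodule.map_span, Submodule.map_top, Submodule.range_subtype, ← Set.range_comp] at this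
    exact this
  choose v hv using key
  let F : {N : Submodule R (Fin 3 → R) // Nat.card ((Fin 3 → R) ⧸ N) = n} →
      (Fin 3 → Fin 3 → R ⧸ Ideal.span {(n : R)}) := fun N i j => Ideal.Quotient.mk _ (v N i j)
  -- Every submodule of index `n` contains `n R ^ 3`, so generators that agree modulo `n` generate
  -- the same submodule. The exponent 9 is the number of entries of a 3 × 3 matrix.
  have hle : ∀ N N', F N = F N' → N.1 ≤ N'.1 := by
    intro N N' h
    rw [← hv N, Submodule.span_le]
    rintro _ ⟨i, rfl⟩
    have : v N i - v N' i ∈ N'.1 := by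
      have h1 : ∀ j, ∃ c, v N i j - v N' i j = n * c := fun j =>
        Ideal.mem_span_singleton.1 (Ideal.Quotient.eq.1 (congrFun (congrFun h i) j))
      choose c hc using h1
      have h2 : v N i - v N' i = n • c := by
        ext j
        simp [hc]
      have h5 : Nat.card ((Fin 3 → R) ⧸ N'.1) • (Submodule.Quotient.mk c : (Fin 3 → R) ⧸ N'.1) = 0 :=
        card_nsmul_eq_zero'
      rwa [N'.2, ← Submodule.Quotient.mk_smul, Submodule.Quotient.mk_eq_zero, ← h2] at h5
    have h3 : v N' i ∈ N'.1 := by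
      have := Submodule.subset_span (R := R) (Set.mem_range_self (f := v N') i)
      rwa [hv N'] at this
    simpa using add_mem this h3
  have hF : Function.Injective F := fun N N' h =>
    Subtype.ext (le_antisymm (hle _ _ h) (hle _ _ h.symm))
  refine ⟨Finite.of_injective F hF, (Nat.card_le_card_of_injective F hF).trans ?_⟩
  simp only [Nat.card_pi, Finset.prod_const, Finset.card_univ, Fintype.card_fin, ← pow_mul]
  exact Nat.pow_le_pow_left hR 9

end Counting

/-! ### Summation over fibers of the index and absolute convergence -/

section Fibers

/-- Summation over the fibers of a map to `ℕ`. -/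
theorem summable_comp_iff_fiber {ι : Type*} (f : ι → ℕ) (hf : ∀ n, Finite {i // f i = n})
    (g : ℕ → ℂ) :
    Summable (fun i => g (f i)) ↔ Summable fun n => (Nat.card {i // f i = n} : ℂ) * g n := by
  have : ∀ n, Fintype {i // f i = n} := fun n => Fintype.ofFinite _
  rw [← summable_norm_iff, ← (Equiv.sigmaFiberEquiv f).summable_iff,
    summable_sigma_of_nonneg (f := (fun i => ‖g (f i)‖) ∘ Equiv.sigmaFiberEquiv f)
      (fun _ => norm_nonneg _),
    ← summable_norm_iff (f := fun n => (Nat.card {i // f i = n} : ℂ) * g n)]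
  have h : ∀ n, ∀ i : {i // f i = n}, ‖g (f (Equiv.sigmaFiberEquiv f ⟨n, i⟩))‖ = ‖g n‖ := by
    rintro n ⟨i, rfl⟩
    rfl
  simp only [Function.comp_apply, h, tsum_fintype, Finset.sum_const, Finset.card_univ,
    nsmul_eq_mul, norm_mul, Complex.norm_natCast, Nat.card_eq_fintype_card]
  exact ⟨fun h => h.2, fun h => ⟨fun n => Summable.of_finite, h⟩⟩

theorem tsum_comp_eq_fiber {ι : Type*} (f : ι → ℕ) (hf : ∀ n, Finite {i // f i = n})
    (g : ℕ → ℂ) (hs : Summable (fun i => g (f i))) :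
    ∑' i, g (f i) = ∑' n, (Nat.card {i // f i = n} : ℂ) * g n := by
  have : ∀ n, Fintype {i // f i = n} := fun n => Fintype.ofFinite _
  have hs' : Summable fun p => g (f (Equiv.sigmaFiberEquiv f p)) :=
    (Equiv.sigmaFiberEquiv f).summable_iff.2 hs
  rw [← (Equiv.sigmaFiberEquiv f).tsum_eq, hs'.tsum_sigma]
  have h : ∀ n, ∀ i : {i // f i = n}, g (f (Equiv.sigmaFiberEquiv f ⟨n, i⟩)) = g n := by
    rintro n ⟨i, rfl⟩
    rfl
  simp only [h, tsum_fintype, Finset.sum_const, Finset.card_univ, nsmul_eq_mul,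
    Nat.card_eq_fintype_card]

variable {R : Type*} [CommRing R] [IsDomain R] [IsPrincipalIdealRing R] [CharZero R]
  {M : Type*} [LieRing M] [LieAlgebra R M]

/-- The product of the `α_i` is the index `n`, and at most `n ^ 9` subalgebras have index `n`. For
real parts above 11 the series is thus dominated by `∑ n ^ (9 - 11)`. -/
theorem summable_cotypeTerm (b : Module.Basis (Fin 3) R M)
    (hR : ∀ n : ℕ, 0 < n → Finite (R ⧸ Ideal.span {(n : R)}) ∧
      Nat.card (R ⧸ Ideal.span {(n : R)}) ≤ n)
    (s : Fin 3 → ℂ) (hs : ∀ i, 11 < (s i).re) : Summable (cotypeTerm R M 3 s) := by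
  let f : FinIndexSubalgebra R M → ℕ := fun S => Nat.card (M ⧸ S.1.toSubmodule)
  have hpos : ∀ S, 0 < f S := fun S => by
    have := S.2
    exact Nat.card_pos
  have hfib : ∀ n, Finite {S // f S = n} ∧ Nat.card {S // f S = n} ≤ n ^ 9 := by
    intro n
    rcases Nat.eq_zero_or_pos n with rfl | hn
    · have : IsEmpty {S // f S = 0} := ⟨fun S => (hpos S.1).ne' S.2⟩
      exact ⟨inferInstance, by simp⟩
    · obtain ⟨h1, h2⟩ := hR n hn
      obtain ⟨h3, h4⟩ := card_submodule_le hn h2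
      let F : {S // f S = n} → {N : Submodule R (Fin 3 → R) // Nat.card ((Fin 3 → R) ⧸ N) = n} :=
        fun S => ⟨S.1.1.toSubmodule.map b.equivFun.toLinearMap, by
          rw [card_quotient_map]; exact S.2⟩
      have hF : Function.Injective F := by
        intro S S' h
        apply Subtype.ext
        apply Subtype.ext
        apply LieSubalgebra.toSubmodule_injective
        exact Submodule.map_injective_of_injective b.equivFun.injective (congrArg Subtype.val h)
      exact ⟨Finite.of_injective F hF, (Nat.card_le_card_of_injective F hF).trans h4⟩
  have hsum : Summable (fun S => (fun n : ℕ => (((n : ℝ) ^ (-11 : ℝ) : ℝ) : ℂ)) (f S)) := by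
    rw [summable_comp_iff_fiber f (fun n => (hfib n).1)
      (fun n : ℕ => (((n : ℝ) ^ (-11 : ℝ) : ℝ) : ℂ))]
    refine Summable.of_norm_bounded (g := fun n : ℕ => (n : ℝ) ^ (-2 : ℝ))
      (Real.summable_nat_rpow.2 (by norm_num)) fun n => ?_
    rcases Nat.eq_zero_or_pos n with rfl | hn
    · simp
    have hn' : (0 : ℝ) < n := Nat.cast_pos.2 hn
    rw [norm_mul, Complex.norm_natCast, Complex.norm_real, Real.norm_of_nonneg (by positivity)]
    calc (Nat.card {S // f S = n} : ℝ) * (n : ℝ) ^ (-11 : ℝ)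
        ≤ (n : ℝ) ^ (9 : ℝ) * (n : ℝ) ^ (-11 : ℝ) := by
          gcongr
          have := (hfib n).2
          exact_mod_cast this
      _ = (n : ℝ) ^ (-2 : ℝ) := by rw [← Real.rpow_add hn']; norm_num
  refine Summable.of_norm_bounded hsum.norm fun S => ?_
  have := S.2
  have hprod := prod_cotype b S.1.toSubmodule
  have hc : ∀ i, 0 < cotype 3 S.1.toSubmodule i := fun i => Nat.pos_of_ne_zero fun h =>
    (hpos S).ne' (by
      change Nat.card _ = 0
      rw [← hprod]
      exact Finset.prod_eq_zero (Finset.mem_univ i) h)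
  rw [Complex.norm_real, Real.norm_of_nonneg (by positivity), cotypeTerm, norm_prod]
  change _ ≤ ((Nat.card (M ⧸ S.1.toSubmodule) : ℕ) : ℝ) ^ (-11 : ℝ)
  rw [← hprod, Nat.cast_prod, ← Real.finsetProd_rpow _ _ (fun _ _ => Nat.cast_nonneg _)]
  refine Finset.prod_le_prod (fun _ _ => norm_nonneg _) fun i _ => ?_
  rw [Complex.norm_natCast_cpow_of_pos (hc i), Complex.neg_re]
  exact Real.rpow_le_rpow_of_exponent_le (by exact_mod_cast hc i) (by linarith [hs i])

end Fibers

end CotypeZeta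

namespace CotypeZeta

open Matrix

/-! ### Corank in terms of elementary abelian quotients -/

section Corank

theorem corank_le_iff_forall {R M : Type*} [CommRing R] [AddCommGroup M] [Module R M] (d m : ℕ)
    (N : Submodule R M) : corank d N ≤ m ↔ ∀ i : Fin d, m ≤ i → cotype d N i = 1 := by
  unfold corank
  rw [Finset.sup_le_iff]
  constructor
  · intro h i hi
    by_contra hne
    have := h i (Finset.mem_univ i)
    rw [if_pos hne] at this
    omega
  · intro h i _
    split_ifs with hne
    · by_contra hlt
      exact hne (h i (by omega))
    · exact Nat.zero_le _

theorem not_surjective_of_range_le_span {q k m : ℕ} [Fact q.Prime] {X : Type*}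
    (φ : X → (Fin m → ZMod q)) (v : Fin k → (Fin m → ZMod q)) (hkm : k < m)
    (h : ∀ x, φ x ∈ Submodule.span (ZMod q) (Set.range v)) : ¬ Function.Surjective φ := by
  intro hs
  have htop : Submodule.span (ZMod q) (Set.range v) = ⊤ := by
    rw [eq_top_iff]
    intro w _
    obtain ⟨x, rfl⟩ := hs w
    exact h x
  have h1 := finrank_range_le_card (R := ZMod q) v
  rw [Set.finrank, htop, finrank_top, Module.finrank_fin_fun, Fintype.card_fin] at h1
  omega

theorem exists_prime_le_span {I : Ideal ℤ} (h : Nat.card (ℤ ⧸ I) ≠ 1) :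
    ∃ q : ℕ, q.Prime ∧ I ≤ Ideal.span {(q : ℤ)} := by
  obtain ⟨g, hg⟩ := IsPrincipalIdealRing.principal I
  have hg' : I = Ideal.span {g} := hg
  have h1 : g.natAbs ≠ 1 := by
    intro h1
    apply h
    have : I = ⊤ := by
      rw [hg', Ideal.span_singleton_eq_top]
      exact Int.isUnit_iff_natAbs_eq.2 h1
    subst this
    have : Subsingleton (ℤ ⧸ (⊤ : Ideal ℤ)) := Ideal.Quotient.subsingleton_iff.2 rfl
    exact Nat.card_unique
  obtain ⟨q, hq, hqg⟩ := Nat.exists_prime_and_dvd h1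
  refine ⟨q, hq, ?_⟩
  rw [hg', Ideal.span_singleton_le_span_singleton]
  exact Int.natCast_dvd.2 hqg

/-- The corank of `N` is at most `m` if and only if `ℤ³ / N` has no quotient `(ℤ / q) ^ (m + 1)`. -/
theorem corank_le_iff (N : Submodule ℤ (Fin 3 → ℤ)) [Finite ((Fin 3 → ℤ) ⧸ N)] (m : ℕ) :
    corank 3 N ≤ m ↔ ∀ q : ℕ, q.Prime → ∀ φ : (Fin 3 → ℤ) →ₗ[ℤ] (Fin (m + 1) → ZMod q),
      N ≤ LinearMap.ker φ → ¬ Function.Surjective φ := by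
  obtain ⟨I, hmono, -, ⟨e⟩, hcard⟩ := isCotype_cotype (Pi.basisFun ℤ (Fin 3)) N
  rw [corank_le_iff_forall]
  constructor
  · intro h q hq φ hφ
    have : Fact q.Prime := ⟨hq⟩
    let ψ := (N.liftQ φ hφ).comp e.symm.toLinearMap
    -- The summands with index at least `m` are trivial, so the images of the first `m` cyclic
    -- generators span the image, which has dimension at most `m`.
    let v : Fin m → (Fin (m + 1) → ZMod q) := fun k =>
      if hk : (k : ℕ) < 3 then ψ (Pi.single ⟨k, hk⟩ 1) else 0
    refine not_surjective_of_range_le_span φ v (Nat.lt_succ_self m) fun x => ?_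
    have hx : φ x = ψ (e (Submodule.Quotient.mk x)) := by
      change φ x = N.liftQ φ hφ (e.symm (e (Submodule.Quotient.mk x)))
      rw [e.symm_apply_apply, Submodule.liftQ_apply]
    rw [hx]
    generalize e (Submodule.Quotient.mk x) = y
    have hy : y = ∑ i, Pi.single i (y i) := (Finset.univ_sum_single y).symm
    rw [hy, map_sum]
    refine sum_mem fun i _ => ?_
    by_cases him : (i : ℕ) < m
    · obtain ⟨z, hz⟩ := Ideal.Quotient.mk_surjective (y i)
      have h1 : Pi.single i (y i) = z • (Pi.single i 1 : ∀ i, ℤ ⧸ I i) := by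
        rw [← Pi.single_smul, ← hz]
        congr 1
        rw [zsmul_eq_mul, mul_one]
        rfl
      rw [h1, map_smul, ← Int.cast_smul_eq_zsmul (ZMod q)]
      refine Submodule.smul_mem _ _ (Submodule.subset_span ⟨⟨i, him⟩, ?_⟩)
      simp [v]
    · have hc := h i (by omega)
      rw [hcard] at hc
      have := (Nat.card_eq_one_iff_unique.1 hc).1
      rw [Subsingleton.elim (y i) 0, Pi.single_zero, map_zero]
      exact zero_mem _
  · intro h i hi
    by_contra hne
    rw [hcard i] at hne
    obtain ⟨q, hq, hqI⟩ := exists_prime_le_span hne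
    have hle : ∀ k : Fin (m + 1), (k : ℕ) < 3 := fun k => by omega
    let j : Fin (m + 1) → Fin 3 := fun k => ⟨k, hle k⟩
    -- If the summand with index `i ≥ m` is nontrivial, the chain gives `I 0 ≤ … ≤ I i ≤ (q)`, and
    -- so each of the first `m + 1` summands surjects onto `ℤ / q`.
    let χ : ∀ k, (ℤ ⧸ I (j k)) →ₗ[ℤ] ZMod q := fun k =>
      Submodule.liftQ (I (j k)) (Int.castAddHom (ZMod q)).toIntLinearMap (by
        intro x hx
        have h1 : x ∈ Ideal.span {(q : ℤ)} := hqI (hmono (by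
          rw [Fin.le_def]; change (k : ℕ) ≤ i; omega) hx)
        rw [Ideal.mem_span_singleton] at h1
        exact (ZMod.intCast_zmod_eq_zero_iff_dvd x q).2 h1)
    refine h q hq ((LinearMap.pi fun k => (χ k).comp (LinearMap.proj (j k))).comp
      (e.toLinearMap.comp N.mkQ)) ?_ ?_
    · intro x hx
      have : N.mkQ x = 0 := by simpa using hx
      rw [LinearMap.mem_ker, LinearMap.comp_apply, LinearMap.comp_apply, this, map_zero, map_zero]
    · intro w
      let y : ∀ i, ℤ ⧸ I i := fun i => Submodule.Quotient.mk
        (if hi : (i : ℕ) < m + 1 then ((w ⟨i, hi⟩).cast : ℤ) else 0)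
      obtain ⟨x, hx⟩ := N.mkQ_surjective (e.symm y)
      refine ⟨x, ?_⟩
      rw [LinearMap.comp_apply, LinearMap.comp_apply, hx]
      ext k
      have hk : (k : ℕ) < m + 1 := k.2
      simp only [LinearEquiv.coe_coe, LinearEquiv.apply_symm_apply, LinearMap.pi_apply,
        LinearMap.comp_apply, LinearMap.proj_apply, y, j, χ, dif_pos hk]
      exact ZMod.intCast_zmod_cast _

theorem corank_le_of_le {N N' : Submodule ℤ (Fin 3 → ℤ)} [Finite ((Fin 3 → ℤ) ⧸ N)]
    [Finite ((Fin 3 → ℤ) ⧸ N')] (h : N ≤ N') {m : ℕ} (hm : corank 3 N ≤ m) : corank 3 N' ≤ m := by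
  rw [corank_le_iff] at hm ⊢
  exact fun q hq φ hφ => hm q hq φ (h.trans hφ)

end Corank

/-! ### Multiplicativity of the subalgebra count -/

section Multiplicativity

theorem nsmul_mem_of_card_quotient {M : Type*} [AddCommGroup M] {N : Submodule ℤ M} {n : ℕ}
    (h : Nat.card (M ⧸ N) = n) (x : M) : (n : ℤ) • x ∈ N := by
  subst h
  rw [← Submodule.Quotient.mk_eq_zero, Submodule.Quotient.mk_smul, Nat.cast_smul_eq_nsmul]
  exact card_nsmul_eq_zero'

/-- Suppose `φ` maps to a vector space over `ℤ / q` and kills `N₁ ⊓ N₂`. One of `n₁`, `n₂` is prime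
to `q`, say `n₁`. For `x ∈ N₂` the multiple `n₁ x` lies in both submodules, so `φ x = 0`; thus `φ`
kills `N₂` and cannot be surjective. -/
theorem corank_inf_le {N₁ N₂ : Submodule ℤ (Fin 3 → ℤ)} {n₁ n₂ m : ℕ} (hn₁ : 0 < n₁) (hn₂ : 0 < n₂)
    (hco : n₁.Coprime n₂) (h₁ : Nat.card ((Fin 3 → ℤ) ⧸ N₁) = n₁)
    (h₂ : Nat.card ((Fin 3 → ℤ) ⧸ N₂) = n₂) [Finite ((Fin 3 → ℤ) ⧸ (N₁ ⊓ N₂))]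
    (hm₁ : corank 3 N₁ ≤ m) (hm₂ : corank 3 N₂ ≤ m) : corank 3 (N₁ ⊓ N₂) ≤ m := by
  have : Finite ((Fin 3 → ℤ) ⧸ N₁) := Nat.finite_of_card_ne_zero (by omega)
  have : Finite ((Fin 3 → ℤ) ⧸ N₂) := Nat.finite_of_card_ne_zero (by omega)
  rw [corank_le_iff] at hm₁ hm₂ ⊢
  intro q hq φ hφ
  have : Fact q.Prime := ⟨hq⟩
  have aux : ∀ n : ℕ, ¬ q ∣ n → ∀ x, (n : ℤ) • x ∈ N₁ ⊓ N₂ → φ x = 0 := by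
    intro n hn x hx
    have h0 := hφ hx
    rw [LinearMap.mem_ker, map_smul] at h0
    ext k
    have hk := congrFun h0 k
    simp only [Pi.smul_apply, Pi.zero_apply, zsmul_eq_mul, Int.cast_natCast] at hk
    exact (mul_eq_zero.1 hk).resolve_left fun h => hn ((ZMod.natCast_eq_zero_iff n q).1 h)
  by_cases hq2 : q ∣ n₂
  · have hq1 : ¬ q ∣ n₁ := fun hq1 => hq.one_lt.ne' (Nat.dvd_one.1 (hco ▸ Nat.dvd_gcd hq1 hq2))
    exact hm₂ q hq φ fun x hx => aux n₁ hq1 x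
      ⟨nsmul_mem_of_card_quotient h₁ x, Submodule.smul_mem _ _ hx⟩
  · exact hm₁ q hq φ fun x hx => aux n₂ hq2 x
      ⟨Submodule.smul_mem _ _ hx, nsmul_mem_of_card_quotient h₂ x⟩

theorem card_quotient_inf {M : Type*} [AddCommGroup M] {N₁ N₂ : Submodule ℤ M} {n₁ n₂ : ℕ}
    (hn₁ : 0 < n₁) (hn₂ : 0 < n₂) (hco : n₁.Coprime n₂) (h₁ : Nat.card (M ⧸ N₁) = n₁)
    (h₂ : Nat.card (M ⧸ N₂) = n₂) : Nat.card (M ⧸ (N₁ ⊓ N₂)) = n₁ * n₂ := by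
  have e1 : N₁.toAddSubgroup.index = n₁ := h₁
  have e2 : N₂.toAddSubgroup.index = n₂ := h₂
  change (N₁.toAddSubgroup ⊓ N₂.toAddSubgroup).index = n₁ * n₂
  have hle : (N₁.toAddSubgroup ⊓ N₂.toAddSubgroup).index ≤ n₁ * n₂ := by
    rw [← e1, ← e2]; exact AddSubgroup.index_inf_le
  have hne : (N₁.toAddSubgroup ⊓ N₂.toAddSubgroup).index ≠ 0 :=
    AddSubgroup.index_inf_ne_zero (by omega) (by omega)
  refine le_antisymm hle (Nat.le_of_dvd (Nat.pos_of_ne_zero hne) ?_)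
  refine hco.mul_dvd_of_dvd_of_dvd ?_ ?_
  · rw [← e1]; exact AddSubgroup.index_dvd_of_le inf_le_left
  · rw [← e2]; exact AddSubgroup.index_dvd_of_le inf_le_right

/-- The submodule `N + n M`. -/
def addMultiples {M : Type*} [AddCommGroup M] (N : Submodule ℤ M) (n : ℕ) : Submodule ℤ M :=
  N ⊔ LinearMap.range (LinearMap.lsmul ℤ M n)

theorem mem_addMultiples {M : Type*} [AddCommGroup M] {N : Submodule ℤ M} {n : ℕ} {x : M} :
    x ∈ addMultiples N n ↔ ∃ a ∈ N, ∃ u : M, x = a + (n : ℤ) • u := by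
  unfold addMultiples
  rw [Submodule.mem_sup]
  constructor
  · rintro ⟨a, ha, _, ⟨u, rfl⟩, rfl⟩
    exact ⟨a, ha, u, rfl⟩
  · rintro ⟨a, ha, u, rfl⟩
    exact ⟨a, ha, _, ⟨u, rfl⟩, rfl⟩

/-- By Bézout `x = r n₁ x + s n₂ x`. If `x` lies in `N + n₂ M`, then `n₁ x` lies in `N + n₁ n₂ M =
N`, and symmetrically for `n₂ x`. -/
theorem addMultiples_inf {M : Type*} [AddCommGroup M] {N : Submodule ℤ M} {n₁ n₂ : ℕ}
    (hco : n₁.Coprime n₂) (h : ∀ x, ((n₁ * n₂ : ℕ) : ℤ) • x ∈ N) :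
    addMultiples N n₁ ⊓ addMultiples N n₂ = N := by
  obtain ⟨r, s, hrs⟩ := Nat.isCoprime_iff_coprime.2 hco
  apply le_antisymm
  · rintro x ⟨h1, h2⟩
    obtain ⟨a, ha, u, hu⟩ := mem_addMultiples.1 h1
    obtain ⟨b, hb, v, hv⟩ := mem_addMultiples.1 h2
    have e : x = r • ((n₁ : ℤ) • b + ((n₁ * n₂ : ℕ) : ℤ) • v) +
        s • ((n₂ : ℤ) • a + ((n₁ * n₂ : ℕ) : ℤ) • u) := by
      have e1 : (n₁ : ℤ) • b + ((n₁ * n₂ : ℕ) : ℤ) • v = (n₁ : ℤ) • x := by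
        rw [hv]; push_cast; module
      have e2 : (n₂ : ℤ) • a + ((n₁ * n₂ : ℕ) : ℤ) • u = (n₂ : ℤ) • x := by
        rw [hu]; push_cast; module
      rw [e1, e2, smul_smul, smul_smul, ← add_smul, hrs, one_smul]
    rw [e]
    exact add_mem
      (Submodule.smul_mem _ _ (add_mem (Submodule.smul_mem _ _ hb) (h v)))
      (Submodule.smul_mem _ _ (add_mem (Submodule.smul_mem _ _ ha) (h u)))
  · exact le_inf le_sup_left le_sup_left

theorem inf_addMultiples {M : Type*} [AddCommGroup M] {N₁ N₂ : Submodule ℤ M} {n₁ n₂ : ℕ}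
    (hco : n₁.Coprime n₂) (h₁ : ∀ x, (n₁ : ℤ) • x ∈ N₁) (h₂ : ∀ x, (n₂ : ℤ) • x ∈ N₂) :
    addMultiples (N₁ ⊓ N₂) n₁ = N₁ := by
  obtain ⟨r, s, hrs⟩ := Nat.isCoprime_iff_coprime.2 hco
  ext x
  rw [mem_addMultiples]
  constructor
  · rintro ⟨a, ha, u, rfl⟩
    exact add_mem ha.1 (h₁ u)
  · intro hx
    refine ⟨(s * n₂) • x, ⟨Submodule.smul_mem _ _ hx, ?_⟩, r • x, ?_⟩
    · rw [mul_smul]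
      exact Submodule.smul_mem _ _ (h₂ x)
    · rw [smul_smul, ← add_smul, mul_comm (n₁ : ℤ) r, add_comm, hrs, one_smul]

/-- The quotient is killed by `n₁`, so by Cauchy's theorem every prime dividing its order divides
`n₁`. -/
theorem coprime_card_quotient_addMultiples {M : Type*} [AddCommGroup M] {N : Submodule ℤ M}
    {n₁ n₂ : ℕ} (hco : n₁.Coprime n₂) [Finite (M ⧸ addMultiples N n₁)] :
    (Nat.card (M ⧸ addMultiples N n₁)).Coprime n₂ := by
  refine Nat.Coprime.symm (Nat.coprime_of_dvd fun q hq h2 h1 => ?_)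
  have : Fact q.Prime := ⟨hq⟩
  obtain ⟨x, hx⟩ := exists_prime_addOrderOf_dvd_card' q h1
  obtain ⟨y, rfl⟩ := Submodule.Quotient.mk_surjective _ x
  have h0 : n₁ • (Submodule.Quotient.mk y : M ⧸ addMultiples N n₁) = 0 := by
    rw [← Submodule.Quotient.mk_smul, Submodule.Quotient.mk_eq_zero, mem_addMultiples]
    exact ⟨0, zero_mem _, y, by rw [zero_add, Nat.cast_smul_eq_nsmul]⟩
  have := addOrderOf_dvd_iff_nsmul_eq_zero.2 h0
  rw [hx] at this
  exact hq.one_lt.ne' (Nat.dvd_one.1 (hco ▸ Nat.dvd_gcd this h2))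

theorem finite_quotient_of_le {M : Type*} [AddCommGroup M] {N N' : Submodule ℤ M} (h : N ≤ N')
    [Finite (M ⧸ N)] : Finite (M ⧸ N') :=
  Finite.of_surjective (Submodule.factor h) (Submodule.factor_surjective h)

theorem card_quotient_addMultiples {M : Type*} [AddCommGroup M] {N : Submodule ℤ M}
    {n₁ n₂ : ℕ} (hn₁ : 0 < n₁) (hn₂ : 0 < n₂) (hco : n₁.Coprime n₂)
    (h : Nat.card (M ⧸ N) = n₁ * n₂) :
    Nat.card (M ⧸ addMultiples N n₁) = n₁ ∧ Nat.card (M ⧸ addMultiples N n₂) = n₂ := by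
  have : Finite (M ⧸ N) := Nat.finite_of_card_ne_zero (by rw [h]; positivity)
  have f1 : Finite (M ⧸ addMultiples N n₁) := finite_quotient_of_le le_sup_left
  have f2 : Finite (M ⧸ addMultiples N n₂) := finite_quotient_of_le le_sup_left
  have c1 := coprime_card_quotient_addMultiples (N := N) hco
  have c2 := coprime_card_quotient_addMultiples (N := N) hco.symm
  have hd : ∀ n, Nat.card (M ⧸ addMultiples N n) ∣ n₁ * n₂ := fun n => by
    rw [← h]
    exact AddSubgroup.index_dvd_of_le (H := N.toAddSubgroup) (K := (addMultiples N n).toAddSubgroup)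
      (le_sup_left (a := N))
  have d1 := c1.dvd_of_dvd_mul_right (hd n₁)
  have d2 := c2.dvd_of_dvd_mul_left (hd n₂)
  have hmul := card_quotient_inf Nat.card_pos Nat.card_pos
    ((hco.coprime_dvd_left d1).coprime_dvd_right d2) (rfl) (rfl) (M := M)
    (N₁ := addMultiples N n₁) (N₂ := addMultiples N n₂)
  rw [addMultiples_inf hco (fun x => nsmul_mem_of_card_quotient h x), h] at hmul
  have l1 := Nat.le_of_dvd hn₁ d1
  have l2 := Nat.le_of_dvd hn₂ d2
  constructor
  · by_contra hne
    have : Nat.card (M ⧸ addMultiples N n₁) < n₁ := by omega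
    have := Nat.mul_lt_mul_of_lt_of_le this l2 hn₂
    omega
  · by_contra hne
    have : Nat.card (M ⧸ addMultiples N n₂) < n₂ := by omega
    have := Nat.mul_lt_mul_of_le_of_lt l1 this hn₁
    omega

/-- Every term of the expanded bracket other than that of `a` and `b` is a multiple of `n`. -/
theorem ClosedUnder.addMultiples {A : Matrix (Fin 3) (Fin 3) ℤ} {N : Submodule ℤ (Fin 3 → ℤ)}
    (h : ClosedUnder A N) (n : ℕ) : ClosedUnder A (addMultiples N n) := by
  intro x hx y hy
  obtain ⟨a, ha, u, rfl⟩ := mem_addMultiples.1 hx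
  obtain ⟨b, hb, v, rfl⟩ := mem_addMultiples.1 hy
  refine mem_addMultiples.2 ⟨_, h a ha b hb,
    (crossProduct a v + crossProduct u b + (n : ℤ) • crossProduct u v) ᵥ* A, ?_⟩
  simp only [map_add, map_smul, LinearMap.add_apply, LinearMap.smul_apply, add_vecMul, smul_vecMul]
  module

theorem ClosedUnder.inf {A : Matrix (Fin 3) (Fin 3) ℤ} {N N' : Submodule ℤ (Fin 3 → ℤ)}
    (h : ClosedUnder A N) (h' : ClosedUnder A N') : ClosedUnder A (N ⊓ N') :=
  fun x hx y hy => ⟨h x hx.1 y hy.1, h' x hx.2 y hy.2⟩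

/-- The submodules of `ℤ³` of index `n` and corank at most `m` that are closed under the bracket
defined by `A`. -/
def ClosedOfIndex (A : Matrix (Fin 3) (Fin 3) ℤ) (m n : ℕ) : Type :=
  -- `Nat.card` of an infinite quotient is 0, so `n ≠ 0` is what excludes infinite index.
  {N : Submodule ℤ (Fin 3 → ℤ) // (n ≠ 0 ∧ Nat.card ((Fin 3 → ℤ) ⧸ N) = n) ∧ ClosedUnder A N ∧
    corank 3 N ≤ m}

/-- The number of subalgebras of index `n` and corank at most `m`. -/
noncomputable def subCount (A : Matrix (Fin 3) (Fin 3) ℤ) (m n : ℕ) : ℕ :=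
  Nat.card (ClosedOfIndex A m n)

theorem card_int_quotient (n : ℕ) (hn : 0 < n) :
    Finite (ℤ ⧸ Ideal.span {(n : ℤ)}) ∧ Nat.card (ℤ ⧸ Ideal.span {(n : ℤ)}) ≤ n := by
  have : NeZero n := ⟨hn.ne'⟩
  have e := Int.quotientSpanNatEquivZMod n
  exact ⟨Finite.of_equiv _ e.symm.toEquiv, by rw [Nat.card_congr e.toEquiv, Nat.card_zmod]⟩

instance finite_closedOfIndex (A : Matrix (Fin 3) (Fin 3) ℤ) (m n : ℕ) :
    Finite (ClosedOfIndex A m n) := by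
  rcases Nat.eq_zero_or_pos n with rfl | hn
  · have : IsEmpty (ClosedOfIndex A m 0) := ⟨fun N => N.2.1.1 rfl⟩
    infer_instance
  · have := (card_int_quotient n hn).1
    have := (card_submodule_le hn (card_int_quotient n hn).2).1
    refine Finite.of_injective (β := {N : Submodule ℤ (Fin 3 → ℤ) //
      Nat.card ((Fin 3 → ℤ) ⧸ N) = n}) (fun N => ⟨N.1, N.2.1.2⟩) fun N N' h => ?_
    exact Subtype.ext (congrArg (fun N => N.1) h)

theorem subCount_zero (A : Matrix (Fin 3) (Fin 3) ℤ) (m : ℕ) : subCount A m 0 = 0 := by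
  have : IsEmpty (ClosedOfIndex A m 0) := ⟨fun N => N.2.1.1 rfl⟩
  exact Nat.card_of_isEmpty

/-- The maps `N ↦ (N + n₁ ℤ³, N + n₂ ℤ³)` and `(N₁, N₂) ↦ N₁ ⊓ N₂` are mutually inverse and respect
index, closedness and the bound on the corank. -/
theorem subCount_mul (A : Matrix (Fin 3) (Fin 3) ℤ) (m : ℕ) {n₁ n₂ : ℕ} (hco : n₁.Coprime n₂) :
    subCount A m (n₁ * n₂) = subCount A m n₁ * subCount A m n₂ := by
  rcases Nat.eq_zero_or_pos n₁ with rfl | hn₁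
  · simp [subCount_zero]
  rcases Nat.eq_zero_or_pos n₂ with rfl | hn₂
  · simp [subCount_zero]
  unfold subCount
  rw [← Nat.card_prod]
  refine Nat.card_congr ⟨fun N => ⟨⟨addMultiples N.1 n₁, ?_⟩, ⟨addMultiples N.1 n₂, ?_⟩⟩,
    fun N => ⟨N.1.1 ⊓ N.2.1, ?_⟩, ?_, ?_⟩
  · obtain ⟨N, ⟨h0, hN⟩, hA, hm⟩ := N
    have : Finite ((Fin 3 → ℤ) ⧸ N) := Nat.finite_of_card_ne_zero (by omega)
    have : Finite ((Fin 3 → ℤ) ⧸ addMultiples N n₁) := finite_quotient_of_le le_sup_left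
    exact ⟨⟨hn₁.ne', (card_quotient_addMultiples hn₁ hn₂ hco hN).1⟩, hA.addMultiples n₁,
      corank_le_of_le (N := N) (N' := addMultiples N n₁) le_sup_left hm⟩
  · obtain ⟨N, ⟨h0, hN⟩, hA, hm⟩ := N
    have : Finite ((Fin 3 → ℤ) ⧸ N) := Nat.finite_of_card_ne_zero (by omega)
    have : Finite ((Fin 3 → ℤ) ⧸ addMultiples N n₂) := finite_quotient_of_le le_sup_left
    exact ⟨⟨hn₂.ne', (card_quotient_addMultiples hn₁ hn₂ hco hN).2⟩, hA.addMultiples n₂,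
      corank_le_of_le (N := N) (N' := addMultiples N n₂) le_sup_left hm⟩
  · obtain ⟨⟨N₁, ⟨-, h1⟩, hA1, hm1⟩, ⟨N₂, ⟨-, h2⟩, hA2, hm2⟩⟩ := N
    have hc := card_quotient_inf hn₁ hn₂ hco h1 h2
    have : Finite ((Fin 3 → ℤ) ⧸ (N₁ ⊓ N₂)) :=
      Nat.finite_of_card_ne_zero (by rw [hc]; positivity)
    exact ⟨⟨by positivity, hc⟩, hA1.inf hA2, corank_inf_le hn₁ hn₂ hco h1 h2 hm1 hm2⟩
  · rintro ⟨N, ⟨h0, hN⟩, hA, hm⟩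
    exact Subtype.ext (addMultiples_inf hco fun x => nsmul_mem_of_card_quotient hN x)
  · rintro ⟨⟨N₁, ⟨-, h1⟩, hA1, hm1⟩, ⟨N₂, ⟨-, h2⟩, hA2, hm2⟩⟩
    refine Prod.ext (Subtype.ext ?_) (Subtype.ext ?_)
    · exact inf_addMultiples hco (fun x => nsmul_mem_of_card_quotient h1 x)
        (fun x => nsmul_mem_of_card_quotient h2 x)
    · change addMultiples (N₁ ⊓ N₂) n₂ = N₂
      rw [inf_comm]
      exact inf_addMultiples hco.symm (fun x => nsmul_mem_of_card_quotient h2 x)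
        (fun x => nsmul_mem_of_card_quotient h1 x)

theorem subCount_one (A : Matrix (Fin 3) (Fin 3) ℤ) (m : ℕ) : subCount A m 1 = 1 := by
  have htop : ∀ N : Submodule ℤ (Fin 3 → ℤ), Nat.card ((Fin 3 → ℤ) ⧸ N) = 1 → N = ⊤ := by
    intro N hN
    rw [eq_top_iff]
    intro x _
    simpa using nsmul_mem_of_card_quotient hN x
  have hcard : Nat.card ((Fin 3 → ℤ) ⧸ (⊤ : Submodule ℤ (Fin 3 → ℤ))) = 1 := Nat.card_unique
  have hu : Unique (ClosedOfIndex A m 1) :=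
    { default := ⟨⊤, ⟨one_ne_zero, hcard⟩, fun _ _ _ _ => trivial, by
        have hp := prod_cotype (Pi.basisFun ℤ (Fin 3)) (⊤ : Submodule ℤ (Fin 3 → ℤ))
        rw [hcard, Finset.prod_eq_one_iff] at hp
        rw [corank_le_iff_forall]
        exact fun i _ => hp i (Finset.mem_univ i)⟩
      uniq := fun N => Subtype.ext (htop _ N.2.1.2) }
  exact Nat.card_unique

end Multiplicativity

end CotypeZeta

namespace CotypeZeta

open Matrix

/-! ### The count as an invariant of the integral form, and its Dirichlet series -/

section CountInvariance

/-- This allows the form to be normalized by an integral change of basis before anything is counted.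
-/
theorem subCount_eq_of_quadForm {A A' P : Matrix (Fin 3) (Fin 3) ℤ} (hP : IsUnit P.det)
    (h : ∀ x, quadForm A' (P *ᵥ x) = quadForm A x) (m n : ℕ) : subCount A' m n = subCount A m n := by
  let g : (Fin 3 → ℤ) ≃ₗ[ℤ] (Fin 3 → ℤ) := LinearEquiv.ofBijective P.vecMulLinear (by
    constructor
    · intro x y hxy
      have := congrArg (· ᵥ* P⁻¹) hxy
      simpa [vecMul_vecMul, mul_nonsing_inv _ hP] using this
    · intro x
      exact ⟨x ᵥ* P⁻¹, by simp [vecMul_vecMul, nonsing_inv_mul _ hP]⟩)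
  refine Nat.card_congr (Equiv.subtypeEquiv (Submodule.orderIsoMapComap g).toEquiv fun N => ?_)
  have e : (Submodule.orderIsoMapComap g).toEquiv N = N.map g.toLinearMap := rfl
  rw [e, card_quotient_map, corank_map, ← closedUnder_map_iff isUnit_one hP
    (fun x => (h x).trans (one_mul _).symm)]
  rfl

variable {L : Type*} [LieRing L]

theorem lieMatrix_eq_structureMatrix (b : Module.Basis (Fin 3) ℤ L) :
    lieMatrix b = structureMatrix b := rfl

/-- The index of a finite-index subalgebra of bounded corank. -/
noncomputable def corankIndex (L : Type*) [LieRing L] (m : ℕ) (S : CorankSubalgebra ℤ L 3 m) : ℕ :=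
  Nat.card (L ⧸ S.1.1.toSubmodule)

/-- Finite-index subalgebras in coordinates. -/
noncomputable def corankIndexFiberEquiv (b : Module.Basis (Fin 3) ℤ L) (m n : ℕ) :
    {S // corankIndex L m S = n} ≃ ClosedOfIndex (structureMatrix b) m n where
  toFun S := ⟨S.1.1.1.toSubmodule.map b.equivFun.toLinearMap, by
    obtain ⟨⟨⟨S, hS⟩, hm⟩, hn⟩ := S
    refine ⟨⟨?_, ?_⟩, ?_, ?_⟩
    · rintro rfl
      exact Nat.card_pos.ne' hn
    · rw [card_quotient_map]
      exact hn
    · rw [← lieMatrix_eq_structureMatrix, closedUnder_map_equivFun]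
      exact fun x hx y hy => S.lie_mem hx hy
    · rw [corank_map]
      exact hm⟩
  invFun N := ⟨⟨⟨{ N.1.map b.equivFun.symm.toLinearMap with
      lie_mem' := fun {x y} hx hy => by
        refine (closedUnder_map_equivFun b (N.1.map b.equivFun.symm.toLinearMap)).1 ?_ x hx y hy
        rw [← Submodule.map_comp, LinearEquiv.comp_coe, LinearEquiv.symm_trans_self,
          LinearEquiv.refl_toLinearMap, Submodule.map_id]
        exact N.2.2.1 },
      by
        have : Finite ((Fin 3 → ℤ) ⧸ N.1) :=
          Nat.finite_of_card_ne_zero (by rw [N.2.1.2]; exact N.2.1.1)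
        exact (finite_quotient_map b.equivFun.symm N.1).2 this⟩,
      (corank_map b.equivFun.symm 3 N.1).trans_le N.2.2.2⟩,
    (card_quotient_map b.equivFun.symm N.1).trans N.2.1.2⟩
  left_inv S := by
    apply Subtype.ext
    apply Subtype.ext
    apply Subtype.ext
    apply LieSubalgebra.toSubmodule_injective
    change (S.1.1.1.toSubmodule.map b.equivFun.toLinearMap).map b.equivFun.symm.toLinearMap = _
    rw [← Submodule.map_comp, LinearEquiv.comp_coe, LinearEquiv.self_trans_symm,
      LinearEquiv.refl_toLinearMap, Submodule.map_id]
  right_inv N := by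
    apply Subtype.ext
    change (N.1.map b.equivFun.symm.toLinearMap).map b.equivFun.toLinearMap = _
    rw [← Submodule.map_comp, LinearEquiv.comp_coe, LinearEquiv.symm_trans_self,
      LinearEquiv.refl_toLinearMap, Submodule.map_id]

theorem finite_corankIndex_fiber (b : Module.Basis (Fin 3) ℤ L) (m n : ℕ) :
    Finite {S // corankIndex L m S = n} :=
  Finite.of_equiv _ (corankIndexFiberEquiv b m n).symm

theorem summable_corankTerm_iff (b : Module.Basis (Fin 3) ℤ L) (m : ℕ) (s : ℂ) :
    Summable (corankTerm ℤ L 3 m s) ↔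
      Summable fun n : ℕ => (subCount (structureMatrix b) m n : ℂ) * (n : ℂ) ^ (-s) := by
  have h := summable_comp_iff_fiber (corankIndex L m) (finite_corankIndex_fiber b m)
    (fun n : ℕ => (n : ℂ) ^ (-s))
  simp only [Nat.card_congr (corankIndexFiberEquiv b m _)] at h
  exact h

theorem corankZeta_eq_tsum (b : Module.Basis (Fin 3) ℤ L) (m : ℕ) {s : ℂ}
    (hs : Summable (corankTerm ℤ L 3 m s)) :
    corankZeta ℤ L 3 m s =
      ∑' n : ℕ, (subCount (structureMatrix b) m n : ℂ) * (n : ℂ) ^ (-s) := by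
  have h := tsum_comp_eq_fiber (corankIndex L m) (finite_corankIndex_fiber b m)
    (fun n : ℕ => (n : ℂ) ^ (-s)) hs
  simp only [Nat.card_congr (corankIndexFiberEquiv b m _)] at h
  exact h

end CountInvariance

/-! ### Hermite normal forms; lower and upper bounds for the count -/

section Hermite

theorem exists_nat_generator (I : Submodule ℤ ℤ) {c : ℤ} (hc : c ≠ 0) (h : c ∈ I) :
    ∃ d : ℕ, 0 < d ∧ (d : ℤ) ∈ I ∧ ∀ a ∈ I, (d : ℤ) ∣ a := by
  obtain ⟨g, hg⟩ := IsPrincipalIdealRing.principal I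
  have hmem : ∀ a ∈ I, g ∣ a := fun a ha => by
    rw [hg] at ha
    exact Ideal.mem_span_singleton.1 ha
  refine ⟨g.natAbs, ?_, ?_, fun a ha => Int.natAbs_dvd.2 (hmem a ha)⟩
  · rw [Int.natAbs_pos]
    rintro rfl
    exact hc (zero_dvd_iff.1 (hmem c h))
  · have : g ∈ I := by rw [hg]; exact Submodule.mem_span_singleton_self g
    rcases Int.natAbs_eq g with h | h
    · rwa [← h]
    · rw [← neg_neg ((g.natAbs : ℕ) : ℤ), ← h]
      exact neg_mem this

theorem card_quotient_span_triangular {d₁ d₂ d₃ : ℕ} (h₁ : 0 < d₁) (h₂ : 0 < d₂) (h₃ : 0 < d₃)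
    (x y z : ℤ) : Nat.card ((Fin 3 → ℤ) ⧸ Submodule.span ℤ
      (Set.range ![![(d₁ : ℤ), x, y], ![0, (d₂ : ℤ), z], ![0, 0, (d₃ : ℤ)]])) = d₁ * d₂ * d₃ := by
  set v : Fin 3 → Fin 3 → ℤ := ![![(d₁ : ℤ), x, y], ![0, (d₂ : ℤ), z], ![0, 0, (d₃ : ℤ)]] with hv
  have hdet : (Matrix.of v).det = d₁ * d₂ * d₃ := by
    rw [det_fin_three]
    simp [hv]
  have hli : LinearIndependent ℤ v := by
    have : (Matrix.of v).det ≠ 0 := by rw [hdet]; positivity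
    exact Matrix.linearIndependent_rows_of_det_ne_zero this
  have h := Submodule.natAbs_det_basis_change (Pi.basisFun ℤ (Fin 3)) _
    (Module.Basis.span hli)
  have e : ((↑) ∘ Module.Basis.span hli : Fin 3 → Fin 3 → ℤ) = v := by
    ext i
    simp [Module.Basis.span_apply]
  rw [e, Pi.basisFun_det_apply] at h
  change (Matrix.of v).det.natAbs = _ at h
  rw [← h, hdet]
  simp [Int.natAbs_mul]

/-- Hermite normal form. -/
theorem exists_triangular_generators {N : Submodule ℤ (Fin 3 → ℤ)} {D : ℕ} (hD : 0 < D)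
    (hN : Nat.card ((Fin 3 → ℤ) ⧸ N) = D) :
    ∃ d₁ d₂ d₃ x y z : ℕ, d₁ * d₂ * d₃ = D ∧ x < d₂ ∧ y < d₃ ∧ z < d₃ ∧
      N = Submodule.span ℤ (Set.range
        ![![(d₁ : ℤ), (x : ℤ), (y : ℤ)], ![0, (d₂ : ℤ), (z : ℤ)], ![0, 0, (d₃ : ℤ)]]) := by
  have hmem := nsmul_mem_of_card_quotient hN
  have hD' : (D : ℤ) ≠ 0 := by exact_mod_cast hD.ne'
  let π : Fin 3 → ((Fin 3 → ℤ) →ₗ[ℤ] ℤ) := fun i => LinearMap.proj i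
  -- The pivots generate the successive projections: coordinate 0 of `N`, coordinate 1 of the
  -- vectors of `N` with `v 0 = 0`, and coordinate 2 of those with `v 0 = v 1 = 0`.
  obtain ⟨d₁, h₁, ⟨u, hu, hu0⟩, h₁d⟩ := exists_nat_generator (N.map (π 0)) hD'
    ⟨_, hmem ![1, 0, 0], by simp [π]⟩
  obtain ⟨d₂, h₂, ⟨v, ⟨hv, hv0⟩, hv1⟩, h₂d⟩ :=
    exists_nat_generator ((N ⊓ LinearMap.ker (π 0)).map (π 1)) hD'
    ⟨_, ⟨hmem ![0, 1, 0], by simp [π]⟩, by simp [π]⟩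
  obtain ⟨d₃, h₃, ⟨w, ⟨hw, hw01⟩, hw2⟩, h₃d⟩ :=
    exists_nat_generator ((N ⊓ (LinearMap.ker (π 0) ⊓ LinearMap.ker (π 1))).map (π 2)) hD'
    ⟨_, ⟨hmem ![0, 0, 1], by simp [π]⟩, by simp [π]⟩
  obtain ⟨hw0, hw1⟩ := hw01
  change u 0 = d₁ at hu0
  change v 0 = 0 at hv0
  change v 1 = d₂ at hv1
  change w 0 = 0 at hw0
  change w 1 = 0 at hw1
  change w 2 = d₃ at hw2
  have p2 : (0 : ℤ) < d₂ := by exact_mod_cast h₂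
  have p3 : (0 : ℤ) < d₃ := by exact_mod_cast h₃
  -- Entries above the pivots are reduced from the bottom row upwards. Subtracting multiples of `w`
  -- changes only the last coordinate, so the middle entry of `u₁` stays reduced.
  let v' := v - (v 2 / d₃) • w
  have hv' : v' ∈ N := sub_mem hv (Submodule.smul_mem _ _ hw)
  let u₁ := u - (u 1 / d₂) • v'
  have hu₁ : u₁ ∈ N := sub_mem hu (Submodule.smul_mem _ _ hv')
  let u' := u₁ - (u₁ 2 / d₃) • w
  have hu' : u' ∈ N := sub_mem hu₁ (Submodule.smul_mem _ _ hw)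
  have ev0 : v' 0 = 0 := by simp [v', hv0, hw0]
  have ev1 : v' 1 = d₂ := by simp [v', hv1, hw1]
  have ev2 : v' 2 = v 2 % d₃ := by
    simp only [v', Pi.sub_apply, Pi.smul_apply, smul_eq_mul, hw2]
    rw [Int.emod_def]; ring
  have eu0 : u' 0 = d₁ := by simp [u', u₁, hu0, ev0, hw0]
  have eu1 : u' 1 = u 1 % d₂ := by
    simp only [u', u₁, Pi.sub_apply, Pi.smul_apply, smul_eq_mul, hw1, ev1]
    rw [Int.emod_def]; ring
  have eu2 : u' 2 = u₁ 2 % d₃ := by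
    simp only [u', Pi.sub_apply, Pi.smul_apply, smul_eq_mul, hw2]
    rw [Int.emod_def]; ring
  obtain ⟨x, hx⟩ := Int.eq_ofNat_of_zero_le (Int.emod_nonneg (u 1) p2.ne')
  obtain ⟨y, hy⟩ := Int.eq_ofNat_of_zero_le (Int.emod_nonneg (u₁ 2) p3.ne')
  obtain ⟨z, hz⟩ := Int.eq_ofNat_of_zero_le (Int.emod_nonneg (v 2) p3.ne')
  have lx := Int.emod_lt_of_pos (u 1) p2
  have ly := Int.emod_lt_of_pos (u₁ 2) p3
  have lz := Int.emod_lt_of_pos (v 2) p3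
  rw [hx] at lx eu1
  rw [hy] at ly eu2
  rw [hz] at lz ev2
  have heq : N = Submodule.span ℤ (Set.range
        ![![(d₁ : ℤ), (x : ℤ), (y : ℤ)], ![0, (d₂ : ℤ), (z : ℤ)], ![0, 0, (d₃ : ℤ)]]) := by
    have r0 : u' = ![(d₁ : ℤ), (x : ℤ), (y : ℤ)] := by
      ext i; fin_cases i
      exacts [eu0, eu1, eu2]
    have r1 : v' = ![0, (d₂ : ℤ), (z : ℤ)] := by
      ext i; fin_cases i
      exacts [ev0, ev1, ev2]
    have r2 : w = ![0, 0, (d₃ : ℤ)] := by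
      ext i; fin_cases i
      exacts [hw0, hw1, hw2]
    rw [← r0, ← r1, ← r2]
    apply le_antisymm
    · intro a ha
      have s0 : u' ∈ Submodule.span ℤ (Set.range ![u', v', w]) := Submodule.subset_span ⟨0, rfl⟩
      have s1 : v' ∈ Submodule.span ℤ (Set.range ![u', v', w]) := Submodule.subset_span ⟨1, rfl⟩
      have s2 : w ∈ Submodule.span ℤ (Set.range ![u', v', w]) := Submodule.subset_span ⟨2, rfl⟩
      obtain ⟨c₁, hc₁⟩ := h₁d (a 0) ⟨a, ha, rfl⟩
      have ha1 : a - c₁ • u' ∈ N := sub_mem ha (Submodule.smul_mem _ _ hu')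
      have z1 : (a - c₁ • u') 0 = 0 := by simp [eu0, hc₁, mul_comm]
      obtain ⟨c₂, hc₂⟩ := h₂d ((a - c₁ • u') 1) ⟨_, ⟨ha1, z1⟩, rfl⟩
      have ha2 : a - c₁ • u' - c₂ • v' ∈ N := sub_mem ha1 (Submodule.smul_mem _ _ hv')
      have z2 : (a - c₁ • u' - c₂ • v') 0 = 0 := by
        rw [Pi.sub_apply, z1, Pi.smul_apply, ev0, smul_zero, sub_zero]
      have z3 : (a - c₁ • u' - c₂ • v') 1 = 0 := by
        rw [Pi.sub_apply, hc₂, Pi.smul_apply, ev1, smul_eq_mul, mul_comm, sub_self]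
      obtain ⟨c₃, hc₃⟩ := h₃d ((a - c₁ • u' - c₂ • v') 2) ⟨_, ⟨ha2, z2, z3⟩, rfl⟩
      have z4 : a - c₁ • u' - c₂ • v' = c₃ • w := by
        ext i; fin_cases i
        · simpa [hw0] using z2
        · simpa [hw1] using z3
        · simpa [hw2, mul_comm] using hc₃
      have : a = c₁ • u' + c₂ • v' + c₃ • w := by rw [← z4]; module
      rw [this]
      exact add_mem (add_mem (Submodule.smul_mem _ _ s0) (Submodule.smul_mem _ _ s1))
        (Submodule.smul_mem _ _ s2)
    · rw [Submodule.span_le]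
      rintro _ ⟨i, rfl⟩
      fin_cases i
      exacts [hu', hv', hw]
  refine ⟨d₁, d₂, d₃, x, y, z, ?_, by exact_mod_cast lx, by exact_mod_cast ly,
    by exact_mod_cast lz, heq⟩
  rw [← card_quotient_span_triangular h₁ h₂ h₃ x y z, ← heq, hN]

theorem dvd_det_of_mem_span {d₁ d₂ d₃ x y z : ℤ} {a b c : Fin 3 → ℤ}
    (ha : a ∈ Submodule.span ℤ (Set.range ![![d₁, x, y], ![0, d₂, z], ![0, 0, d₃]]))
    (hb : b ∈ Submodule.span ℤ (Set.range ![![d₁, x, y], ![0, d₂, z], ![0, 0, d₃]]))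
    (hc : c ∈ Submodule.span ℤ (Set.range ![![d₁, x, y], ![0, d₂, z], ![0, 0, d₃]])) :
    d₁ * d₂ * d₃ ∣ crossProduct a b ⬝ᵥ c := by
  obtain ⟨r, rfl⟩ := (Submodule.mem_span_range_iff_exists_fun ℤ).1 ha
  obtain ⟨s, rfl⟩ := (Submodule.mem_span_range_iff_exists_fun ℤ).1 hb
  obtain ⟨t, rfl⟩ := (Submodule.mem_span_range_iff_exists_fun ℤ).1 hc
  refine ⟨(r 1 * s 2 - r 2 * s 1) * t 0 + (r 2 * s 0 - r 0 * s 2) * t 1 +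
    (r 0 * s 1 - r 1 * s 0) * t 2, ?_⟩
  simp [Fin.sum_univ_three, cross_apply, dotProduct]
  ring

/-- The number `f(a × b)` is the determinant of `a`, `b` and their bracket `(a × b) A`. All three
lie in the lattice, so its covolume divides the determinant. -/
theorem ClosedUnder.dvd_quadForm {A : Matrix (Fin 3) (Fin 3) ℤ} {d₁ d₂ d₃ x y z : ℤ}
    (h : ClosedUnder A (Submodule.span ℤ (Set.range ![![d₁, x, y], ![0, d₂, z], ![0, 0, d₃]])))
    {a b : Fin 3 → ℤ}
    (ha : a ∈ Submodule.span ℤ (Set.range ![![d₁, x, y], ![0, d₂, z], ![0, 0, d₃]]))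
    (hb : b ∈ Submodule.span ℤ (Set.range ![![d₁, x, y], ![0, d₂, z], ![0, 0, d₃]])) :
    d₁ * d₂ * d₃ ∣ quadForm A (crossProduct a b) := by
  have := dvd_det_of_mem_span ha hb (h a ha b hb)
  rwa [dotProduct_comm, ← dotProduct_mulVec] at this

/-- The Hermite normal forms with diagonal `(p ^ (n - j - k), p ^ j, p ^ k)` that satisfy two
necessary conditions for spanning a subalgebra. The entries are listed as `((x, z), y)`. -/
def hermiteSet (A : Matrix (Fin 3) (Fin 3) ℤ) (p n j k : ℕ) : Finset ((ℕ × ℕ) × ℕ) :=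
  ((Finset.range (p ^ j) ×ˢ Finset.range (p ^ k)) ×ˢ Finset.range (p ^ k)).filter fun t =>
    (p : ℤ) ^ n ∣ quadForm A
      ![(t.1.1 : ℤ) * t.1.2 - t.2 * p ^ j, -(t.1.2 * p ^ (n - j - k)), p ^ (n - k)] ∧
    (p : ℤ) ^ n ∣ quadForm A ![-(t.1.1 * p ^ k), p ^ (n - j), 0]

theorem exists_hermite {A : Matrix (Fin 3) (Fin 3) ℤ} {p m n : ℕ} (hp : p.Prime)
    (N : ClosedOfIndex A m (p ^ n)) :
    ∃ j k : ℕ, ∃ t : (ℕ × ℕ) × ℕ, j + k ≤ n ∧ t ∈ hermiteSet A p n j k ∧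
      N.1 = Submodule.span ℤ (Set.range ![![(p : ℤ) ^ (n - j - k), t.1.1, t.2],
        ![0, (p : ℤ) ^ j, t.1.2], ![0, 0, (p : ℤ) ^ k]]) := by
  obtain ⟨N, ⟨-, hN⟩, hA, -⟩ := N
  obtain ⟨d₁, d₂, d₃, x, y, z, hd, hx, hy, hz, rfl⟩ :=
    exists_triangular_generators (pow_pos hp.pos n) hN
  obtain ⟨i, -, rfl⟩ := (Nat.dvd_prime_pow hp).1 (⟨d₂ * d₃, by rw [← hd]; ring⟩ : d₁ ∣ p ^ n)
  obtain ⟨j, -, rfl⟩ := (Nat.dvd_prime_pow hp).1 (⟨p ^ i * d₃, by rw [← hd]; ring⟩ : d₂ ∣ p ^ n)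
  obtain ⟨k, -, rfl⟩ := (Nat.dvd_prime_pow hp).1
    (⟨p ^ i * p ^ j, by rw [← hd]; ring⟩ : d₃ ∣ p ^ n)
  rw [← pow_add, ← pow_add] at hd
  have hn := Nat.pow_right_injective hp.two_le hd
  have hi : n - j - k = i := by omega
  have e0 : (![((p ^ i : ℕ) : ℤ), (x : ℤ), (y : ℤ)]) ∈ Submodule.span ℤ (Set.range
      ![![((p ^ i : ℕ) : ℤ), (x : ℤ), (y : ℤ)], ![0, ((p ^ j : ℕ) : ℤ), (z : ℤ)],
        ![0, 0, ((p ^ k : ℕ) : ℤ)]]) := Submodule.subset_span ⟨0, rfl⟩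
  have e1 : (![0, ((p ^ j : ℕ) : ℤ), (z : ℤ)]) ∈ Submodule.span ℤ (Set.range
      ![![((p ^ i : ℕ) : ℤ), (x : ℤ), (y : ℤ)], ![0, ((p ^ j : ℕ) : ℤ), (z : ℤ)],
        ![0, 0, ((p ^ k : ℕ) : ℤ)]]) := Submodule.subset_span ⟨1, rfl⟩
  have e2 : (![0, 0, ((p ^ k : ℕ) : ℤ)]) ∈ Submodule.span ℤ (Set.range
      ![![((p ^ i : ℕ) : ℤ), (x : ℤ), (y : ℤ)], ![0, ((p ^ j : ℕ) : ℤ), (z : ℤ)],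
        ![0, 0, ((p ^ k : ℕ) : ℤ)]]) := Submodule.subset_span ⟨2, rfl⟩
  have q1 := hA.dvd_quadForm e0 e1
  have q2 := hA.dvd_quadForm e2 e0
  refine ⟨j, k, ((x, z), y), by omega, ?_, ?_⟩
  · simp only [hermiteSet, Finset.mem_filter, Finset.mem_product, Finset.mem_range]
    refine ⟨⟨⟨hx, hz⟩, hy⟩, ?_, ?_⟩
    · rw [hi]
      have hk : n - k = i + j := by omega
      rw [hk, ← hn]
      convert q1 using 2
      · push_cast; ring
      · rw [cross_apply]
        ext l; fin_cases l <;> simp <;> ring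
    · have hk : n - j = i + k := by omega
      rw [hk, ← hn]
      convert q2 using 2
      · push_cast; ring
      · rw [cross_apply]
        ext l; fin_cases l <;> simp <;> ring
  · simp only [hi]
    push_cast
    rfl

theorem subCount_le_sum (A : Matrix (Fin 3) (Fin 3) ℤ) {p : ℕ} (hp : p.Prime) (m n : ℕ) :
    subCount A m (p ^ n) ≤ ∑ jk ∈ (Finset.range (n + 1) ×ˢ Finset.range (n + 1)).filter
      (fun jk => jk.1 + jk.2 ≤ n), (hermiteSet A p n jk.1 jk.2).card := by
  choose j k t hjk ht hN using fun N : ClosedOfIndex A m (p ^ n) => exists_hermite hp N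
  rw [← Finset.card_sigma, subCount, ← Nat.card_eq_finsetCard]
  refine Nat.card_le_card_of_injective (fun N => ⟨⟨(j N, k N), t N⟩, ?_⟩) fun N N' h => ?_
  · simp only [Finset.mem_sigma, Finset.mem_filter, Finset.mem_product, Finset.mem_range]
    have := hjk N
    exact ⟨⟨⟨by omega, by omega⟩, this⟩, ht N⟩
  · have h' := congrArg Subtype.val h
    simp only [Sigma.mk.injEq, Prod.mk.injEq, heq_eq_eq] at h'
    obtain ⟨⟨h1, h2⟩, h3⟩ := h'
    refine Subtype.ext ?_
    rw [hN N, hN N', h1, h2, h3]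

/-- The number of solutions modulo `p ^ e` of `f(-y, -z, 1) = 0`. -/
def affineCount (A : Matrix (Fin 3) (Fin 3) ℤ) (p e : ℕ) : ℕ :=
  ((Finset.range (p ^ e) ×ˢ Finset.range (p ^ e)).filter fun t : ℕ × ℕ =>
    (p : ℤ) ^ e ∣ quadForm A ![-(t.2 : ℤ), -(t.1 : ℤ), 1]).card

/-- The lattice `{v : v₂ ≡ y v₀ + z v₁ mod D}`. -/
def congruenceLattice (D : ℕ) (y z : ℤ) : Submodule ℤ (Fin 3 → ℤ) where
  carrier := {v | (D : ℤ) ∣ v 2 - y * v 0 - z * v 1}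
  add_mem' := by
    rintro a b ⟨r, hr⟩ ⟨s, hs⟩
    exact ⟨r + s, by simp only [Pi.add_apply]; linear_combination hr + hs⟩
  zero_mem' := by simp
  smul_mem' := by
    rintro c a ⟨r, hr⟩
    exact ⟨c * r, by simp only [Pi.smul_apply, smul_eq_mul]; linear_combination c * hr⟩

theorem mem_congruenceLattice {D : ℕ} {y z : ℤ} {v : Fin 3 → ℤ} :
    v ∈ congruenceLattice D y z ↔ (D : ℤ) ∣ v 2 - y * v 0 - z * v 1 := Iff.rfl

theorem card_quotient_congruenceLattice {D : ℕ} (hD : 0 < D) (y z : ℤ) :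
    Nat.card ((Fin 3 → ℤ) ⧸ congruenceLattice D y z) = D := by
  have h := card_quotient_span_triangular one_pos one_pos hD 0 y z
  rw [one_mul, one_mul] at h
  refine Eq.trans ?_ h
  congr 3
  ext v
  rw [mem_congruenceLattice, Submodule.mem_span_range_iff_exists_fun]
  constructor
  · rintro ⟨c, hc⟩
    refine ⟨![v 0, v 1, c], ?_⟩
    ext i
    fin_cases i
    · simp [Fin.sum_univ_three]
    · simp [Fin.sum_univ_three]
    · simp [Fin.sum_univ_three]
      linear_combination -hc
  · rintro ⟨c, rfl⟩
    refine ⟨c 2, ?_⟩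
    simp [Fin.sum_univ_three]
    ring

/-- The lattice consists of the vectors orthogonal to `u = (-y, -z, 1)` modulo `D`. For `a`, `b` in
it, `a × b` is congruent to `(a 0 * b 1 - a 1 * b 0) u`, so pairing the bracket with `u` gives a
multiple of `f(u)` modulo `D`. -/
theorem closedUnder_congruenceLattice {A : Matrix (Fin 3) (Fin 3) ℤ} {D : ℕ} {y z : ℤ}
    (h : (D : ℤ) ∣ quadForm A ![-y, -z, 1]) : ClosedUnder A (congruenceLattice D y z) := by
  rintro a ⟨r, hr⟩ b ⟨s, hs⟩
  obtain ⟨t, ht⟩ := h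
  rw [mem_congruenceLattice]
  simp only [quadForm_eq, Matrix.cons_val_zero, Matrix.cons_val_one, Matrix.cons_val] at ht
  have ha : a 2 = y * a 0 + z * a 1 + D * r := by linear_combination hr
  have hb : b 2 = y * b 0 + z * b 1 + D * s := by linear_combination hs
  simp only [cross_apply, vecMul, dotProduct, Fin.sum_univ_three, Matrix.cons_val_zero,
    Matrix.cons_val_one, Matrix.cons_val]
  rw [ha, hb]
  refine ⟨(a 0 * b 1 - a 1 * b 0) * t + (a 1 * s - b 1 * r) * (A 0 2 - y * A 0 0 - z * A 0 1) +
    (b 0 * r - a 0 * s) * (A 1 2 - y * A 1 0 - z * A 1 1), ?_⟩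
  linear_combination (a 0 * b 1 - a 1 * b 0) * ht

/-- Modulo the lattice, `x` is the multiple `x 2 - y x 0 - z x 1` of the last basis vector, so the
quotient is cyclic. -/
theorem corank_congruenceLattice_le {D : ℕ} (hD : 0 < D) (y z : ℤ) {m : ℕ} (hm : 1 ≤ m) :
    corank 3 (congruenceLattice D y z) ≤ m := by
  have : Finite ((Fin 3 → ℤ) ⧸ congruenceLattice D y z) :=
    Nat.finite_of_card_ne_zero (by rw [card_quotient_congruenceLattice hD]; omega)
  rw [corank_le_iff]
  intro q hq φ hφ
  have : Fact q.Prime := ⟨hq⟩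
  refine not_surjective_of_range_le_span (k := 1) φ (fun _ => φ ![0, 0, 1]) (by omega) fun x => ?_
  have h1 : φ (x - (x 2 - y * x 0 - z * x 1) • ![0, 0, 1]) = 0 := hφ (by
    rw [mem_congruenceLattice]
    refine ⟨0, ?_⟩
    simp
    ring)
  rw [map_sub, sub_eq_zero, map_smul, ← Int.cast_smul_eq_zsmul (ZMod q)] at h1
  rw [h1]
  exact Submodule.smul_mem _ _ (Submodule.subset_span ⟨0, rfl⟩)

/-- Distinct residues `(y, z)` give distinct lattices. Their corank is at most 1, hence the bound is
available for every `m ≥ 1`. -/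
theorem affineCount_le_subCount (A : Matrix (Fin 3) (Fin 3) ℤ) {p m : ℕ} (hp : p.Prime)
    (hm : 1 ≤ m) (e : ℕ) : affineCount A p e ≤ subCount A m (p ^ e) := by
  rw [affineCount, ← Nat.card_eq_finsetCard, subCount]
  have hD := pow_pos hp.pos e
  refine Nat.card_le_card_of_injective
    (fun t => ⟨congruenceLattice (p ^ e) t.1.2 t.1.1, ⟨hD.ne', card_quotient_congruenceLattice hD _ _⟩,
      closedUnder_congruenceLattice ?_, corank_congruenceLattice_le hD _ _ hm⟩) ?_
  · have := (Finset.mem_filter.1 t.2).2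
    push_cast
    exact this
  · rintro ⟨⟨z, y⟩, ht⟩ ⟨⟨z', y'⟩, ht'⟩ h
    have h' : congruenceLattice (p ^ e) y z = congruenceLattice (p ^ e) y' z' :=
      congrArg (fun N : ClosedOfIndex A m (p ^ e) => N.1) h
    simp only [Finset.mem_filter, Finset.mem_product, Finset.mem_range] at ht ht'
    have m0 : ![1, 0, (y : ℤ)] ∈ congruenceLattice (p ^ e) y z := by simp [mem_congruenceLattice]
    have m1 : ![0, 1, (z : ℤ)] ∈ congruenceLattice (p ^ e) y z := by simp [mem_congruenceLattice]
    rw [h', mem_congruenceLattice] at m0 m1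
    simp only [Matrix.cons_val_zero, Matrix.cons_val_one, Matrix.cons_val, mul_one, mul_zero,
      sub_zero] at m0 m1
    have hy : y' = y := Nat.ModEq.eq_of_lt_of_lt (Nat.modEq_iff_dvd.2 m0) ht'.1.2 ht.1.2
    have hz : z' = z := Nat.ModEq.eq_of_lt_of_lt (Nat.modEq_iff_dvd.2 m1) ht'.1.1 ht.1.1
    subst hy hz
    rfl

end Hermite

end CotypeZeta

namespace CotypeZeta

open Matrix

/-! ### Solutions of quadratic congruences modulo prime powers -/

section QuadraticCongruences

/-- For `e ≥ k` the truncated difference is 0 and the bound is 1, as it should be. -/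
theorem card_filter_residue_le {p : ℕ} (hp : p.Prime) (k e : ℕ) (c : ℤ) :
    ((Finset.range (p ^ k)).filter fun y : ℕ => (p : ℤ) ^ e ∣ (y : ℤ) - c).card ≤ p ^ (k - e) := by
  have he := pow_pos hp.pos e
  rw [← Finset.card_range (p ^ (k - e))]
  refine Finset.card_le_card_of_injOn (fun y => y / p ^ e) ?_ ?_
  · intro y hy
    simp only [Finset.coe_filter, Finset.mem_range, Set.mem_ofPred_eq, Finset.coe_range,
      Set.mem_Iio] at hy ⊢
    rw [Nat.div_lt_iff_lt_mul he, ← pow_add]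
    exact hy.1.trans_le (Nat.pow_le_pow_right hp.pos (by omega))
  · intro y hy y' hy' h
    simp only [Finset.coe_filter, Finset.mem_range, Set.mem_ofPred_eq] at hy hy' h
    have h1 : ((p ^ e : ℕ) : ℤ) ∣ (y' : ℤ) - y := by
      have := dvd_sub hy'.2 hy.2
      push_cast
      rwa [sub_sub_sub_cancel_right] at this
    have h2 : y % p ^ e = y' % p ^ e := Nat.modEq_iff_dvd.2 h1
    rw [← Nat.div_add_mod y (p ^ e), ← Nat.div_add_mod y' (p ^ e), h, h2]

theorem exists_pow_dvd_of_pow_dvd_mul {p : ℕ} (hp : p.Prime) {n : ℕ} {a b : ℤ}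
    (h : (p : ℤ) ^ n ∣ a * b) : ∃ i j, i + j = n ∧ (p : ℤ) ^ i ∣ a ∧ (p : ℤ) ^ j ∣ b := by
  have hp' : Prime (p : ℤ) := Nat.prime_iff_prime_int.1 hp
  obtain ⟨d, e, hd, he, hde⟩ := exists_dvd_and_dvd_of_dvd_mul h
  obtain ⟨i, -, hi⟩ := (dvd_prime_pow hp' n).1 (⟨e, hde⟩ : d ∣ (p : ℤ) ^ n)
  obtain ⟨j, -, hj⟩ := (dvd_prime_pow hp' n).1 (⟨d, by rw [hde, mul_comm]⟩ : e ∣ (p : ℤ) ^ n)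
  refine ⟨i, j, ?_, hi.symm.dvd.trans hd, hj.symm.dvd.trans he⟩
  have h1 : Associated ((p : ℤ) ^ n) ((p : ℤ) ^ (i + j)) := by
    rw [hde, pow_add]
    exact hi.mul_mul hj
  exact (pow_inj_of_not_isUnit hp'.not_isUnit hp'.ne_zero).1 (Int.eq_of_associated_of_nonneg h1.symm
    (by positivity) (by positivity))

theorem pow_dvd_of_not_pow_succ_dvd {p : ℕ} (hp : p.Prime) {h v : ℕ} {a b : ℤ}
    (ha : ¬ (p : ℤ) ^ (v + 1) ∣ a) (hab : (p : ℤ) ^ h ∣ a * b) : (p : ℤ) ^ (h - v) ∣ b := by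
  obtain ⟨i, j, hij, hi, hj⟩ := exists_pow_dvd_of_pow_dvd_mul hp hab
  have : i ≤ v := by
    by_contra hlt
    exact ha ((pow_dvd_pow _ (by omega)).trans hi)
  exact (pow_dvd_pow _ (by omega)).trans hj

/-- A quadratic congruence modulo `p ^ n` has few solutions in a residue class. -/
theorem card_quadratic_le {p : ℕ} (hp : p.Prime) {α β γ : ℤ} {v : ℕ}
    (hα : ¬ (p : ℤ) ^ (v + 1) ∣ α) (c : ℤ) (n j k : ℕ) :
    ((Finset.range (p ^ k)).filter fun y : ℕ =>
      (p : ℤ) ^ n ∣ α * (c - y * p ^ j) ^ 2 + β * (c - y * p ^ j) + γ).card ≤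
        2 * p ^ v * p ^ (k - ((n + 1) / 2 - j)) := by
  set S := (Finset.range (p ^ k)).filter fun y : ℕ =>
      (p : ℤ) ^ n ∣ α * (c - y * p ^ j) ^ 2 + β * (c - y * p ^ j) + γ with hS
  set h := (n + 1) / 2 with hh
  have hp0 : (p : ℤ) ≠ 0 := by exact_mod_cast hp.ne_zero
  rcases S.eq_empty_or_nonempty with he | ⟨y₀, hy₀⟩
  · simp [he]
  have cancel : ∀ (a : ℤ), (p : ℤ) ^ h ∣ a * p ^ j → (p : ℤ) ^ (h - j) ∣ a := by
    intro a ha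
    rw [mul_comm] at ha
    by_cases hj : j ≤ h
    · have e : (p : ℤ) ^ h = p ^ j * p ^ (h - j) := by rw [← pow_add]; congr 1; omega
      rw [e] at ha
      exact (mul_dvd_mul_iff_left (pow_ne_zero _ hp0)).1 ha
    · rw [Nat.sub_eq_zero_of_le (by omega)]
      simp
  -- The difference of the values at `y` and at `y₀` is `(y₀ - y) p ^ j` times a factor linear in
  -- `y`. If `p ^ n` divides it, then `p ^ h` with `h = ⌈n / 2⌉` divides one of the two factors;
  -- these cases are `E₁` and `E₂`.
  let E₁ := (Finset.range (p ^ k)).filter fun y : ℕ => (p : ℤ) ^ (h - j) ∣ (y : ℤ) - y₀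
  let E₂ := (Finset.range (p ^ k)).filter fun y : ℕ =>
    (p : ℤ) ^ h ∣ α * ((c - y * p ^ j) + (c - y₀ * p ^ j)) + β
  have hsub : S ⊆ E₁ ∪ E₂ := by
    intro y hy
    simp only [hS, Finset.mem_filter] at hy hy₀
    have h1 : (p : ℤ) ^ n ∣ ((y₀ - y) * p ^ j) * (α * ((c - y * p ^ j) + (c - y₀ * p ^ j)) + β) := by
      refine (congrArg (_ ∣ ·) ?_).mp (dvd_sub hy.2 hy₀.2)
      ring
    obtain ⟨i, l, hil, hi, hl⟩ := exists_pow_dvd_of_pow_dvd_mul hp h1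
    by_cases hih : h ≤ i
    · refine Finset.mem_union_left _ (Finset.mem_filter.2 ⟨hy.1, ?_⟩)
      rw [← dvd_neg, neg_sub]
      exact cancel _ ((pow_dvd_pow _ hih).trans hi)
    · exact Finset.mem_union_right _ (Finset.mem_filter.2
        ⟨hy.1, (pow_dvd_pow _ (by omega)).trans hl⟩)
  have hE₁ : E₁.card ≤ p ^ v * p ^ (k - (h - j)) :=
    (card_filter_residue_le hp k (h - j) y₀).trans
      (Nat.le_mul_of_pos_left _ (pow_pos hp.pos v))
  have hE₂ : E₂.card ≤ p ^ v * p ^ (k - (h - j)) := by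
    rcases E₂.eq_empty_or_nonempty with he | ⟨y₁, hy₁⟩
    · simp [he]
    -- Two members of `E₂` differ by a solution of a linear congruence with coefficient `α p ^ j`;
    -- dividing by `α` loses at most `p ^ v`.
    have hsub2 : E₂ ⊆ (Finset.range (p ^ k)).filter fun y : ℕ =>
        (p : ℤ) ^ (h - j - v) ∣ (y : ℤ) - y₁ := by
      intro y hy
      simp only [E₂, Finset.mem_filter] at hy hy₁ ⊢
      refine ⟨hy.1, ?_⟩
      have h1 : (p : ℤ) ^ h ∣ (α * (y - y₁)) * p ^ j := by
        refine (congrArg (_ ∣ ·) ?_).mp (dvd_sub hy₁.2 hy.2)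
        ring
      exact pow_dvd_of_not_pow_succ_dvd hp hα (cancel _ h1)
    refine (Finset.card_le_card hsub2).trans ((card_filter_residue_le hp k _ y₁).trans ?_)
    rw [← pow_add]
    exact Nat.pow_le_pow_right hp.pos (by omega)
  calc S.card ≤ E₁.card + E₂.card := (Finset.card_le_card hsub).trans (Finset.card_union_le _ _)
    _ ≤ 2 * p ^ v * p ^ (k - (h - j)) := by linarith

end QuadraticCongruences

/-! ### Bounds for the count at all prime powers -/

section HermiteBounds

theorem card_filter_product_le {s t : Type*} [DecidableEq s] {S : Finset s} {T : Finset t}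
    (P : s × t → Prop) [DecidablePred P] {B : ℕ}
    (h : ∀ a ∈ S, (T.filter fun b => P (a, b)).card ≤ B) :
    ((S ×ˢ T).filter P).card ≤ S.card * B := by
  rw [Finset.card_filter, Finset.sum_product, ← smul_eq_mul]
  refine Finset.sum_le_card_nsmul _ _ _ fun a ha => ?_
  rw [← Finset.card_filter]
  exact h a ha

theorem card_hermiteSet_le_trivial (A : Matrix (Fin 3) (Fin 3) ℤ) (p n j k : ℕ) :
    (hermiteSet A p n j k).card ≤ p ^ (j + k + k) := by
  refine (Finset.card_filter_le _ _).trans ?_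
  simp [pow_add]

/-- For fixed `x` and `z` the first condition is a quadratic congruence in `x z - y p ^ j` with
leading coefficient `A 0 0`. -/
theorem card_hermiteSet_le {A : Matrix (Fin 3) (Fin 3) ℤ} {p : ℕ} (hp : p.Prime) {v : ℕ}
    (hα : ¬ (p : ℤ) ^ (v + 1) ∣ A 0 0) (n j k : ℕ) :
    (hermiteSet A p n j k).card ≤ 2 * p ^ v * p ^ (j + k + (k - ((n + 1) / 2 - j))) := by
  have h := card_filter_product_le (S := Finset.range (p ^ j) ×ˢ Finset.range (p ^ k))
    (T := Finset.range (p ^ k)) (fun t : (ℕ × ℕ) × ℕ => (p : ℤ) ^ n ∣ quadForm A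
      ![(t.1.1 : ℤ) * t.1.2 - t.2 * p ^ j, -(t.1.2 * p ^ (n - j - k)), p ^ (n - k)])
    (B := 2 * p ^ v * p ^ (k - ((n + 1) / 2 - j))) (by
      rintro ⟨x, z⟩ -
      refine le_trans (le_of_eq ?_) (card_quadratic_le hp hα ((x : ℤ) * z) n j k
        (β := (A 0 1 + A 1 0) * -(z * p ^ (n - j - k)) + (A 0 2 + A 2 0) * p ^ (n - k))
        (γ := quadForm A ![0, -(z * p ^ (n - j - k)), p ^ (n - k)]))
      congr 1
      refine Finset.filter_congr fun y _ => ?_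
      refine Eq.to_iff (congrArg _ ?_)
      simp [quadForm_eq]
      ring)
  refine (Finset.card_le_card (Finset.monotone_filter_right _ fun t _ ht => ht.1)).trans
    (h.trans (le_of_eq ?_))
  simp only [Finset.card_product, Finset.card_range]
  ring

theorem subCount_le_of_card_le {A : Matrix (Fin 3) (Fin 3) ℤ} {p : ℕ} (hp : p.Prime) (m n : ℕ)
    {B : ℕ} (h : ∀ j k, j + k ≤ n → (hermiteSet A p n j k).card ≤ B) :
    subCount A m (p ^ n) ≤ (n + 1) ^ 2 * B := by
  refine (subCount_le_sum A hp m n).trans ((Finset.sum_le_card_nsmul _ _ B fun jk hjk =>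
    h _ _ (Finset.mem_filter.1 hjk).2).trans ?_)
  rw [smul_eq_mul]
  refine Nat.mul_le_mul_right _ ((Finset.card_filter_le _ _).trans ?_)
  simp [sq]

theorem subCount_le_trivial (A : Matrix (Fin 3) (Fin 3) ℤ) {p : ℕ} (hp : p.Prime) (m n : ℕ) :
    subCount A m (p ^ n) ≤ (n + 1) ^ 2 * p ^ (2 * n) :=
  subCount_le_of_card_le hp m n fun j k hjk =>
    (card_hermiteSet_le_trivial A p n j k).trans (Nat.pow_le_pow_right hp.pos (by omega))

/-- Since `p ^ v` divides `A 0 0`, the loss is bounded by `|A 0 0|` uniformly in `p`, including the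
primes that divide `A 0 0`. The exponent, at most `3n/2`, is below `19n/10`, which leaves room to
the left of `Re s = 2`. -/
theorem subCount_le {A : Matrix (Fin 3) (Fin 3) ℤ} (hA : A 0 0 ≠ 0) {p : ℕ} (hp : p.Prime)
    (m n : ℕ) : subCount A m (p ^ n) ≤ 2 * (A 0 0).natAbs * (n + 1) ^ 2 * p ^ (n + n / 2) := by
  have hfin : FiniteMultiplicity (p : ℤ) (A 0 0) := Int.finiteMultiplicity_iff.2
    ⟨by rw [Int.natAbs_natCast]; exact hp.one_lt.ne', hA⟩
  set v := multiplicity (p : ℤ) (A 0 0)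
  have hv : p ^ v ≤ (A 0 0).natAbs := by
    refine Nat.le_of_dvd (Int.natAbs_pos.2 hA) ?_
    rw [← Int.natCast_dvd]
    push_cast
    exact pow_multiplicity_dvd _ _
  refine (subCount_le_of_card_le hp m n (B := 2 * p ^ v * p ^ (n + n / 2)) fun j k hjk =>
    (card_hermiteSet_le hp (hfin.not_pow_dvd_of_multiplicity_lt (Nat.lt_succ_self v)) n j k).trans
      (Nat.mul_le_mul_left _ (Nat.pow_le_pow_right hp.pos (by omega)))).trans ?_
  calc (n + 1) ^ 2 * (2 * p ^ v * p ^ (n + n / 2))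
      = p ^ v * (2 * (n + 1) ^ 2 * p ^ (n + n / 2)) := by ring
    _ ≤ (A 0 0).natAbs * (2 * (n + 1) ^ 2 * p ^ (n + n / 2)) := Nat.mul_le_mul_right _ hv
    _ = _ := by ring

end HermiteBounds

/-! ### Sharper bounds at `p` and `p²` -/

section PrimeBounds

variable {A : Matrix (Fin 3) (Fin 3) ℤ} {p : ℕ}

/-- With diagonal `(1, 1, p ^ n)` one has `x = 0`, and the first condition reads `f(-y, -z, 1) ≡ 0`.
This is the main term; the other diagonals contribute the error. -/
theorem card_hermiteSet_zero_left (n : ℕ) : (hermiteSet A p n 0 n).card ≤ affineCount A p n := by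
  refine Finset.card_le_card_of_injOn (fun t => (t.1.2, t.2)) ?_ ?_
  · rintro ⟨⟨x, z⟩, y⟩ ht
    simp only [hermiteSet, Finset.coe_filter, Finset.mem_product, Finset.mem_range,
      Set.mem_ofPred_eq, pow_zero, Nat.lt_one_iff] at ht ⊢
    obtain ⟨⟨⟨rfl, hz⟩, hy⟩, h1, -⟩ := ht
    refine ⟨⟨hz, hy⟩, ?_⟩
    simpa using h1
  · rintro ⟨⟨x, z⟩, y⟩ ht ⟨⟨x', z'⟩, y'⟩ ht' h
    simp only [hermiteSet, Finset.coe_filter, Finset.mem_product, Finset.mem_range,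
      Set.mem_ofPred_eq, pow_zero, Nat.lt_one_iff] at ht ht'
    simp only [Prod.mk.injEq] at h ⊢
    omega

theorem filter_pairs_one : ((Finset.range (1 + 1) ×ˢ Finset.range (1 + 1)).filter
    (fun jk : ℕ × ℕ => jk.1 + jk.2 ≤ 1)) = {(0, 0), (0, 1), (1, 0)} := by decide

theorem filter_pairs_two : ((Finset.range (2 + 1) ×ˢ Finset.range (2 + 1)).filter
    (fun jk : ℕ × ℕ => jk.1 + jk.2 ≤ 2)) =
      {(0, 0), (0, 1), (0, 2), (1, 0), (1, 1), (2, 0)} := by decide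

theorem subCount_prime_le_trivial (A : Matrix (Fin 3) (Fin 3) ℤ) (hp : p.Prime) (m : ℕ) :
    subCount A m p ≤ affineCount A p 1 + (p + 1) := by
  have h := subCount_le_sum A hp m 1
  rw [filter_pairs_one, pow_one] at h
  have h00 := card_hermiteSet_le_trivial A p 1 0 0
  have h01 := card_hermiteSet_zero_left (A := A) (p := p) 1
  have h10 := card_hermiteSet_le_trivial A p 1 1 0
  simp at h h00 h01 h10
  omega

theorem subCount_prime_le (hp : p.Prime) (hα : ¬ (p : ℤ) ∣ A 0 0) (m : ℕ) :
    subCount A m p ≤ affineCount A p 1 + 3 := by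
  have h := subCount_le_sum A hp m 1
  rw [filter_pairs_one, pow_one] at h
  have h00 := card_hermiteSet_le_trivial A p 1 0 0
  have h01 := card_hermiteSet_zero_left (A := A) (p := p) 1
  -- For the diagonal `(1, p, 1)` the second condition is `f(-x, 1, 0) ≡ 0` modulo `p`, which has at
  -- most two roots. With the diagonal `(p, 1, 1)` the error is at most 3.
  have h10 : (hermiteSet A p 1 1 0).card ≤ 2 := by
    have hq := card_quadratic_le hp (v := 0) (by simpa using hα) 0 1 0 1
      (β := A 0 1 + A 1 0) (γ := A 1 1)
    simp only [pow_zero, mul_one] at hq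
    refine le_trans (Finset.card_le_card_of_injOn (fun t => t.1.1) ?_ ?_) hq
    · rintro ⟨⟨x, z⟩, y⟩ ht
      simp only [hermiteSet, Finset.coe_filter, Finset.mem_product, Finset.mem_range,
        Set.mem_ofPred_eq, pow_zero, Nat.lt_one_iff] at ht ⊢
      obtain ⟨⟨⟨hx, rfl⟩, rfl⟩, -, h2⟩ := ht
      refine ⟨hx, ?_⟩
      simp [quadForm_eq] at h2
      convert h2 using 2
      · simp
      · ring
    · rintro ⟨⟨x, z⟩, y⟩ ht ⟨⟨x', z'⟩, y'⟩ ht' h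
      simp only [hermiteSet, Finset.coe_filter, Finset.mem_product, Finset.mem_range,
        Set.mem_ofPred_eq, pow_zero, Nat.lt_one_iff] at ht ht' h
      simp only [Prod.mk.injEq] at h ⊢
      omega
  simp at h h00 h01
  omega

/-- The trivial bound `p³` for the diagonal `(1, p, p)` would be as large as the main term of rank
1. Modulo `p` the first condition becomes `z² f(-x, 1, 0) ≡ 0`, so either `z = 0` or `x` is one of
at most two roots, giving `p² + 2p²`. -/
theorem card_hermiteSet_two_one_one (hp : p.Prime) (hα : ¬ (p : ℤ) ∣ A 0 0) :
    (hermiteSet A p 2 1 1).card ≤ 3 * p ^ 2 := by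
  have hp' : Prime (p : ℤ) := Nat.prime_iff_prime_int.1 hp
  have hq := card_quadratic_le hp (v := 0) (by simpa using hα) 0 1 0 1
      (β := A 0 1 + A 1 0) (γ := A 1 1)
  simp only [pow_zero, mul_one, pow_one] at hq
  set X := (Finset.range p).filter fun y : ℕ =>
      (p : ℤ) ∣ A 0 0 * (0 - (y : ℤ)) ^ 2 + (A 0 1 + A 1 0) * (0 - y) + A 1 1 with hX
  have hsub : hermiteSet A p 2 1 1 ⊆ ((Finset.range p ×ˢ {0}) ×ˢ Finset.range p) ∪
      ((X ×ˢ Finset.range p) ×ˢ Finset.range p) := by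
    rintro ⟨⟨x, z⟩, y⟩ ht
    simp only [hermiteSet, Finset.mem_filter, Finset.mem_product, Finset.mem_range, pow_one] at ht
    obtain ⟨⟨⟨hx, hz⟩, hy⟩, h1, -⟩ := ht
    simp only [Finset.mem_union, Finset.mem_product, Finset.mem_range, Finset.mem_singleton, hX,
      Finset.mem_filter]
    have h2 : (p : ℤ) ∣ (z : ℤ) ^ 2 *
        (A 0 0 * (0 - (x : ℤ)) ^ 2 + (A 0 1 + A 1 0) * (0 - x) + A 1 1) := by
      have h3 := (Dvd.intro_left _ (sq (p : ℤ)).symm).trans h1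
      obtain ⟨c, hc⟩ := h3
      simp [quadForm_eq] at hc
      refine ⟨c + 2 * A 0 0 * x * z * y - A 0 0 * y ^ 2 * p - (A 0 1 + A 1 0) * (y * z)
        - (A 0 2 + A 2 0) * (x * z - y * p) + (A 1 2 + A 2 1) * z - A 2 2 * p, ?_⟩
      linear_combination hc
    rcases hp'.dvd_or_dvd h2 with h3 | h3
    · left
      have := Int.natCast_dvd_natCast.1 (hp'.dvd_of_dvd_pow h3)
      exact ⟨⟨hx, Nat.eq_zero_of_dvd_of_lt this hz⟩, hy⟩
    · right
      exact ⟨⟨⟨hx, h3⟩, hz⟩, hy⟩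
  refine (Finset.card_le_card hsub).trans ((Finset.card_union_le _ _).trans ?_)
  simp only [Finset.card_product, Finset.card_range, Finset.card_singleton, mul_one]
  norm_num at hq
  nlinarith [Nat.mul_le_mul_right (p * p) hq]

/-- Apart from `(1, 1, p²)` and `(1, p, p)`, the trivial bound for each diagonal is at most `p²`. -/
theorem subCount_prime_sq_le (hp : p.Prime) (hα : ¬ (p : ℤ) ∣ A 0 0) (m : ℕ) :
    subCount A m (p ^ 2) ≤ affineCount A p 2 + 8 * p ^ 2 := by
  have h := subCount_le_sum A hp m 2
  rw [filter_pairs_two] at h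
  have h00 := card_hermiteSet_le_trivial A p 2 0 0
  have h01 := card_hermiteSet_le_trivial A p 2 0 1
  have h02 := card_hermiteSet_zero_left (A := A) (p := p) 2
  have h10 := card_hermiteSet_le_trivial A p 2 1 0
  have h20 := card_hermiteSet_le_trivial A p 2 2 0
  have h11 := card_hermiteSet_two_one_one hp hα
  have hp1 := hp.one_lt
  have hpp : p ≤ p ^ 2 := Nat.le_self_pow (by norm_num) p
  simp at h h00 h01 h10 h20
  omega

end PrimeBounds

end CotypeZeta

namespace CotypeZeta

open Matrix

/-! ### Completing squares without division -/

section Discriminants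

variable {R : Type*} [CommRing R]

/-- The coefficient of `Y²` in the discriminant `Δ(Y, Z)` of the ternary form `f(X, Y, Z)` with
respect to `X`. -/
def disc₁ (A : Matrix (Fin 3) (Fin 3) R) : R := (A 0 1 + A 1 0) ^ 2 - 4 * A 0 0 * A 1 1

/-- The coefficient of `Y Z` in `Δ(Y, Z)`. -/
def disc₂ (A : Matrix (Fin 3) (Fin 3) R) : R :=
  2 * (A 0 1 + A 1 0) * (A 0 2 + A 2 0) - 4 * A 0 0 * (A 1 2 + A 2 1)

/-- The coefficient of `Z²` in `Δ(Y, Z)`. -/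
def disc₃ (A : Matrix (Fin 3) (Fin 3) R) : R := (A 0 2 + A 2 0) ^ 2 - 4 * A 0 0 * A 2 2

/-- The discriminant of the binary form `Δ(Y, Z)`. -/
def doubleDisc (A : Matrix (Fin 3) (Fin 3) R) : R := disc₂ A ^ 2 - 4 * disc₁ A * disc₃ A

theorem four_mul_quadForm (A : Matrix (Fin 3) (Fin 3) R) (x : Fin 3 → R) :
    4 * A 0 0 * quadForm A x =
      (2 * A 0 0 * x 0 + (A 0 1 + A 1 0) * x 1 + (A 0 2 + A 2 0) * x 2) ^ 2 -
        (disc₁ A * x 1 ^ 2 + disc₂ A * (x 1 * x 2) + disc₃ A * x 2 ^ 2) := by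
  rw [quadForm_eq, disc₁, disc₂, disc₃]
  ring

/-- The square is completed in `x 0` and then in `x 1`. The resulting diagonal form has coefficients
`disc₁ A`, `-1` and `doubleDisc A`, and the change of variables is invertible wherever `2`, `A 0 0`
and `disc₁ A` are. -/
theorem sixteen_mul_quadForm (A : Matrix (Fin 3) (Fin 3) R) (x : Fin 3 → R) :
    16 * A 0 0 * disc₁ A * quadForm A x =
      disc₁ A * (2 * (2 * A 0 0 * x 0 + (A 0 1 + A 1 0) * x 1 + (A 0 2 + A 2 0) * x 2)) ^ 2 -
        (2 * disc₁ A * x 1 + disc₂ A * x 2) ^ 2 + doubleDisc A * x 2 ^ 2 := by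
  have := four_mul_quadForm A x
  rw [doubleDisc]
  linear_combination 4 * disc₁ A * this

end Discriminants

/-! ### Zeros modulo `p` and `p²` of forms of rank one -/

section RankOne

variable {A : Matrix (Fin 3) (Fin 3) ℤ} {p : ℕ}

theorem not_dvd_two_mul (hp : p.Prime) (h2 : p ≠ 2) {a : ℤ} (ha : ¬ (p : ℤ) ∣ a) :
    ¬ (p : ℤ) ∣ 2 * a := by
  have hp' : Prime (p : ℤ) := Nat.prime_iff_prime_int.1 hp
  intro h
  rcases hp'.dvd_or_dvd h with h | h
  · exact h2 ((Nat.prime_dvd_prime_iff_eq hp Nat.prime_two).1 (by exact_mod_cast h))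
  · exact ha h

theorem card_linear_congruence (hp : p.Prime) {s : ℤ} (hs : ¬ (p : ℤ) ∣ s) (w : ℤ) (k : ℕ) :
    ((Finset.range (p ^ (k + 1))).filter fun y : ℕ => (p : ℤ) ∣ s * y + w).card = p ^ k := by
  have : Fact p.Prime := ⟨hp⟩
  have hs' : (s : ZMod p) ≠ 0 := fun h => hs ((ZMod.intCast_zmod_eq_zero_iff_dvd s p).1 h)
  let y₀ : ℕ := (-(w : ZMod p) / s).val
  have h0 : ∀ y : ℕ, (p : ℤ) ∣ s * y + w ↔ y ≡ y₀ [MOD p] := by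
    intro y
    rw [← ZMod.intCast_zmod_eq_zero_iff_dvd, ← ZMod.natCast_eq_natCast_iff, ZMod.natCast_zmod_val,
      eq_div_iff hs']
    push_cast
    rw [← eq_neg_iff_add_eq_zero, mul_comm]
  simp only [h0]
  rw [← Nat.count_eq_card_filter_range, Nat.count_modEq_card _ hp.pos, pow_succ,
    Nat.mul_div_cancel _ hp.pos, Nat.mul_mod_left]
  simp

theorem card_filter_product_eq {s t : Type*} [DecidableEq s] {S : Finset s} {T : Finset t}
    (P : s × t → Prop) [DecidablePred P] {B : ℕ}
    (h : ∀ a ∈ S, (T.filter fun b => P (a, b)).card = B) :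
    ((S ×ˢ T).filter P).card = S.card * B := by
  rw [Finset.card_filter, Finset.sum_product, ← smul_eq_mul]
  refine Finset.sum_eq_card_nsmul fun a ha => ?_
  rw [← Finset.card_filter]
  exact h a ha

/-- Here `4 A₀₀ f` is the square of a linear form, so `p` dividing `f` already forces `p²` to divide
it. -/
theorem dvd_quadForm_iff_of_disc_eq_zero (hp : p.Prime) (h2 : p ≠ 2) (hα : ¬ (p : ℤ) ∣ A 0 0)
    (h₁ : disc₁ A = 0) (h₂ : disc₂ A = 0) (h₃ : disc₃ A = 0) {e : ℕ} (he : e = 1 ∨ e = 2)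
    (x : Fin 3 → ℤ) : (p : ℤ) ^ e ∣ quadForm A x ↔
      (p : ℤ) ∣ 2 * A 0 0 * x 0 + (A 0 1 + A 1 0) * x 1 + (A 0 2 + A 2 0) * x 2 := by
  have hp' : Prime (p : ℤ) := Nat.prime_iff_prime_int.1 hp
  have key := four_mul_quadForm A x
  rw [h₁, h₂, h₃] at key
  simp only [zero_mul, add_zero, sub_zero] at key
  have hco : IsCoprime ((p : ℤ) ^ e) (4 * A 0 0) := by
    apply IsCoprime.pow_left
    rw [(Nat.prime_iff_prime_int.1 hp).irreducible.coprime_iff_not_dvd]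
    have := not_dvd_two_mul hp h2 (not_dvd_two_mul hp h2 hα)
    rwa [← mul_assoc] at this
  constructor
  · intro h
    have h3 : (p : ℤ) ∣ quadForm A x := (dvd_pow_self _ (by omega)).trans h
    exact hp'.dvd_of_dvd_pow (key ▸ h3.mul_left _)
  · intro h
    refine hco.dvd_of_dvd_mul_left ?_
    rw [key]
    exact (pow_dvd_pow _ (by omega : e ≤ 2)).trans (pow_dvd_pow_of_dvd h 2)

/-- Every `z` is allowed and `y` is determined modulo `p` only. For `e = 2` this gives `p³`, which
produces the factor `ζ(2s - 3)` and with it the second pole. -/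
theorem affineCount_of_disc_eq_zero (hp : p.Prime) (h2 : p ≠ 2) (hα : ¬ (p : ℤ) ∣ A 0 0)
    (h₁ : disc₁ A = 0) (h₂ : disc₂ A = 0) (h₃ : disc₃ A = 0) {e : ℕ} (he : e = 1 ∨ e = 2) :
    affineCount A p e = p ^ e * p ^ (e - 1) := by
  unfold affineCount
  simp only [dvd_quadForm_iff_of_disc_eq_zero hp h2 hα h₁ h₂ h₃ he]
  rw [card_filter_product_eq (B := p ^ (e - 1)) (fun t : ℕ × ℕ => (p : ℤ) ∣
    2 * A 0 0 * ![-(t.2 : ℤ), -(t.1 : ℤ), 1] 0 + (A 0 1 + A 1 0) * ![-(t.2 : ℤ), -(t.1 : ℤ), 1] 1 +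
      (A 0 2 + A 2 0) * ![-(t.2 : ℤ), -(t.1 : ℤ), 1] 2), Finset.card_range]
  intro z _
  have hs : ¬ (p : ℤ) ∣ -(2 * A 0 0) := by
    rw [dvd_neg]
    exact not_dvd_two_mul hp h2 hα
  have := card_linear_congruence hp hs ((A 0 1 + A 1 0) * -(z : ℤ) + (A 0 2 + A 2 0)) (e - 1)
  rw [show e - 1 + 1 = e by omega] at this
  rw [← this]
  congr 1
  refine Finset.filter_congr fun y _ => Eq.to_iff (congrArg _ ?_)
  simp
  ring

end RankOne

/-! ### Zeros modulo `p²` in rank at least two -/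

section SquareModulus

variable {A : Matrix (Fin 3) (Fin 3) ℤ} {p : ℕ}

/-- Two solutions have square roots `u`, `u₀` of `d` with `p² ∣ (u - u₀)(u + u₀)`. As `p ∤ 2 u₀`,
the prime cannot divide both factors, so `p²` divides one of them. -/
theorem card_quadratic_sq_modulus_le (hp : p.Prime) (h2 : p ≠ 2) {a d w : ℤ} (ha : ¬ (p : ℤ) ∣ a)
    (hd : ¬ (p : ℤ) ∣ d) :
    ((Finset.range (p ^ 2)).filter fun y : ℕ => (p : ℤ) ^ 2 ∣ (2 * a * y + w) ^ 2 - d).card ≤ 2 := by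
  have hp' : Prime (p : ℤ) := Nat.prime_iff_prime_int.1 hp
  set S := (Finset.range (p ^ 2)).filter fun y : ℕ => (p : ℤ) ^ 2 ∣ (2 * a * y + w) ^ 2 - d with hS
  rcases S.eq_empty_or_nonempty with he | ⟨y₀, hy₀⟩
  · simp [he]
  have ha2 := not_dvd_two_mul hp h2 ha
  have ha' : ¬ (p : ℤ) ^ (0 + 1) ∣ 2 * a := by simpa using ha2
  let E₁ := (Finset.range (p ^ 2)).filter fun y : ℕ => (p : ℤ) ^ 2 ∣ (y : ℤ) - y₀
  let E₂ := (Finset.range (p ^ 2)).filter fun y : ℕ =>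
    (p : ℤ) ^ 2 ∣ (2 * a * y + w) + (2 * a * y₀ + w)
  have hy0 := (Finset.mem_filter.1 hy₀).2
  have hu0 : ¬ (p : ℤ) ∣ 2 * a * y₀ + w := by
    intro h
    apply hd
    have h1 := (dvd_pow_self (p : ℤ) two_ne_zero).trans hy0
    have h3 := dvd_sub (h.trans (dvd_pow_self _ two_ne_zero)) h1
    rwa [sub_sub_cancel] at h3
  have hsub : S ⊆ E₁ ∪ E₂ := by
    intro y hy
    have hyr := (Finset.mem_filter.1 hy).1
    have h1 : (p : ℤ) ^ 2 ∣ (2 * a * (y - y₀)) * ((2 * a * y + w) + (2 * a * y₀ + w)) := by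
      refine (congrArg (_ ∣ ·) ?_).mp (dvd_sub (Finset.mem_filter.1 hy).2 hy0)
      ring
    obtain ⟨i, j, hij, hi, hj⟩ := exists_pow_dvd_of_pow_dvd_mul hp h1
    by_cases h0 : i = 0
    · have : j = 2 := by omega
      subst this
      exact Finset.mem_union_right _ (Finset.mem_filter.2 ⟨hyr, hj⟩)
    by_cases h0' : j = 0
    · have : i = 2 := by omega
      subst this
      refine Finset.mem_union_left _ (Finset.mem_filter.2 ⟨hyr, ?_⟩)
      simpa using pow_dvd_of_not_pow_succ_dvd hp ha' hi
    · exfalso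
      have h3 := (dvd_pow_self (p : ℤ) h0).trans hi
      have h4 := (dvd_pow_self (p : ℤ) h0').trans hj
      refine not_dvd_two_mul hp h2 hu0 ?_
      refine (congrArg (_ ∣ ·) ?_).mp (dvd_sub h4 h3)
      ring
  have hE₁ : E₁.card ≤ 1 := by simpa using card_filter_residue_le hp 2 2 y₀
  have hE₂ : E₂.card ≤ 1 := by
    rcases E₂.eq_empty_or_nonempty with he | ⟨y₁, hy₁⟩
    · simp [he]
    have hsub2 : E₂ ⊆ (Finset.range (p ^ 2)).filter fun y : ℕ => (p : ℤ) ^ 2 ∣ (y : ℤ) - y₁ := by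
      intro y hy
      refine Finset.mem_filter.2 ⟨(Finset.mem_filter.1 hy).1, ?_⟩
      have h1 : (p : ℤ) ^ 2 ∣ 2 * a * (y - y₁) := by
        refine (congrArg (_ ∣ ·) ?_).mp
          (dvd_sub (Finset.mem_filter.1 hy).2 (Finset.mem_filter.1 hy₁).2)
        ring
      simpa using pow_dvd_of_not_pow_succ_dvd hp ha' h1
    exact (Finset.card_le_card hsub2).trans (by simpa using card_filter_residue_le hp 2 2 y₁)
  calc S.card ≤ E₁.card + E₂.card := (Finset.card_le_card hsub).trans (Finset.card_union_le _ _)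
    _ ≤ 2 := by omega

/-- At most `2p` values of `z` make the discriminant in `y` divisible by `p`, and each allows at
most `2p` values of `y`. All other `z` allow at most two, so the total is at most `4p² + 2p²`. -/
theorem affineCount_two_le (hp : p.Prime) (h2 : p ≠ 2) (hα : ¬ (p : ℤ) ∣ A 0 0)
    (h₁ : ¬ (p : ℤ) ∣ disc₁ A) : affineCount A p 2 ≤ 6 * p ^ 2 := by
  have hα' : ¬ (p : ℤ) ^ (0 + 1) ∣ A 0 0 := by simpa using hα
  have h₁' : ¬ (p : ℤ) ^ (0 + 1) ∣ disc₁ A := by simpa using h₁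
  let Z := (Finset.range (p ^ 2)).filter fun z : ℕ =>
    (p : ℤ) ^ 1 ∣ disc₁ A * (0 - z * p ^ 0) ^ 2 + disc₂ A * (0 - z * p ^ 0) + disc₃ A
  have hZ : Z.card ≤ 2 * p := by
    have := card_quadratic_le hp h₁' 0 1 0 2 (β := disc₂ A) (γ := disc₃ A)
    refine le_trans this (by simp)
  have hsub : ((Finset.range (p ^ 2) ×ˢ Finset.range (p ^ 2)).filter fun t : ℕ × ℕ =>
      (p : ℤ) ^ 2 ∣ quadForm A ![-(t.2 : ℤ), -(t.1 : ℤ), 1]) ⊆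
      ((Z ×ˢ Finset.range (p ^ 2)).filter fun t : ℕ × ℕ =>
        (p : ℤ) ^ 2 ∣ quadForm A ![-(t.2 : ℤ), -(t.1 : ℤ), 1]) ∪
      (((Finset.range (p ^ 2) \ Z) ×ˢ Finset.range (p ^ 2)).filter fun t : ℕ × ℕ =>
        (p : ℤ) ^ 2 ∣ quadForm A ![-(t.2 : ℤ), -(t.1 : ℤ), 1]) := by
    intro t ht
    simp only [Finset.mem_union, Finset.mem_filter, Finset.mem_product, Finset.mem_sdiff] at ht ⊢
    by_cases hz : t.1 ∈ Z <;> tauto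
  have hB₁ := card_filter_product_le (S := Z) (T := Finset.range (p ^ 2)) (B := 2 * p)
    (fun t : ℕ × ℕ => (p : ℤ) ^ 2 ∣ quadForm A ![-(t.2 : ℤ), -(t.1 : ℤ), 1]) (by
      intro z _
      refine le_trans (le_of_eq ?_) (le_trans (card_quadratic_le hp hα' 0 2 0 2
        (β := (A 0 1 + A 1 0) * -z + (A 0 2 + A 2 0)) (γ := quadForm A ![0, -z, 1])) ?_)
      · congr 1
        refine Finset.filter_congr fun y _ => Eq.to_iff (congrArg _ ?_)
        simp [quadForm_eq]
        ring
      · simp)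
  have hB₂ := card_filter_product_le (S := Finset.range (p ^ 2) \ Z) (T := Finset.range (p ^ 2))
    (B := 2) (fun t : ℕ × ℕ => (p : ℤ) ^ 2 ∣ quadForm A ![-(t.2 : ℤ), -(t.1 : ℤ), 1]) (by
      intro z hz
      rw [Finset.mem_sdiff, Finset.mem_filter, not_and] at hz
      have hd := hz.2 hz.1
      rw [pow_one] at hd
      have := card_quadratic_sq_modulus_le hp h2 (a := -A 0 0)
        (w := (A 0 1 + A 1 0) * -z + (A 0 2 + A 2 0)) (by rwa [dvd_neg]) hd
      refine (Finset.card_le_card (Finset.monotone_filter_right _ fun y _ hy => ?_)).trans this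
      have h3 := (four_mul_quadForm A ![-(y : ℤ), -(z : ℤ), 1]) ▸ hy.mul_left (4 * A 0 0)
      refine (congrArg (_ ∣ ·) ?_).mp h3
      simp
      ring)
  have hS : (Finset.range (p ^ 2) \ Z).card ≤ p ^ 2 :=
    (Finset.card_le_card Finset.sdiff_subset).trans (Finset.card_range _).le
  calc affineCount A p 2 ≤ Z.card * (2 * p) + (Finset.range (p ^ 2) \ Z).card * 2 :=
        (Finset.card_le_card hsub).trans ((Finset.card_union_le _ _).trans (add_le_add hB₁ hB₂))
    _ ≤ 2 * p * (2 * p) + p ^ 2 * 2 := by gcongr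
    _ = 6 * p ^ 2 := by ring

end SquareModulus

/-! ### Points on affine conics over finite fields -/

section FiniteField

variable {F : Type*} [Field F] [Fintype F] [DecidableEq F]

theorem card_conic (hF : ringChar F ≠ 2) (a d : F) :
    (((Finset.univ : Finset (F × F)).filter fun t => t.2 ^ 2 = a * t.1 ^ 2 + d).card : ℤ) =
      ∑ u, (quadraticChar F (a * u ^ 2 + d) + 1) := by
  rw [Finset.card_filter, ← Finset.univ_product_univ, Finset.sum_product]
  push_cast
  refine Finset.sum_congr rfl fun u _ => ?_
  rw [← quadraticChar_card_sqrts hF]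
  simp [Finset.sum_boole, Set.toFinset_ofPred]

theorem sum_quadraticChar_mul_sq {a : F} :
    ∑ u : F, quadraticChar F (a * u ^ 2) = quadraticChar F a * (Fintype.card F - 1) := by
  rw [← Finset.add_sum_erase _ _ (Finset.mem_univ (0 : F))]
  have : ∀ u ∈ Finset.univ.erase (0 : F), quadraticChar F (a * u ^ 2) = quadraticChar F a := by
    intro u hu
    rw [map_mul, quadraticChar_sq_one' (Finset.ne_of_mem_erase hu), mul_one]
  rw [Finset.sum_congr rfl this, Finset.sum_const, Finset.card_erase_of_mem (Finset.mem_univ _),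
    Finset.card_univ, nsmul_eq_mul, Nat.cast_sub Fintype.card_pos]
  simp [mul_comm]

theorem sum_quadraticChar_affine (hF : ringChar F ≠ 2) {a : F} (ha : a ≠ 0) (d : F) :
    ∑ t : F, quadraticChar F (a * t + d) = 0 := by
  rw [← quadraticChar_sum_zero hF]
  exact Fintype.sum_bijective (fun t => a * t + d)
    ((Equiv.addRight d).bijective.comp (mulLeft_bijective₀ a ha)) _ _ fun _ => rfl

theorem sum_comp_sq (hF : ringChar F ≠ 2) (g : F → ℤ) :
    ∑ u : F, g (u ^ 2) = ∑ t, (quadraticChar F t + 1) * g t := by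
  have h := Finset.sum_fiberwise_of_maps_to (s := Finset.univ) (t := Finset.univ)
    (g := fun u : F => u ^ 2) (fun _ _ => Finset.mem_univ _) (fun u => g (u ^ 2))
  rw [← h]
  refine Finset.sum_congr rfl fun t _ => ?_
  rw [Finset.sum_congr rfl (g := fun _ => g t) (by
    intro u hu
    rw [(Finset.mem_filter.1 hu).2]), Finset.sum_const, nsmul_eq_mul, ← quadraticChar_card_sqrts hF]
  simp [Set.toFinset_ofPred]

/-- Replacing `u²` by `t` with weight `1 + χ(t)` leaves `∑ χ(t) χ(a t + d)`, since the unweighted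
sum vanishes. For `t ≠ 0` the summand equals `χ(d t⁻¹ + a)`, and inverting `t` gives the full sum of
`χ(d t + a)`, which is 0, without its term `χ(a)` at `t = 0`. -/
theorem sum_quadraticChar_conic (hF : ringChar F ≠ 2) {a d : F} (ha : a ≠ 0) (hd : d ≠ 0) :
    ∑ u : F, quadraticChar F (a * u ^ 2 + d) = -quadraticChar F a := by
  rw [sum_comp_sq hF fun t => quadraticChar F (a * t + d)]
  simp only [add_mul, one_mul, Finset.sum_add_distrib]
  rw [sum_quadraticChar_affine hF ha, add_zero, ← Finset.add_sum_erase _ _ (Finset.mem_univ (0 : F))]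
  have h1 : ∑ t ∈ Finset.univ.erase (0 : F), quadraticChar F t * quadraticChar F (a * t + d) =
      ∑ t ∈ Finset.univ.erase (0 : F), quadraticChar F (d * t + a) := by
    refine Finset.sum_nbij' (fun t => t⁻¹) (fun t => t⁻¹) ?_ ?_ ?_ ?_ ?_
    · intro t ht
      simpa using ht
    · intro t ht
      simpa using ht
    · simp
    · simp
    · intro t ht
      have ht0 : t ≠ 0 := Finset.ne_of_mem_erase ht
      rw [← map_mul]
      have : t * (a * t + d) = (d * t⁻¹ + a) * t ^ 2 := by field_simp; ring
      rw [this, map_mul, quadraticChar_sq_one' ht0, mul_one]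
  have h2 := sum_quadraticChar_affine hF hd a
  rw [← Finset.add_sum_erase _ _ (Finset.mem_univ (0 : F))] at h2
  simp only [mul_zero, zero_add] at h2
  rw [h1, MulChar.map_zero, zero_mul, zero_add]
  linarith

end FiniteField

/-! ### Zeros modulo `p` in ranks two and three -/

section AffineCount

variable {A : Matrix (Fin 3) (Fin 3) ℤ} {p : ℕ}

/-- When `2`, `A 0 0` and `disc₁ A` are invertible modulo `p`, completing both squares is an affine
bijection of the plane. -/
theorem affineCount_one_eq [Fact p.Prime] (h2 : p ≠ 2) (hα : ¬ (p : ℤ) ∣ A 0 0)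
    (h₁ : ¬ (p : ℤ) ∣ disc₁ A) :
    affineCount A p 1 = ((Finset.univ : Finset (ZMod p × ZMod p)).filter fun t =>
      t.2 ^ 2 = ((disc₁ A : ℤ) : ZMod p) * t.1 ^ 2 + ((doubleDisc A : ℤ) : ZMod p)).card := by
  have hp : p.Prime := Fact.out
  have c2 : (2 : ZMod p) ≠ 0 := by
    intro h
    have h' : ((2 : ℕ) : ZMod p) = 0 := by exact_mod_cast h
    exact h2 ((Nat.prime_dvd_prime_iff_eq hp Nat.prime_two).1 ((ZMod.natCast_eq_zero_iff 2 p).1 h'))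
  have ca : (A 0 0 : ZMod p) ≠ 0 := fun h => hα ((ZMod.intCast_zmod_eq_zero_iff_dvd _ p).1 h)
  have cd : ((disc₁ A : ℤ) : ZMod p) ≠ 0 := fun h => h₁ ((ZMod.intCast_zmod_eq_zero_iff_dvd _ p).1 h)
  have hinj : ∀ {a b : ℕ}, a < p → b < p → (a : ZMod p) = b → a = b := fun ha hb h =>
    Nat.ModEq.eq_of_lt_of_lt ((ZMod.natCast_eq_natCast_iff _ _ _).1 h) ha hb
  have key : ∀ y z : ℤ, 16 * (A 0 0 : ZMod p) * ((disc₁ A : ℤ) : ZMod p) *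
      ((quadForm A ![-y, -z, 1] : ℤ) : ZMod p) = ((disc₁ A : ℤ) : ZMod p) *
        (2 * (2 * (A 0 0 : ZMod p) * -(y : ZMod p) + ((A 0 1 : ZMod p) + A 1 0) * -(z : ZMod p) +
          ((A 0 2 : ZMod p) + A 2 0))) ^ 2 -
        (2 * ((disc₁ A : ℤ) : ZMod p) * -(z : ZMod p) + ((disc₂ A : ℤ) : ZMod p)) ^ 2 +
        ((doubleDisc A : ℤ) : ZMod p) := by
    intro y z
    have h := sixteen_mul_quadForm A ![-y, -z, 1]
    simp only [Matrix.cons_val_zero, Matrix.cons_val_one, Matrix.cons_val, mul_one, one_pow] at h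
    exact_mod_cast congrArg (fun a : ℤ => (a : ZMod p)) h
  unfold affineCount
  simp only [pow_one]
  refine Finset.card_bij (fun t _ =>
    (2 * (2 * (A 0 0 : ZMod p) * -(t.2 : ZMod p) + ((A 0 1 : ZMod p) + A 1 0) * -(t.1 : ZMod p) +
        ((A 0 2 : ZMod p) + A 2 0)),
      2 * ((disc₁ A : ℤ) : ZMod p) * -(t.1 : ZMod p) + ((disc₂ A : ℤ) : ZMod p))) ?_ ?_ ?_
  · intro t ht
    have h := (Finset.mem_filter.1 ht).2
    rw [← ZMod.intCast_zmod_eq_zero_iff_dvd] at h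
    have key := key t.2 t.1
    rw [h, mul_zero] at key
    push_cast at key
    refine Finset.mem_filter.2 ⟨Finset.mem_univ _, ?_⟩
    linear_combination key
  · rintro ⟨z, y⟩ ht ⟨z', y'⟩ ht' h
    simp only [Finset.mem_filter, Finset.mem_product, Finset.mem_range, Prod.mk.injEq] at ht ht' h
    have hz : (z : ZMod p) = z' := by
      refine mul_left_cancel₀ (mul_ne_zero c2 cd) ?_
      linear_combination -h.2
    have hy : (y : ZMod p) = y' := by
      refine mul_left_cancel₀ (mul_ne_zero c2 (mul_ne_zero c2 ca)) ?_
      linear_combination -h.1 - 2 * ((A 0 1 : ZMod p) + A 1 0) * hz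
    rw [hinj ht.1.1 ht'.1.1 hz, hinj ht.1.2 ht'.1.2 hy]
  · rintro ⟨u, w⟩ ht
    have ht' := (Finset.mem_filter.1 ht).2
    let z : ZMod p := (((disc₂ A : ℤ) : ZMod p) - w) / (2 * ((disc₁ A : ℤ) : ZMod p))
    let y : ZMod p := (((A 0 1 : ZMod p) + A 1 0) * -z + ((A 0 2 : ZMod p) + A 2 0) - u / 2) /
      (2 * A 0 0)
    have hz : 2 * ((disc₁ A : ℤ) : ZMod p) * -z + ((disc₂ A : ℤ) : ZMod p) = w := by
      simp only [z]; field_simp; ring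
    have hu : 2 * (2 * (A 0 0 : ZMod p) * -y + ((A 0 1 : ZMod p) + A 1 0) * -z +
        ((A 0 2 : ZMod p) + A 2 0)) = u := by
      simp only [y]; field_simp; ring
    refine ⟨(z.val, y.val), ?_, ?_⟩
    · simp only [Finset.mem_filter, Finset.mem_product, Finset.mem_range]
      refine ⟨⟨ZMod.val_lt z, ZMod.val_lt y⟩, ?_⟩
      rw [← ZMod.intCast_zmod_eq_zero_iff_dvd]
      have key := key y.val z.val
      push_cast [ZMod.natCast_zmod_val] at key
      have h16 : (16 * (A 0 0 : ZMod p) * ((disc₁ A : ℤ) : ZMod p)) ≠ 0 := by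
        have : (16 : ZMod p) = 2 ^ 4 := by norm_num
        rw [this]
        exact mul_ne_zero (mul_ne_zero (pow_ne_zero _ c2) ca) cd
      refine (mul_eq_zero.1 ?_).resolve_left h16
      rw [key, hu, hz]
      linear_combination -ht'
    · simp only [ZMod.natCast_zmod_val]
      rw [hu, hz]

/-- The conic degenerates to `w² = d u²`: two lines meeting at the origin, with `2p - 1` points, if
`d` is a square modulo `p`, and the origin alone otherwise. -/
theorem affineCount_one_of_doubleDisc_eq_zero [Fact p.Prime] (h2 : p ≠ 2) (hα : ¬ (p : ℤ) ∣ A 0 0)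
    (h₁ : ¬ (p : ℤ) ∣ disc₁ A) (hD : doubleDisc A = 0) :
    (affineCount A p 1 : ℤ) = p + legendreSym p (disc₁ A) * (p - 1) := by
  have hF : ringChar (ZMod p) ≠ 2 := by rwa [ZMod.ringChar_zmod_n]
  rw [affineCount_one_eq h2 hα h₁, card_conic hF, Finset.sum_add_distrib, hD, Int.cast_zero]
  simp only [add_zero]
  rw [sum_quadraticChar_mul_sq, legendreSym, ZMod.card]
  simp [ZMod.card]
  ring

/-- A nondegenerate conic has `p + 1` projective points, of which `1 + χ(d)` lie at infinity. -/
theorem affineCount_one_of_not_dvd_doubleDisc [Fact p.Prime] (h2 : p ≠ 2)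
    (hα : ¬ (p : ℤ) ∣ A 0 0) (h₁ : ¬ (p : ℤ) ∣ disc₁ A) (hD : ¬ (p : ℤ) ∣ doubleDisc A) :
    (affineCount A p 1 : ℤ) = p - legendreSym p (disc₁ A) := by
  have hF : ringChar (ZMod p) ≠ 2 := by rwa [ZMod.ringChar_zmod_n]
  have cd : ((disc₁ A : ℤ) : ZMod p) ≠ 0 := fun h => h₁ ((ZMod.intCast_zmod_eq_zero_iff_dvd _ p).1 h)
  have cD : ((doubleDisc A : ℤ) : ZMod p) ≠ 0 := fun h =>
    hD ((ZMod.intCast_zmod_eq_zero_iff_dvd _ p).1 h)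
  rw [affineCount_one_eq h2 hα h₁, card_conic hF, Finset.sum_add_distrib,
    sum_quadraticChar_conic hF cd cD, legendreSym]
  simp [ZMod.card]
  ring

end AffineCount

end CotypeZeta

namespace CotypeZeta

open Matrix

/-! ### Finite quotients of `ℤ_p` -/

section PadicQuotients

variable {p : ℕ} [hp : Fact p.Prime]

theorem exists_span_natCast_eq_span_pow {n : ℕ} (hn : 0 < n) :
    ∃ k, p ^ k ≤ n ∧ Ideal.span {(n : ℤ_[p])} = Ideal.span {(p : ℤ_[p]) ^ k} := by
  obtain ⟨k, m, hm, rfl⟩ := Nat.exists_eq_pow_mul_and_not_dvd hn.ne' p hp.out.ne_one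
  have hm0 : 0 < m := Nat.pos_of_ne_zero fun h => hm (h ▸ dvd_zero p)
  refine ⟨k, Nat.le_mul_of_pos_right _ hm0, ?_⟩
  have hu : IsUnit (m : ℤ_[p]) := PadicInt.isUnit_iff.2 (PadicInt.norm_natCast_eq_one_iff.2
    ((Nat.Prime.coprime_iff_not_dvd hp.out).2 hm))
  rw [Nat.cast_mul, Nat.cast_pow]
  exact Ideal.span_singleton_mul_right_unit hu _

theorem surjective_mk_fin_pow (k : ℕ) :
    Function.Surjective fun i : Fin (p ^ k) =>
      Ideal.Quotient.mk (Ideal.span {(p : ℤ_[p]) ^ k}) ((i : ℕ) : ℤ_[p]) := by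
  intro x
  obtain ⟨x, rfl⟩ := Ideal.Quotient.mk_surjective x
  refine ⟨⟨x.appr k, PadicInt.appr_lt x k⟩, ?_⟩
  rw [Ideal.Quotient.eq, ← neg_mem_iff, neg_sub]
  exact PadicInt.appr_spec k x

theorem card_padicInt_quotient (n : ℕ) (hn : 0 < n) :
    Finite (ℤ_[p] ⧸ Ideal.span {(n : ℤ_[p])}) ∧
      Nat.card (ℤ_[p] ⧸ Ideal.span {(n : ℤ_[p])}) ≤ n := by
  obtain ⟨k, hk, h⟩ := exists_span_natCast_eq_span_pow (p := p) hn
  rw [h]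
  have hs := surjective_mk_fin_pow (p := p) k
  have := Finite.of_surjective _ hs
  refine ⟨this, (Nat.card_le_card_of_surjective _ hs).trans ?_⟩
  rwa [Nat.card_fin]

end PadicQuotients

/-! ### Extension of scalars and the matrices of the model algebras -/

section Scalars

/-- The basis `1 ⊗ b` of `ℤ_p ⊗ L`. -/
noncomputable def padicBasis (p : ℕ) [Fact p.Prime] {L : Type*} [LieRing L] (b : Module.Basis (Fin 3) ℤ L) :
    Module.Basis (Fin 3) ℤ_[p] (AtPrime p L) :=
  Algebra.TensorProduct.basis ℤ_[p] b

theorem lieMatrix_padicBasis (p : ℕ) [Fact p.Prime] {L : Type*} [LieRing L]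
    (b : Module.Basis (Fin 3) ℤ L) :
    lieMatrix (padicBasis p b) = (structureMatrix b).map (Int.cast : ℤ → ℤ_[p]) := by
  ext i k
  simp only [lieMatrix, structureMatrix, Matrix.of_apply, Matrix.map_apply, padicBasis,
    Algebra.TensorProduct.basis_apply, LieAlgebra.ExtendScalars.bracket_tmul, mul_one]
  rw [Algebra.TensorProduct.basis_repr_tmul]
  simp

theorem sameCotypeZeta_atPrime {L L' : Type*} [LieRing L] [LieRing L']
    (b : Module.Basis (Fin 3) ℤ L) (b' : Module.Basis (Fin 3) ℤ L') (p : ℕ) [Fact p.Prime]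
    {P : Matrix (Fin 3) (Fin 3) ℤ_[p]} {c : ℤ_[p]} (hc : IsUnit c) (hP : IsUnit P.det)
    (h : ∀ x, quadForm ((structureMatrix b').map (Int.cast : ℤ → ℤ_[p])) (P *ᵥ x) =
      c * quadForm ((structureMatrix b).map (Int.cast : ℤ → ℤ_[p])) x) :
    SameCotypeZeta ℤ_[p] (AtPrime p L) (AtPrime p L') 3 := by
  refine sameCotypeZeta_of_quadForm (padicBasis p b) (padicBasis p b') hc hP (σ := 11) ?_ ?_
  · rwa [lieMatrix_padicBasis, lieMatrix_padicBasis]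
  · exact fun s hs => summable_cotypeTerm (padicBasis p b) card_padicInt_quotient s hs

/-- The standard basis of a group that is defined to be `ℤ³`. -/
noncomputable def stdBasis {L : Type} [AddCommGroup L] (e : L ≃+ (Fin 3 → ℤ)) : Module.Basis (Fin 3) ℤ L :=
  Module.Basis.ofEquivFun e.toIntLinearEquiv

theorem stdBasis_apply {L : Type} [AddCommGroup L] (e : L ≃+ (Fin 3 → ℤ)) (i : Fin 3) :
    stdBasis e i = e.symm (Pi.single i 1) := by
  simp [stdBasis, Module.Basis.coe_ofEquivFun]

/-- The standard basis of `ℤ³` with the zero bracket. -/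
noncomputable def abelianBasis : Module.Basis (Fin 3) ℤ Abelian3 :=
  stdBasis (L := Abelian3) (AddEquiv.refl (Fin 3 → ℤ))

/-- The standard basis of the Heisenberg Lie algebra. -/
noncomputable def heisenbergBasis : Module.Basis (Fin 3) ℤ Heisenberg :=
  stdBasis (L := Heisenberg) (AddEquiv.refl (Fin 3 → ℤ))

/-- The standard basis of `sl_2(ℤ)`. -/
noncomputable def sl2Basis : Module.Basis (Fin 3) ℤ SL2 :=
  stdBasis (L := SL2) (AddEquiv.refl (Fin 3 → ℤ))

/-- The standard basis of the Lie algebra `L_1`. -/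
noncomputable def l1Basis : Module.Basis (Fin 3) ℤ L1 :=
  stdBasis (L := L1) (AddEquiv.refl (Fin 3 → ℤ))

theorem structureMatrix_abelianBasis : structureMatrix abelianBasis = 0 := by
  ext i k
  change abelianBasis.repr (0 : Abelian3) k = 0
  simp

theorem structureMatrix_heisenbergBasis :
    structureMatrix heisenbergBasis = !![0, 0, 0; 0, 0, 0; 0, 0, 1] := by
  ext i k
  have h : ∀ i, heisenbergBasis i = (Pi.single i 1 : Fin 3 → ℤ) := fun i =>
    stdBasis_apply (L := Heisenberg) (AddEquiv.refl (Fin 3 → ℤ)) i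
  rw [structureMatrix, Matrix.of_apply, h, h]
  change heisBracket (Pi.single (i + 1) 1) (Pi.single (i + 2) 1) k = _
  fin_cases i <;> fin_cases k <;> rfl

theorem structureMatrix_sl2Basis :
    structureMatrix sl2Basis = !![0, 2, 0; 2, 0, 0; 0, 0, 1] := by
  ext i k
  have h : ∀ i, sl2Basis i = (Pi.single i 1 : Fin 3 → ℤ) := fun i =>
    stdBasis_apply (L := SL2) (AddEquiv.refl (Fin 3 → ℤ)) i
  rw [structureMatrix, Matrix.of_apply, h, h]
  change sl2Bracket (Pi.single (i + 1) 1) (Pi.single (i + 2) 1) k = _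
  fin_cases i <;> fin_cases k <;> rfl

theorem structureMatrix_l1Basis :
    structureMatrix l1Basis = !![0, 0, 0; 0, -1, 0; 0, 0, 1] := by
  ext i k
  have h : ∀ i, l1Basis i = (Pi.single i 1 : Fin 3 → ℤ) := fun i =>
    stdBasis_apply (L := L1) (AddEquiv.refl (Fin 3 → ℤ)) i
  rw [structureMatrix, Matrix.of_apply, h, h]
  change l1Bracket (Pi.single (i + 1) 1) (Pi.single (i + 2) 1) k = _
  fin_cases i <;> fin_cases k <;> rfl

theorem sameCotypeZeta_abelian {L : Type*} [LieRing L] (b : Module.Basis (Fin 3) ℤ L)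
    (h : ∀ x, quadForm (structureMatrix b) x = 0) : SameCotypeZeta ℤ L Abelian3 3 := by
  refine sameCotypeZeta_of_quadForm b abelianBasis (c := 1) (P := 1) isUnit_one (by simp)
    (σ := 11) (fun x => ?_) fun s hs => summable_cotypeTerm b card_int_quotient s hs
  rw [lieMatrix_eq_structureMatrix, lieMatrix_eq_structureMatrix, h,
    structureMatrix_abelianBasis]
  simp [quadForm]

end Scalars

end CotypeZeta

namespace CotypeZeta

open Matrix

/-! ### Squares in `ℤ_p` and representation of 1 by a binary form -/

section PadicSquares

variable {p : ℕ} [hp : Fact p.Prime]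

theorem isUnit_intCast_padicInt {a : ℤ} (ha : ¬ (p : ℤ) ∣ a) : IsUnit (a : ℤ_[p]) := by
  rw [PadicInt.isUnit_iff]
  exact le_antisymm (PadicInt.norm_le_one _)
    (not_lt.1 fun h => ha ((PadicInt.norm_int_lt_one_iff_dvd a).1 h))

theorem exists_sq_eq_padicInt (h2 : p ≠ 2) {r y : ℤ_[p]} (hr : ‖r‖ = 1) (h : ‖r ^ 2 - y‖ < 1) :
    ∃ z, z ^ 2 = y := by
  have h2' : ‖(2 : ℤ_[p])‖ = 1 := by
    have := PadicInt.isUnit_iff.1 (isUnit_intCast_padicInt (p := p) (a := 2)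
      (fun h => h2 ((Nat.prime_dvd_prime_iff_eq hp.out Nat.prime_two).1 (by exact_mod_cast h))))
    simpa using this
  obtain ⟨z, hz, -⟩ := hensels_lemma (p := p) (R := ℤ_[p]) (F := Polynomial.X ^ 2 - Polynomial.C y)
    (a := r) (by simpa [hr, h2', one_add_one_eq_two] using h)
  exact ⟨z, by simpa [sub_eq_zero] using hz⟩

theorem norm_lt_one_iff_toZMod (x : ℤ_[p]) : ‖x‖ < 1 ↔ PadicInt.toZMod x = 0 := by
  rw [← RingHom.mem_ker, PadicInt.ker_toZMod, IsLocalRing.mem_maximalIdeal,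
    PadicInt.mem_nonunits]

theorem norm_eq_one_iff_toZMod (x : ℤ_[p]) : ‖x‖ = 1 ↔ PadicInt.toZMod x ≠ 0 := by
  rw [Ne, ← norm_lt_one_iff_toZMod, not_lt]
  exact ⟨fun h => h.ge, fun h => le_antisymm (PadicInt.norm_le_one x) h⟩

/-- Over `ℤ_p` with `p` odd, the form `a r² + b s²` with unit coefficients represents `1`. -/
theorem exists_mul_sq_add_mul_sq_eq_one (h2 : p ≠ 2) {a b : ℤ_[p]} (ha : IsUnit a)
    (hb : IsUnit b) : ∃ r s, a * r ^ 2 + b * s ^ 2 = 1 := by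
  -- A solution modulo `p` with `r ≠ 0` lifts: `s` is lifted arbitrarily, and Hensel's lemma solves
  -- `r² = (1 - b s²) / a`.
  have key : ∀ {a b : ℤ_[p]} (ha : IsUnit a) {r s : ZMod p}, r ≠ 0 →
      PadicInt.toZMod a * r ^ 2 + PadicInt.toZMod b * s ^ 2 = 1 →
      ∃ r s, a * r ^ 2 + b * s ^ 2 = 1 := by
    intro a b ha r s hr h
    obtain ⟨a', haa⟩ := ha.exists_right_inv
    obtain ⟨r, rfl⟩ := ZMod.ringHom_surjective (PadicInt.toZMod (p := p)) r
    obtain ⟨s, rfl⟩ := ZMod.ringHom_surjective (PadicInt.toZMod (p := p)) s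
    have haa' : PadicInt.toZMod a * PadicInt.toZMod a' = 1 := by rw [← map_mul, haa, map_one]
    obtain ⟨z, hz⟩ := exists_sq_eq_padicInt h2 (r := r) (y := a' * (1 - b * s ^ 2))
      ((norm_eq_one_iff_toZMod r).2 hr) ((norm_lt_one_iff_toZMod _).2 (by
        simp only [map_sub, map_mul, map_pow, map_one]
        linear_combination (PadicInt.toZMod a') * h - (PadicInt.toZMod r) ^ 2 * haa'))
    exact ⟨z, s, by rw [hz]; linear_combination (1 - b * s ^ 2) * haa⟩
  obtain ⟨r, s, h⟩ : ∃ r s : ZMod p, PadicInt.toZMod a * r ^ 2 + PadicInt.toZMod b * s ^ 2 = 1 := by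
    have ha0 := (ha.map PadicInt.toZMod).ne_zero
    have hb0 := (hb.map PadicInt.toZMod).ne_zero
    have hcard : Fintype.card (ZMod p) % 2 = 1 := by
      rw [ZMod.card]; exact Nat.odd_iff.1 (hp.out.odd_of_ne_two h2)
    obtain ⟨r, s, h⟩ := FiniteField.exists_root_sum_quadratic
      (f := Polynomial.C (PadicInt.toZMod a) * Polynomial.X ^ 2 + Polynomial.C 0 * Polynomial.X +
        Polynomial.C (-1))
      (g := Polynomial.C (PadicInt.toZMod b) * Polynomial.X ^ 2 + Polynomial.C 0 * Polynomial.X +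
        Polynomial.C 0) (Polynomial.degree_quadratic ha0) (Polynomial.degree_quadratic hb0) hcard
    refine ⟨r, s, ?_⟩
    simp only [Polynomial.eval_add, Polynomial.eval_mul, Polynomial.eval_C, Polynomial.eval_pow,
      Polynomial.eval_X] at h
    linear_combination h
  -- If `r = 0` then `s ≠ 0`, and the roles of `r` and `s` are exchanged.
  by_cases hr : r = 0
  · have hs : s ≠ 0 := by
      rintro rfl
      simp [hr] at h
    obtain ⟨s, r, h⟩ := key hb hs (by rw [add_comm]; exact h)
    exact ⟨r, s, by rw [add_comm]; exact h⟩
  · exact key ha hr h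

end PadicSquares

/-! ### Reduction of the form to the three models -/

section CanonicalForms

variable {R : Type*} [CommRing R]

/-- `4 A₀₀ f` is the square of the last row of `P`; the other rows only make the determinant a unit.
-/
theorem exists_quadForm_heisenberg {A : Matrix (Fin 3) (Fin 3) R} (h2 : IsUnit (2 : R))
    (hα : IsUnit (A 0 0)) (h₁ : disc₁ A = 0) (h₂ : disc₂ A = 0) (h₃ : disc₃ A = 0) :
    ∃ (P : Matrix (Fin 3) (Fin 3) R) (c : R), IsUnit c ∧ IsUnit P.det ∧
      ∀ x, quadForm !![0, 0, 0; 0, 0, 0; 0, 0, 1] (P *ᵥ x) = c * quadForm A x := by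
  refine ⟨!![0, 1, 0; 0, 0, 1; 2 * A 0 0, A 0 1 + A 1 0, A 0 2 + A 2 0], 2 * 2 * A 0 0,
    (h2.mul h2).mul hα, ?_, fun x => ?_⟩
  · simpa [Matrix.det_fin_three] using h2.mul hα
  · have h := four_mul_quadForm A x
    rw [h₁, h₂, h₃] at h
    rw [quadForm_eq !![0, 0, 0; 0, 0, 0; 0, 0, 1]]
    simp [Matrix.mulVec, dotProduct, Fin.sum_univ_three]
    linear_combination -h

/-- After both completions `16 A₀₀ t² f = (t u)² - w²`, and the last two rows of `P` are `w` and `t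
u`. -/
theorem exists_quadForm_l1 {A : Matrix (Fin 3) (Fin 3) R} (h2 : IsUnit (2 : R))
    (hα : IsUnit (A 0 0)) {t : R} (ht : IsUnit t) (h₁ : disc₁ A = t ^ 2) (hD : doubleDisc A = 0) :
    ∃ (P : Matrix (Fin 3) (Fin 3) R) (c : R), IsUnit c ∧ IsUnit P.det ∧
      ∀ x, quadForm !![0, 0, 0; 0, -1, 0; 0, 0, 1] (P *ᵥ x) = c * quadForm A x := by
  refine ⟨!![0, 0, 1; 0, 2 * t ^ 2, disc₂ A; 2 * t * (2 * A 0 0), 2 * t * (A 0 1 + A 1 0),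
    2 * t * (A 0 2 + A 2 0)], 2 ^ 4 * A 0 0 * t ^ 2, ((h2.pow 4).mul hα).mul (ht.pow 2), ?_,
    fun x => ?_⟩
  · have : IsUnit (2 ^ 3 * t ^ 3 * A 0 0) := ((h2.pow 3).mul (ht.pow 3)).mul hα
    rw [← IsUnit.neg_iff] at this
    convert this using 1
    simp [Matrix.det_fin_three]
    ring
  · have h := sixteen_mul_quadForm A x
    rw [h₁, hD] at h
    rw [quadForm_eq !![0, 0, 0; 0, -1, 0; 0, 0, 1]]
    simp [Matrix.mulVec, dotProduct, Fin.sum_univ_three]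
    linear_combination -h

/-- With `d = disc₁ A`, `D = doubleDisc A` and `v = x 2`, the completed form is `d u² - w² + D v²`.
The composition identity `(d r² + D s²)(d u² + D v²) = (d r u + D s v)² + d D (r v - s u)²`, with
first factor 1, turns it into `(d r u + D s v - w)(d r u + D s v + w) + d D (r v - s u)²`. Dividing
by `d D` gives `4 X Y + Z²`; this is why `i` inverts `4 d D`. -/
theorem exists_quadForm_sl2 {A : Matrix (Fin 3) (Fin 3) R} (h2 : IsUnit (2 : R))
    (hα : IsUnit (A 0 0)) (h₁ : IsUnit (disc₁ A)) (hD : IsUnit (doubleDisc A)) {r s : R}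
    (hrs : disc₁ A * r ^ 2 + doubleDisc A * s ^ 2 = 1) :
    ∃ (P : Matrix (Fin 3) (Fin 3) R) (c : R), IsUnit c ∧ IsUnit P.det ∧
      ∀ x, quadForm !![0, 2, 0; 2, 0, 0; 0, 0, 1] (P *ᵥ x) = c * quadForm A x := by
  obtain ⟨i, hi⟩ := (((h2.pow 2).mul h₁).mul hD).exists_right_inv
  obtain ⟨j, hj⟩ := hD.exists_right_inv
  have hiu : IsUnit i := IsUnit.of_mul_eq_one _ (by rw [mul_comm]; exact hi)
  have hju : IsUnit j := IsUnit.of_mul_eq_one _ (by rw [mul_comm]; exact hj)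
  refine ⟨!![i * (2 * disc₁ A * r * (2 * A 0 0)),
      i * (2 * disc₁ A * r * (A 0 1 + A 1 0) - 2 * disc₁ A),
      i * (2 * disc₁ A * r * (A 0 2 + A 2 0) + doubleDisc A * s - disc₂ A);
    2 * disc₁ A * r * (2 * A 0 0), 2 * disc₁ A * r * (A 0 1 + A 1 0) + 2 * disc₁ A,
      2 * disc₁ A * r * (A 0 2 + A 2 0) + doubleDisc A * s + disc₂ A;
    - 2 * s * (2 * A 0 0), - 2 * s * (A 0 1 + A 1 0), r - 2 * s * (A 0 2 + A 2 0)],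
    2 ^ 4 * A 0 0 * j, ((h2.pow 4).mul hα).mul hju, ?_, fun x => ?_⟩
  · have : IsUnit (2 ^ 4 * A 0 0 * disc₁ A * i) := (((h2.pow 4).mul hα).mul h₁).mul hiu
    convert this using 1
    generalize disc₁ A = d at *
    generalize doubleDisc A = D at *
    generalize disc₂ A = e at *
    simp [Matrix.det_fin_three]
    linear_combination (2 ^ 4 * A 0 0 * d * i) * hrs
  · have h := sixteen_mul_quadForm A x
    rw [quadForm_eq !![0, 2, 0; 2, 0, 0; 0, 0, 1]]
    generalize quadForm A x = f at *
    generalize disc₁ A = d at *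
    generalize doubleDisc A = D at *
    generalize disc₂ A = e at *
    simp [Matrix.mulVec, dotProduct, Fin.sum_univ_three]
    set u := 2 * (2 * A 0 0 * x 0 + (A 0 1 + A 1 0) * x 1 + (A 0 2 + A 2 0) * x 2) with hu
    set w := 2 * d * x 1 + e * x 2 with hw
    have e1 : 4 * i * ((d * r * u + D * s * x 2 - w) * (d * r * u + D * s * x 2 + w)) +
        (r * x 2 - s * u) ^ 2 = 16 * A 0 0 * j * f := by
      have hij : 4 * i * d = j := by linear_combination j * hi -
        2 ^ 2 * d * i * hj
      have hd : 4 * i * d * D = 1 := by linear_combination hi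
      linear_combination (-4 * i) * h + (4 * i * (d * u ^ 2 + D * x 2 ^ 2)) * hrs -
        (-16 * A 0 0 * f) * hij - (r * x 2 - s * u) ^ 2 * hd
    rw [← sub_eq_zero] at e1 ⊢
    rw [← e1, hu, hw]
    ring

end CanonicalForms

/-! ### Comparison with the model algebras at almost all primes -/

section CanonicalFormsPadic

variable {L : Type*} [LieRing L] (b : Module.Basis (Fin 3) ℤ L)

theorem map_conj {R : Type*} [CommRing R] (A Q : Matrix (Fin 3) (Fin 3) ℤ) :
    (Qᵀ * A * Q).map (Int.cast : ℤ → R) =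
      (Q.map (Int.cast : ℤ → R))ᵀ * A.map (Int.cast : ℤ → R) * Q.map (Int.cast : ℤ → R) := by
  have := Matrix.map_mul (L := Qᵀ * A) (M := Q) (f := Int.castRingHom R)
  have h' := Matrix.map_mul (L := Qᵀ) (M := A) (f := Int.castRingHom R)
  simp only [Int.coe_castRingHom] at this h'
  rw [this, h', Matrix.transpose_map]

/-- Equality of cotype zeta functions over `ℤ_p` from a similarity of the quadratic forms, after an
integral change of basis. -/
theorem sameCotypeZeta_atPrime_of_conj {L' : Type*} [LieRing L']
    (b' : Module.Basis (Fin 3) ℤ L') {Q : Matrix (Fin 3) (Fin 3) ℤ} (hQ : IsUnit Q.det) (p : ℕ)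
    [Fact p.Prime] {T : Matrix (Fin 3) (Fin 3) ℤ_[p]}
    (hT : (structureMatrix b').map (Int.cast : ℤ → ℤ_[p]) = T)
    (h : ∃ (P : Matrix (Fin 3) (Fin 3) ℤ_[p]) (c : ℤ_[p]), IsUnit c ∧ IsUnit P.det ∧
      ∀ x, quadForm T (P *ᵥ x) =
        c * quadForm ((Qᵀ * structureMatrix b * Q).map (Int.cast : ℤ → ℤ_[p])) x) :
    SameCotypeZeta ℤ_[p] (AtPrime p L) (AtPrime p L') 3 := by
  obtain ⟨P, c, hc, hP, h⟩ := h
  have hQ' : IsUnit (Q.map (Int.cast : ℤ → ℤ_[p])).det := by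
    have := hQ.map (Int.castRingHom ℤ_[p])
    rwa [RingHom.map_det] at this
  refine sameCotypeZeta_atPrime b b' p (P := P * (Q.map (Int.cast : ℤ → ℤ_[p]))⁻¹) hc ?_ ?_
  · rw [Matrix.det_mul]
    exact hP.mul (Matrix.isUnit_nonsing_inv_det _ hQ')
  · intro x
    rw [← Matrix.mulVec_mulVec, hT, h, map_conj, quadForm_conj, Matrix.mulVec_mulVec,
      Matrix.mul_nonsing_inv _ hQ', Matrix.one_mulVec]

variable {p : ℕ} [hp : Fact p.Prime]

theorem isUnit_two_padicInt (h2 : p ≠ 2) : IsUnit (2 : ℤ_[p]) := by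
  have := isUnit_intCast_padicInt (p := p) (a := 2)
    (fun h => h2 ((Nat.prime_dvd_prime_iff_eq hp.out Nat.prime_two).1 (by exact_mod_cast h)))
  simpa using this

theorem disc₁_map (A : Matrix (Fin 3) (Fin 3) ℤ) :
    disc₁ (A.map (Int.cast : ℤ → ℤ_[p])) = (disc₁ A : ℤ) := by simp [disc₁]

theorem disc₂_map (A : Matrix (Fin 3) (Fin 3) ℤ) :
    disc₂ (A.map (Int.cast : ℤ → ℤ_[p])) = (disc₂ A : ℤ) := by simp [disc₂]

theorem disc₃_map (A : Matrix (Fin 3) (Fin 3) ℤ) :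
    disc₃ (A.map (Int.cast : ℤ → ℤ_[p])) = (disc₃ A : ℤ) := by simp [disc₃]

theorem doubleDisc_map (A : Matrix (Fin 3) (Fin 3) ℤ) :
    doubleDisc (A.map (Int.cast : ℤ → ℤ_[p])) = (doubleDisc A : ℤ) := by
  simp [doubleDisc, disc₁_map, disc₂_map, disc₃_map]

variable {b} {Q : Matrix (Fin 3) (Fin 3) ℤ} {A : Matrix (Fin 3) (Fin 3) ℤ}

theorem sameCotypeZeta_heisenberg (hQ : IsUnit Q.det) (hA : A = Qᵀ * structureMatrix b * Q)
    (h2 : p ≠ 2) (hα : ¬ (p : ℤ) ∣ A 0 0) (h₁ : disc₁ A = 0) (h₂ : disc₂ A = 0)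
    (h₃ : disc₃ A = 0) :
    SameCotypeZeta ℤ_[p] (AtPrime p L) (AtPrime p Heisenberg) 3 := by
  refine sameCotypeZeta_atPrime_of_conj b heisenbergBasis hQ p
    (T := !![0, 0, 0; 0, 0, 0; 0, 0, 1]) ?_ ?_
  · rw [structureMatrix_heisenbergBasis]
    ext i j
    fin_cases i <;> fin_cases j <;> simp
  · rw [← hA]
    refine exists_quadForm_heisenberg (isUnit_two_padicInt h2) (isUnit_intCast_padicInt hα) ?_ ?_ ?_
    · simp [disc₁_map, h₁]
    · simp [disc₂_map, h₂]
    · simp [disc₃_map, h₃]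

theorem sameCotypeZeta_l1 (hQ : IsUnit Q.det) (hA : A = Qᵀ * structureMatrix b * Q)
    (h2 : p ≠ 2) (hα : ¬ (p : ℤ) ∣ A 0 0) {t : ℤ} (ht : ¬ (p : ℤ) ∣ t) (h₁ : disc₁ A = t ^ 2)
    (hD : doubleDisc A = 0) : SameCotypeZeta ℤ_[p] (AtPrime p L) (AtPrime p L1) 3 := by
  refine sameCotypeZeta_atPrime_of_conj b l1Basis hQ p
    (T := !![0, 0, 0; 0, -1, 0; 0, 0, 1]) ?_ ?_
  · rw [structureMatrix_l1Basis]
    ext i j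
    fin_cases i <;> fin_cases j <;> simp
  · rw [← hA]
    refine exists_quadForm_l1 (isUnit_two_padicInt h2) (isUnit_intCast_padicInt hα)
      (isUnit_intCast_padicInt ht) ?_ ?_
    · simp [disc₁_map, h₁]
    · simp [doubleDisc_map, hD]

theorem sameCotypeZeta_sl2 (hQ : IsUnit Q.det) (hA : A = Qᵀ * structureMatrix b * Q)
    (h2 : p ≠ 2) (hα : ¬ (p : ℤ) ∣ A 0 0) (h₁ : ¬ (p : ℤ) ∣ disc₁ A)
    (hD : ¬ (p : ℤ) ∣ doubleDisc A) : SameCotypeZeta ℤ_[p] (AtPrime p L) (AtPrime p SL2) 3 := by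
  refine sameCotypeZeta_atPrime_of_conj b sl2Basis hQ p
    (T := !![0, 2, 0; 2, 0, 0; 0, 0, 1]) ?_ ?_
  · rw [structureMatrix_sl2Basis]
    ext i j
    fin_cases i <;> fin_cases j <;> simp
  · rw [← hA]
    have h₁' := isUnit_intCast_padicInt h₁
    have hD' := isUnit_intCast_padicInt hD
    obtain ⟨r, s, hrs⟩ := exists_mul_sq_add_mul_sq_eq_one h2 h₁' hD'
    rw [← disc₁_map] at h₁' hrs
    rw [← doubleDisc_map] at hD' hrs
    exact exists_quadForm_sl2 (isUnit_two_padicInt h2) (isUnit_intCast_padicInt hα) h₁' hD' hrs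

end CanonicalFormsPadic

end CotypeZeta

namespace CotypeZeta

open Matrix

/-! ### The rank in terms of the discriminants -/

section Rank

theorem quadRank_eq_card_of_conj {A U : Matrix (Fin 3) (Fin 3) ℤ} {w : Fin 3 → ℤ}
    (hU : U.det ≠ 0) (h : Uᵀ * (A + Aᵀ) * U = Matrix.diagonal w) :
    quadRank A = Fintype.card {i // w i ≠ 0} := by
  have h' := congrArg (fun M : Matrix (Fin 3) (Fin 3) ℤ => M.map (Int.cast : ℤ → ℚ)) h
  simp only [map_conj] at h'
  rw [Matrix.diagonal_map Int.cast_zero] at h'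
  have hU' : IsUnit (U.map (Int.cast : ℤ → ℚ)).det := by
    have := RingHom.map_det (Int.castRingHom ℚ) U
    rw [isUnit_iff_ne_zero]
    intro h0
    refine hU (Int.cast_injective (α := ℚ) ?_)
    rw [Int.cast_zero, ← h0]
    exact this
  have hr := congrArg Matrix.rank h'
  rw [Matrix.rank_mul_eq_left_of_isUnit_det _ _ hU', Matrix.rank_mul_eq_right_of_isUnit_det _ _
    (by rwa [Matrix.det_transpose]), Matrix.rank_diagonal] at hr
  rw [quadRank, hr]
  exact Fintype.card_congr (Equiv.subtypeEquivRight fun i => by simp)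

theorem quadRank_conj {A Q : Matrix (Fin 3) (Fin 3) ℤ} (hQ : Q.det ≠ 0) :
    quadRank (Qᵀ * A * Q) = quadRank A := by
  have hQ' : IsUnit (Q.map (Int.cast : ℤ → ℚ)).det := by
    have := RingHom.map_det (Int.castRingHom ℚ) Q
    rw [isUnit_iff_ne_zero]
    intro h0
    refine hQ (Int.cast_injective (α := ℚ) ?_)
    rw [Int.cast_zero, ← h0]
    exact this
  have : Qᵀ * A * Q + (Qᵀ * A * Q)ᵀ = Qᵀ * (A + Aᵀ) * Q := by
    simp only [Matrix.transpose_mul, Matrix.transpose_transpose, Matrix.mul_add, Matrix.add_mul,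
      Matrix.mul_assoc]
  rw [quadRank, this, map_conj, Matrix.rank_mul_eq_left_of_isUnit_det _ _ hQ',
    Matrix.rank_mul_eq_right_of_isUnit_det _ _ (by rwa [Matrix.det_transpose]), quadRank]

theorem quadRank_of_quadForm_eq_zero {A : Matrix (Fin 3) (Fin 3) ℤ}
    (h : ∀ x, quadForm A x = 0) : quadRank A = 0 := by
  have : A + Aᵀ = 0 := by
    have h0 := h ![1, 0, 0]
    have h1 := h ![0, 1, 0]
    have h2 := h ![0, 0, 1]
    have h3 := h ![1, 1, 0]
    have h4 := h ![1, 0, 1]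
    have h5 := h ![0, 1, 1]
    simp [quadForm_eq] at h0 h1 h2 h3 h4 h5
    ext i j
    fin_cases i <;> fin_cases j <;> simp <;> lia
  rw [quadRank, this]
  simp

theorem quadRank_of_disc_eq_zero {A : Matrix (Fin 3) (Fin 3) ℤ} (hα : A 0 0 ≠ 0)
    (h₁ : disc₁ A = 0) (h₂ : disc₂ A = 0) (h₃ : disc₃ A = 0) : quadRank A = 1 := by
  rw [quadRank_eq_card_of_conj (A := A) (w := ![2 * A 0 0, 0, 0])
    (U := !![1, -(A 0 1 + A 1 0), -(A 0 2 + A 2 0); 0, 2 * A 0 0, 0; 0, 0, 2 * A 0 0])]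
  · rw [Fintype.card_eq_one_iff]
    refine ⟨⟨0, by simpa using hα⟩, ?_⟩
    rintro ⟨i, hi⟩
    fin_cases i
    · rfl
    · exact absurd rfl hi
    · exact absurd rfl hi
  · simp [Matrix.det_fin_three, hα]
  · rw [disc₁] at h₁
    rw [disc₂] at h₂
    rw [disc₃] at h₃
    ext i j
    fin_cases i <;> fin_cases j <;>
      simp [Matrix.mul_apply, Fin.sum_univ_three]
    · ring
    · ring
    · ring
    · ring
    · linear_combination (-2 * A 0 0) * h₁
    · linear_combination (-A 0 0) * h₂
    · ring
    · linear_combination (-A 0 0) * h₂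
    · linear_combination (-2 * A 0 0) * h₃

/-- The columns of `U` come from completing the square twice with cleared denominators; they are
orthogonal for the Gram matrix. -/
theorem quadRank_of_disc₁_ne_zero {A : Matrix (Fin 3) (Fin 3) ℤ} (hα : A 0 0 ≠ 0)
    (h₁ : disc₁ A ≠ 0) : quadRank A = if doubleDisc A = 0 then 2 else 3 := by
  rw [quadRank_eq_card_of_conj (A := A)
    (w := ![2 * A 0 0, -2 * A 0 0 * disc₁ A, 2 * A 0 0 * disc₁ A * doubleDisc A])
    (U := !![1, -(A 0 1 + A 1 0), (A 0 1 + A 1 0) * disc₂ A - 2 * (A 0 2 + A 2 0) * disc₁ A;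
      0, 2 * A 0 0, -2 * A 0 0 * disc₂ A; 0, 0, 4 * A 0 0 * disc₁ A])]
  · rw [Fintype.card_subtype]
    split_ifs with hD
    · have : (Finset.univ.filter fun i : Fin 3 => (![2 * A 0 0, -2 * A 0 0 * disc₁ A,
          2 * A 0 0 * disc₁ A * doubleDisc A] : Fin 3 → ℤ) i ≠ 0) = {0, 1} := by
        ext i
        fin_cases i <;> simp [hα, h₁, hD]
      rw [this]
      rfl
    · have : (Finset.univ.filter fun i : Fin 3 => (![2 * A 0 0, -2 * A 0 0 * disc₁ A,
          2 * A 0 0 * disc₁ A * doubleDisc A] : Fin 3 → ℤ) i ≠ 0) = Finset.univ := by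
        ext i
        fin_cases i <;> simp [hα, h₁, hD]
      rw [this]
      rfl
  · simp [Matrix.det_fin_three, hα, h₁]
  · ext i j
    fin_cases i <;> fin_cases j <;>
      simp [Matrix.mul_apply, Fin.sum_univ_three, doubleDisc,
        disc₁, disc₂, disc₃] <;> ring

end Rank

/-! ### Choice of a basis with nonzero leading coefficients -/

section Normalization

/-- The six matrices tried have first columns `e_i` and `e_i + e_j`, and a form vanishing at all of
these is zero. -/
theorem exists_apply_zero_ne_zero {A : Matrix (Fin 3) (Fin 3) ℤ} {v : Fin 3 → ℤ}
    (h : quadForm A v ≠ 0) :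
    ∃ Q : Matrix (Fin 3) (Fin 3) ℤ, IsUnit Q.det ∧ (Qᵀ * A * Q) 0 0 ≠ 0 := by
  have key : ∀ Q : Matrix (Fin 3) (Fin 3) ℤ, (Qᵀ * A * Q) 0 0 = quadForm A (Q *ᵥ ![1, 0, 0]) := by
    intro Q
    rw [← quadForm_conj, quadForm_eq]
    simp
  by_contra! hA
  have H : ∀ Q : Matrix (Fin 3) (Fin 3) ℤ, IsUnit Q.det → quadForm A (Q *ᵥ ![1, 0, 0]) = 0 :=
    fun Q hQ => (key Q).symm.trans (hA Q hQ)
  have h0 := H 1 (by simp)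
  have h1 := H !![0, 1, 0; 1, 0, 0; 0, 0, 1] (by simp [Matrix.det_fin_three])
  have h2 := H !![0, 0, 1; 0, 1, 0; 1, 0, 0] (by simp [Matrix.det_fin_three])
  have h3 := H !![1, 0, 0; 1, 1, 0; 0, 0, 1] (by simp [Matrix.det_fin_three])
  have h4 := H !![1, 0, 0; 0, 1, 0; 1, 0, 1] (by simp [Matrix.det_fin_three])
  have h5 := H !![0, 1, 0; 1, 0, 0; 1, 0, 1] (by simp [Matrix.det_fin_three])
  simp [quadForm_eq] at h0 h1 h2 h3 h4 h5
  refine h ?_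
  rw [quadForm_eq, h0, h1, h2, show A 0 1 + A 1 0 = 0 by lia, show A 0 2 + A 2 0 = 0 by lia,
    show A 1 2 + A 2 1 = 0 by lia]
  ring

/-- With the first basis vector fixed, choosing `v` in the span of the other two as second basis
vector makes `disc₁` the value of `Δ` at `v`. A nonzero binary form cannot vanish at `e_1`, `e_2`
and `e_1 + e_2`. -/
theorem exists_disc₁_ne_zero {A : Matrix (Fin 3) (Fin 3) ℤ} (hα : A 0 0 ≠ 0)
    (h : ¬ (disc₁ A = 0 ∧ disc₂ A = 0 ∧ disc₃ A = 0)) :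
    ∃ Q : Matrix (Fin 3) (Fin 3) ℤ, IsUnit Q.det ∧ (Qᵀ * A * Q) 0 0 ≠ 0 ∧
      disc₁ (Qᵀ * A * Q) ≠ 0 := by
  by_contra! hA
  have h1 : disc₁ A = 0 := by
    have := hA 1 (by simp)
    simpa [hα] using this
  have h3 : disc₃ A = 0 := by
    have := hA !![1, 0, 0; 0, 0, 1; 0, 1, 0] (by simp [Matrix.det_fin_three])
    simpa [hα, disc₁, disc₃, Matrix.mul_apply, Fin.sum_univ_three] using this
  refine h ⟨h1, ?_, h3⟩
  have := hA !![1, 0, 0; 0, 1, 0; 0, 1, 1] (by simp [Matrix.det_fin_three])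
  simp [hα, disc₁, Matrix.mul_apply, Fin.sum_univ_three] at this
  rw [disc₁] at h1
  rw [disc₃] at h3
  rw [disc₂]
  linear_combination this - h1 - h3

/-- Every integral ternary quadratic form is, after a change of basis, of one of three shapes. -/
theorem exists_normalization (A : Matrix (Fin 3) (Fin 3) ℤ) :
    ((∀ x, quadForm A x = 0) ∧ quadRank A = 0) ∨
    ∃ Q : Matrix (Fin 3) (Fin 3) ℤ, IsUnit Q.det ∧ (Qᵀ * A * Q) 0 0 ≠ 0 ∧
      ((disc₁ (Qᵀ * A * Q) = 0 ∧ disc₂ (Qᵀ * A * Q) = 0 ∧ disc₃ (Qᵀ * A * Q) = 0 ∧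
          quadRank A = 1) ∨
        (disc₁ (Qᵀ * A * Q) ≠ 0 ∧
          quadRank A = if doubleDisc (Qᵀ * A * Q) = 0 then 2 else 3)) := by
  by_cases h : ∀ x, quadForm A x = 0
  · exact Or.inl ⟨h, quadRank_of_quadForm_eq_zero h⟩
  · right
    push Not at h
    obtain ⟨v, hv⟩ := h
    obtain ⟨Q, hQ, hα⟩ := exists_apply_zero_ne_zero hv
    by_cases hd : disc₁ (Qᵀ * A * Q) = 0 ∧ disc₂ (Qᵀ * A * Q) = 0 ∧ disc₃ (Qᵀ * A * Q) = 0
    · refine ⟨Q, hQ, hα, Or.inl ⟨hd.1, hd.2.1, hd.2.2, ?_⟩⟩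
      rw [← quadRank_conj (A := A) hQ.ne_zero]
      exact quadRank_of_disc_eq_zero hα hd.1 hd.2.1 hd.2.2
    · obtain ⟨Q', hQ', hα', hd'⟩ := exists_disc₁_ne_zero hα hd
      have e : Q'ᵀ * (Qᵀ * A * Q) * Q' = (Q * Q')ᵀ * A * (Q * Q') := by
        simp only [Matrix.transpose_mul, Matrix.mul_assoc]
      rw [e] at hα' hd'
      have hQQ : IsUnit (Q * Q').det := by
        rw [Matrix.det_mul]
        exact hQ.mul hQ'
      refine ⟨Q * Q', hQQ, hα', Or.inr ⟨hd', ?_⟩⟩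
      rw [← quadRank_conj (A := A) hQQ.ne_zero]
      exact quadRank_of_disc₁_ne_zero hα' hd'

end Normalization

/-! ### Reducibility and square discriminants -/

section Reducibility

open MvPolynomial

theorem eval_quadPoly (A : Matrix (Fin 3) (Fin 3) ℤ) (x : Fin 3 → ℤ) :
    MvPolynomial.eval x (quadPoly A) = quadForm A x := by
  simp only [quadPoly, map_sum, map_mul, MvPolynomial.eval_C, MvPolynomial.eval_X, quadForm,
    dotProduct, Matrix.mulVec, Finset.mul_sum]
  exact Finset.sum_congr rfl fun i _ => Finset.sum_congr rfl fun j _ => by ring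

theorem eval_of_totalDegree_le_one {σ R : Type*} [Fintype σ] [CommRing R] {g : MvPolynomial σ R}
    (hg : g.totalDegree ≤ 1) (x : σ → R) :
    MvPolynomial.eval x g = g.coeff 0 + (fun i => g.coeff (Finsupp.single i 1)) ⬝ᵥ x := by
  classical
  have : g = MvPolynomial.C (g.coeff 0) +
      ∑ i, MvPolynomial.C (g.coeff (Finsupp.single i 1)) * MvPolynomial.X i := by
    ext d
    rw [MvPolynomial.coeff_add, MvPolynomial.coeff_sum, MvPolynomial.coeff_C]
    simp only [MvPolynomial.coeff_C_mul, MvPolynomial.coeff_X]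
    by_cases h0 : d = 0
    · subst h0
      simp
    by_cases h1 : ∃ i, d = Finsupp.single i 1
    · obtain ⟨i, rfl⟩ := h1
      have : ∀ j, (Finsupp.single j 1 = Finsupp.single i 1) ↔ j = i := fun j =>
        Finsupp.single_left_inj one_ne_zero
      simp [this, Ne.symm h0]
    · have h2 : ∀ j, Finsupp.single j 1 ≠ d := fun j hj => h1 ⟨j, hj.symm⟩
      simp only [Ne.symm h0, h2, if_false, mul_zero, Finset.sum_const_zero, add_zero]
      refine MvPolynomial.coeff_eq_zero_of_totalDegree_lt (lt_of_le_of_lt hg ?_)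
      by_contra hlt
      have hs : (d.sum fun _ n => n) ≤ 1 := not_lt.1 hlt
      rcases Nat.le_one_iff_eq_zero_or_eq_one.1 hs with hs | hs
      · refine h0 (Finsupp.ext fun i => ?_)
        by_contra hi
        have := (Finset.sum_eq_zero_iff.1 hs) i (Finsupp.mem_support_iff.2 hi)
        exact hi this
      · exact h1 ((Finsupp.sum_eq_one_iff d).1 hs)
  conv_lhs => rw [this]
  simp [dotProduct]

theorem totalDegree_quadPoly_le (A : Matrix (Fin 3) (Fin 3) ℤ) :
    (quadPoly A).totalDegree ≤ 2 := by
  refine (MvPolynomial.totalDegree_finsetSum _ _).trans (Finset.sup_le fun i _ =>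
    (MvPolynomial.totalDegree_finsetSum _ _).trans (Finset.sup_le fun j _ => ?_))
  refine (MvPolynomial.totalDegree_mul _ _).trans ?_
  refine Nat.add_le_add ((MvPolynomial.totalDegree_mul _ _).trans
    (Nat.add_le_add (MvPolynomial.totalDegree_C _).le (MvPolynomial.totalDegree_X _).le))
    (MvPolynomial.totalDegree_X _).le

/-- A reducible quadratic form is a product of two linear forms. -/
theorem exists_linear_of_isReducibleForm {A : Matrix (Fin 3) (Fin 3) ℤ}
    (h : IsReducibleForm (quadPoly A)) (hA : quadPoly A ≠ 0) :
    ∃ l m : Fin 3 → ℤ, ∀ x, quadForm A x = (l ⬝ᵥ x) * (m ⬝ᵥ x) := by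
  obtain ⟨g, h, hg, hh, hgh⟩ := h
  have hdeg := totalDegree_quadPoly_le A
  rw [hgh] at hA
  rw [hgh, MvPolynomial.totalDegree_mul_of_isDomain (left_ne_zero_of_mul hA)
    (right_ne_zero_of_mul hA)] at hdeg
  have hg1 : g.totalDegree ≤ 1 := by lia
  have hh1 : h.totalDegree ≤ 1 := by lia
  refine ⟨fun i => g.coeff (Finsupp.single i 1), fun i => h.coeff (Finsupp.single i 1),
    fun x => ?_⟩
  have key : ∀ x, quadForm A x =
      (g.coeff 0 + (fun i => g.coeff (Finsupp.single i 1)) ⬝ᵥ x) *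
        (h.coeff 0 + (fun i => h.coeff (Finsupp.single i 1)) ⬝ᵥ x) := fun x => by
    rw [← eval_quadPoly, hgh, map_mul, eval_of_totalDegree_le_one hg1,
      eval_of_totalDegree_le_one hh1]
  -- Comparing the values at `0`, `x` and `-x` eliminates the constant terms of the two factors.
  have h0 := key 0
  have h1 := key x
  have h2 := key (-x)
  have hneg : quadForm A (-x) = quadForm A x := by
    rw [quadForm_eq, quadForm_eq]; simp
  have hzero : quadForm A 0 = 0 := by rw [quadForm_eq]; simp
  rw [hneg, dotProduct_neg, dotProduct_neg] at h2
  rw [hzero, dotProduct_zero, dotProduct_zero] at h0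
  refine mul_left_cancel₀ (two_ne_zero (α := ℤ)) ?_
  linear_combination h1 + h2 - 2 * h0

/-- The discriminant of a product of two linear forms in two variables is the square of their
determinant. -/
theorem isSquare_disc₁_of_isReducibleForm {A Q : Matrix (Fin 3) (Fin 3) ℤ}
    (h : IsReducibleForm (quadPoly A)) (hα : (Qᵀ * A * Q) 0 0 ≠ 0) :
    ∃ t, disc₁ (Qᵀ * A * Q) = t ^ 2 := by
  have hA : quadPoly A ≠ 0 := by
    intro h0
    have : ∀ x, quadForm (Qᵀ * A * Q) x = 0 := fun x => by
      rw [quadForm_conj, ← eval_quadPoly, h0, map_zero]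
    refine hα ?_
    simpa [quadForm_eq] using this ![1, 0, 0]
  obtain ⟨l, m, hlm⟩ := exists_linear_of_isReducibleForm h hA
  have key : ∀ x, quadForm (Qᵀ * A * Q) x = ((l ᵥ* Q) ⬝ᵥ x) * ((m ᵥ* Q) ⬝ᵥ x) := fun x => by
    rw [quadForm_conj, hlm, dotProduct_mulVec, dotProduct_mulVec]
  generalize Qᵀ * A * Q = B at key
  generalize l ᵥ* Q = l at key
  generalize m ᵥ* Q = m at key
  have h0 := key ![1, 0, 0]
  have h1 := key ![0, 1, 0]
  have h2 := key ![1, 1, 0]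
  simp [quadForm_eq, dotProduct, Fin.sum_univ_three] at h0 h1 h2
  refine ⟨l 0 * m 1 - l 1 * m 0, ?_⟩
  have h3 : B 0 1 + B 1 0 = l 0 * m 1 + l 1 * m 0 := by linear_combination h2 - h0 - h1
  rw [disc₁, h0, h1, h3]
  ring

/-- This is Gauss's lemma: the primes dividing `c` remain prime in the polynomial ring and are
cancelled from one of the two factors one at a time, without changing degrees. -/
theorem isReducibleForm_of_C_mul {f : MvPolynomial (Fin 3) ℤ} (c : ℤ) (hc : c ≠ 0) :
    ∀ g h : MvPolynomial (Fin 3) ℤ, g.totalDegree ≠ 0 → h.totalDegree ≠ 0 →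
      MvPolynomial.C c * f = g * h → IsReducibleForm f := by
  induction c using UniqueFactorizationMonoid.induction_on_prime with
  | h₁ => exact absurd rfl hc
  | h₂ c hc' =>
    intro g h hg hh hgh
    obtain ⟨u, rfl⟩ := hc'
    refine ⟨MvPolynomial.C ((u⁻¹ : ℤˣ) : ℤ) * g, h, ?_, hh, ?_⟩
    · rw [MvPolynomial.totalDegree_mul_of_isDomain (by simp) (by rintro rfl; simp at hg)]
      rwa [MvPolynomial.totalDegree_C, zero_add]
    · rw [mul_assoc, ← hgh, ← mul_assoc, ← MvPolynomial.C_mul]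
      simp
  | h₃ c q hc0 hq ih =>
    have hq' : Prime (MvPolynomial.C q : MvPolynomial (Fin 3) ℤ) := (MvPolynomial.prime_C_iff _).2 hq
    have hdeg : ∀ {g : MvPolynomial (Fin 3) ℤ}, (MvPolynomial.C q * g).totalDegree ≠ 0 →
        g.totalDegree ≠ 0 := by
      intro g hg hg0
      refine hg (Nat.le_zero.1 ((MvPolynomial.totalDegree_mul _ _).trans ?_))
      rw [MvPolynomial.totalDegree_C, hg0]
    intro g h hg hh hgh
    have hdvd : MvPolynomial.C q ∣ g * h := ⟨MvPolynomial.C c * f, by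
      rw [← hgh, MvPolynomial.C_mul, mul_assoc]⟩
    rw [MvPolynomial.C_mul, mul_assoc] at hgh
    rcases hq'.dvd_or_dvd hdvd with ⟨g', rfl⟩ | ⟨h', rfl⟩
    · refine ih hc0 g' h (hdeg hg) hh (mul_left_cancel₀ hq'.ne_zero ?_)
      rw [hgh, mul_assoc]
    · refine ih hc0 g h' hg (hdeg hh) (mul_left_cancel₀ hq'.ne_zero ?_)
      rw [hgh, mul_left_comm]

theorem isReducibleForm_of_eq_mul {A : Matrix (Fin 3) (Fin 3) ℤ} {c : ℤ} (hc : c ≠ 0)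
    {v : Fin 3 → ℤ} (hv : quadForm A v ≠ 0) {l m : Fin 3 → ℤ}
    (h : ∀ x, c * quadForm A x = (l ⬝ᵥ x) * (m ⬝ᵥ x)) : IsReducibleForm (quadPoly A) := by
  have heval : ∀ (l : Fin 3 → ℤ) x, MvPolynomial.eval x
      (∑ i, MvPolynomial.C (l i) * MvPolynomial.X i) = l ⬝ᵥ x := fun l x => by
    simp [dotProduct]
  -- A linear form that is nonzero at `v` vanishes at the origin and so is not constant.
  have hdeg : ∀ l : Fin 3 → ℤ, l ⬝ᵥ v ≠ 0 →
      (∑ i, MvPolynomial.C (l i) * MvPolynomial.X i :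
        MvPolynomial (Fin 3) ℤ).totalDegree ≠ 0 := by
    intro l hl h0
    rw [MvPolynomial.totalDegree_eq_zero_iff_eq_C] at h0
    have h1 := heval l v
    have h2 := heval l 0
    rw [h0, MvPolynomial.eval_C] at h1 h2
    rw [dotProduct_zero] at h2
    exact hl (h1.symm.trans h2)
  have hlm : (l ⬝ᵥ v) * (m ⬝ᵥ v) ≠ 0 := by
    rw [← h]
    exact mul_ne_zero hc hv
  refine isReducibleForm_of_C_mul c hc _ _ (hdeg l (left_ne_zero_of_mul hlm))
    (hdeg m (right_ne_zero_of_mul hlm)) (MvPolynomial.funext fun x => ?_)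
  rw [map_mul, map_mul, MvPolynomial.eval_C, eval_quadPoly, heval, heval, h]

/-- A multiple of the form is a difference of two squares of integral linear forms, hence a product
over `ℤ`. -/
theorem isReducibleForm_of_disc₁_eq_sq {A Q : Matrix (Fin 3) (Fin 3) ℤ} (hQ : IsUnit Q.det)
    (hα : (Qᵀ * A * Q) 0 0 ≠ 0) (h₁ : disc₁ (Qᵀ * A * Q) ≠ 0)
    (hD : doubleDisc (Qᵀ * A * Q) = 0) {t : ℤ} (ht : disc₁ (Qᵀ * A * Q) = t ^ 2) :
    IsReducibleForm (quadPoly A) := by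
  have hB : ∀ x, quadForm A x = quadForm (Qᵀ * A * Q) (Q⁻¹ *ᵥ x) := fun x => by
    rw [quadForm_conj, Matrix.mulVec_mulVec, Matrix.mul_nonsing_inv _ hQ, Matrix.one_mulVec]
  have hv : quadForm A (Q *ᵥ ![1, 0, 0]) ≠ 0 := by
    rw [← quadForm_conj, quadForm_eq]
    simpa using hα
  generalize Qᵀ * A * Q = B at *
  let u : Fin 3 → ℤ := ![2 * t * (2 * B 0 0), 2 * t * (B 0 1 + B 1 0), 2 * t * (B 0 2 + B 2 0)]
  let w : Fin 3 → ℤ := ![0, 2 * disc₁ B, disc₂ B]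
  refine isReducibleForm_of_eq_mul (c := 16 * B 0 0 * disc₁ B)
    (mul_ne_zero (mul_ne_zero (by norm_num) hα) h₁) hv (l := (u - w) ᵥ* Q⁻¹) (m := (u + w) ᵥ* Q⁻¹)
    fun x => ?_
  rw [hB, sixteen_mul_quadForm, ← dotProduct_mulVec, ← dotProduct_mulVec]
  generalize Q⁻¹ *ᵥ x = y
  rw [hD]
  simp only [u, w, dotProduct, Fin.sum_univ_three, Pi.sub_apply, Pi.add_apply]
  simp
  linear_combination (2 * (2 * B 0 0 * y 0 + (B 0 1 + B 1 0) * y 1 + (B 0 2 + B 2 0) * y 2)) ^ 2 *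
    ht

end Reducibility

end CotypeZeta

namespace CotypeZeta

/-! ### Local Dirichlet series on the strip `Re s > 19/10` -/

section LocalFactors

/-- The half-plane `Re s > 2 - 1/10`. -/
def polarStrip : Set ℂ := {s | 2 - (1 / 10 : ℝ) < s.re}

theorem isOpen_polarStrip : IsOpen polarStrip := isOpen_lt continuous_const Complex.continuous_re

/-- The local Dirichlet series at `p` of the coefficients `a`. -/
noncomputable def localSeries (a : ℕ → ℝ) (p : ℕ) (s : ℂ) : ℂ :=
  ∑' n : ℕ, (a (p ^ n) : ℂ) * ((p ^ n : ℕ) : ℂ) ^ (-s)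

/-- The summable majorant of the local Dirichlet series. -/
noncomputable def localBound (n : ℕ) : ℝ := ((n : ℝ) + 1) ^ 2 * ((2 : ℝ) ^ (-(1 / 10) : ℝ)) ^ n

theorem summable_localBound : Summable localBound := by
  have h0 : (0 : ℝ) < (2 : ℝ) ^ (-(1 / 10) : ℝ) := by positivity
  have h1 : (2 : ℝ) ^ (-(1 / 10) : ℝ) < 1 :=
    Real.rpow_lt_one_of_one_lt_of_neg (by norm_num) (by norm_num)
  have h := (summable_nat_add_iff 1).2 (summable_pow_mul_geometric_of_norm_lt_one 2
    (r := (2 : ℝ) ^ (-(1 / 10) : ℝ)) (by rwa [Real.norm_of_nonneg h0.le]))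
  refine (h.mul_right ((2 : ℝ) ^ (-(1 / 10) : ℝ))⁻¹).congr fun n => ?_
  rw [localBound, pow_succ _ n, ← mul_assoc, mul_inv_cancel_right₀ h0.ne', Nat.cast_add_one]

variable {a : ℕ → ℝ} {p : ℕ} {s : ℂ} {K : ℝ}

theorem norm_natCast_pow_cpow (hp : 0 < p) (n : ℕ) :
    ‖((p ^ n : ℕ) : ℂ) ^ (-s)‖ = (p : ℝ) ^ (-(s.re * n)) := by
  rw [Complex.norm_natCast_cpow_of_pos (pow_pos hp n), Complex.neg_re, Nat.cast_pow,
    ← Real.rpow_natCast, ← Real.rpow_mul (Nat.cast_nonneg p)]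
  ring_nf

theorem norm_localTerm_le (ha : ∀ n, 0 ≤ a n) (hp : 0 < p)
    (hK : ∀ n : ℕ, a (p ^ n) ≤ K * ((n : ℝ) + 1) ^ 2 * (p : ℝ) ^ (n + n / 2)) (hs : s ∈ polarStrip)
    (n : ℕ) : ‖(a (p ^ n) : ℂ) * ((p ^ n : ℕ) : ℂ) ^ (-s)‖ ≤
      K * ((n : ℝ) + 1) ^ 2 * (p : ℝ) ^ (((n + n / 2 : ℕ) : ℝ) - 19 / 10 * n) := by
  have hp1 : (1 : ℝ) ≤ p := by exact_mod_cast hp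
  have hp0 : (0 : ℝ) < p := by positivity
  rw [norm_mul, norm_natCast_pow_cpow hp, Complex.norm_real, Real.norm_of_nonneg (ha _),
    Real.rpow_sub hp0, Real.rpow_natCast, ← mul_div_assoc, div_eq_mul_inv, ← Real.rpow_neg hp0.le]
  have hs' : (19 / 10 : ℝ) ≤ s.re := by
    have : 2 - (1 / 10 : ℝ) < s.re := hs
    linarith
  have h2 : (p : ℝ) ^ (-(s.re * n)) ≤ (p : ℝ) ^ (-(19 / 10 * n : ℝ)) :=
    Real.rpow_le_rpow_of_exponent_le hp1 (neg_le_neg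
      (mul_le_mul_of_nonneg_right hs' (Nat.cast_nonneg n)))
  exact mul_le_mul (hK n) h2 (by positivity) ((ha _).trans (hK n))

theorem nonneg_of_bound (ha : ∀ n, 0 ≤ a n)
    (hK : ∀ n : ℕ, a (p ^ n) ≤ K * ((n : ℝ) + 1) ^ 2 * (p : ℝ) ^ (n + n / 2)) : 0 ≤ K := by
  have := (ha _).trans (hK 0)
  simpa using this

theorem norm_localTerm_le_localBound (ha : ∀ n, 0 ≤ a n) (hp : 2 ≤ p)
    (hK : ∀ n : ℕ, a (p ^ n) ≤ K * ((n : ℝ) + 1) ^ 2 * (p : ℝ) ^ (n + n / 2)) (hs : s ∈ polarStrip)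
    (n : ℕ) : ‖(a (p ^ n) : ℂ) * ((p ^ n : ℕ) : ℂ) ^ (-s)‖ ≤ K * localBound n := by
  have hK0 := nonneg_of_bound ha hK
  refine (norm_localTerm_le ha (by lia) hK hs n).trans ?_
  rw [localBound, mul_assoc]
  refine mul_le_mul_of_nonneg_left (mul_le_mul_of_nonneg_left ?_ (by positivity)) hK0
  have hp2 : (2 : ℝ) ≤ p := by exact_mod_cast hp
  have h1 : ((n + n / 2 : ℕ) : ℝ) - 19 / 10 * n ≤ -(1 / 10) * n := by
    have : ((n / 2 : ℕ) : ℝ) ≤ n / 2 := Nat.cast_div_le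
    have h0 : (0 : ℝ) ≤ n := Nat.cast_nonneg n
    push_cast
    linarith
  rw [← Real.rpow_natCast, ← Real.rpow_mul (by norm_num)]
  refine (Real.rpow_le_rpow_of_exponent_le (by linarith) h1).trans ?_
  exact Real.rpow_le_rpow_of_nonpos (by norm_num) hp2
    (by have h0 : (0 : ℝ) ≤ n := Nat.cast_nonneg n; linarith)

theorem norm_localTerm_add_three_le (ha : ∀ n, 0 ≤ a n) (hp : 2 ≤ p)
    (hK : ∀ n : ℕ, a (p ^ n) ≤ K * ((n : ℝ) + 1) ^ 2 * (p : ℝ) ^ (n + n / 2)) (hs : s ∈ polarStrip)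
    (n : ℕ) : ‖(a (p ^ (n + 3)) : ℂ) * ((p ^ (n + 3) : ℕ) : ℂ) ^ (-s)‖ ≤
      K * (p : ℝ) ^ (-(3 / 2) : ℝ) * (((2 : ℝ) ^ (-(1 / 10) : ℝ)) ^ 3)⁻¹ * localBound (n + 3) := by
  have hK0 := nonneg_of_bound ha hK
  refine (norm_localTerm_le ha (by lia) hK hs (n + 3)).trans ?_
  have hp2 : (2 : ℝ) ≤ p := by exact_mod_cast hp
  have h0 : (0 : ℝ) ≤ n := Nat.cast_nonneg n
  -- For `n ≥ 1` the estimate `(n + 3) / 2` without the floor suffices. For `n = 0` it would give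
  -- only `-6/5`; the floor `3 / 2 = 1` gives `-17/10`.
  have h1 : (((n + 3) + (n + 3) / 2 : ℕ) : ℝ) - 19 / 10 * ((n + 3 : ℕ) : ℝ) ≤
      -(3 / 2) + -(1 / 10) * n := by
    rcases Nat.eq_zero_or_pos n with rfl | hn
    · norm_num
    · have : (((n + 3) / 2 : ℕ) : ℝ) ≤ ((n + 3 : ℕ) : ℝ) / 2 := Nat.cast_div_le
      have hn1 : (1 : ℝ) ≤ n := by exact_mod_cast hn
      push_cast at this ⊢
      linarith
  have h2 : (p : ℝ) ^ (-(1 / 10) * n : ℝ) ≤ (2 : ℝ) ^ (-(1 / 10) * n : ℝ) :=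
    Real.rpow_le_rpow_of_nonpos (by norm_num) hp2 (by linarith)
  have h3 := (Real.rpow_le_rpow_of_exponent_le (by linarith) h1).trans_eq
    (Real.rpow_add (by linarith : (0 : ℝ) < p) _ _)
  have h4 : (2 : ℝ) ^ (-(1 / 10) * n : ℝ) = ((2 : ℝ) ^ (-(1 / 10) : ℝ)) ^ n := by
    rw [Real.rpow_mul (by norm_num), Real.rpow_natCast]
  rw [h4] at h2
  have h5 := h3.trans (mul_le_mul_of_nonneg_left h2 (by positivity))
  rw [localBound, pow_add]
  have hρ : (0 : ℝ) < (2 : ℝ) ^ (-(1 / 10) : ℝ) := by positivity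
  generalize (2 : ℝ) ^ (-(1 / 10) : ℝ) = ρ at *
  calc _ ≤ K * (((n + 3 : ℕ) : ℝ) + 1) ^ 2 * ((p : ℝ) ^ (-(3 / 2) : ℝ) * ρ ^ n) :=
        mul_le_mul_of_nonneg_left h5 (by positivity)
    _ = _ := by field_simp

/-- The local Dirichlet series is `1` plus its first two terms, up to `O(p ^ (-3/2))`. -/
theorem norm_localSeries_sub_le (ha : ∀ n, 0 ≤ a n) (h1 : a 1 = 1) (hp : 2 ≤ p)
    (hK : ∀ n : ℕ, a (p ^ n) ≤ K * ((n : ℝ) + 1) ^ 2 * (p : ℝ) ^ (n + n / 2)) (hs : s ∈ polarStrip) :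
    ‖localSeries a p s - (1 + (a p : ℂ) * (p : ℂ) ^ (-s) +
      (a (p ^ 2) : ℂ) * ((p ^ 2 : ℕ) : ℂ) ^ (-s))‖ ≤
      K * (((2 : ℝ) ^ (-(1 / 10) : ℝ)) ^ 3)⁻¹ * (∑' n, localBound (n + 3)) *
        (p : ℝ) ^ (-(3 / 2) : ℝ) := by
  have hsum : Summable fun n : ℕ => (a (p ^ n) : ℂ) * ((p ^ n : ℕ) : ℂ) ^ (-s) :=
    Summable.of_norm_bounded (summable_localBound.mul_left K)
      (norm_localTerm_le_localBound ha hp hK hs)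
  have hsplit := hsum.sum_add_tsum_nat_add 3
  have hb : Summable fun n => localBound (n + 3) := (summable_nat_add_iff 3).2 summable_localBound
  rw [localSeries, ← hsplit]
  have hfin : ∑ n ∈ Finset.range 3, (a (p ^ n) : ℂ) * ((p ^ n : ℕ) : ℂ) ^ (-s) =
      1 + (a p : ℂ) * (p : ℂ) ^ (-s) + (a (p ^ 2) : ℂ) * ((p ^ 2 : ℕ) : ℂ) ^ (-s) := by
    simp [Finset.sum_range_succ, h1]
  rw [hfin, add_sub_cancel_left]
  refine (tsum_of_norm_bounded (hb.mul_left _).hasSum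
    (norm_localTerm_add_three_le ha hp hK hs)).trans_eq ?_
  rw [tsum_mul_left]
  ring

theorem differentiableOn_localSeries (ha : ∀ n, 0 ≤ a n) (hp : 2 ≤ p)
    (hK : ∀ n : ℕ, a (p ^ n) ≤ K * ((n : ℝ) + 1) ^ 2 * (p : ℝ) ^ (n + n / 2)) :
    DifferentiableOn ℂ (localSeries a p) polarStrip := by
  refine Complex.differentiableOn_tsum_of_summable_norm (summable_localBound.mul_left K)
    (fun n => ?_) isOpen_polarStrip
    (fun n s hs => norm_localTerm_le_localBound ha hp hK hs n)
  have : ((p ^ n : ℕ) : ℂ) ≠ 0 := by exact_mod_cast (pow_pos (by lia) n).ne'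
  refine Differentiable.differentiableOn ?_
  intro s
  exact (DifferentiableAt.const_cpow (by fun_prop) (Or.inl this)).const_mul _

/-- At a real point the local Dirichlet series is a real number, at least `1`. -/
theorem exists_localSeries_ofReal (ha : ∀ n, 0 ≤ a n) (h1 : a 1 = 1) (hp : 2 ≤ p)
    (hK : ∀ n : ℕ, a (p ^ n) ≤ K * ((n : ℝ) + 1) ^ 2 * (p : ℝ) ^ (n + n / 2)) {σ : ℝ}
    (hσ : (σ : ℂ) ∈ polarStrip) :
    Summable (fun n : ℕ => a (p ^ n) * ((p ^ n : ℕ) : ℝ) ^ (-σ)) ∧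
    localSeries a p σ = ((∑' n : ℕ, a (p ^ n) * ((p ^ n : ℕ) : ℝ) ^ (-σ) : ℝ) : ℂ) ∧
      1 ≤ ∑' n : ℕ, a (p ^ n) * ((p ^ n : ℕ) : ℝ) ^ (-σ) := by
  have hterm : ∀ n : ℕ, (a (p ^ n) : ℂ) * ((p ^ n : ℕ) : ℂ) ^ (-(σ : ℂ)) =
      ((a (p ^ n) * ((p ^ n : ℕ) : ℝ) ^ (-σ) : ℝ) : ℂ) := fun n => by
    rw [Complex.ofReal_mul, Complex.ofReal_cpow (Nat.cast_nonneg _), Complex.ofReal_neg,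
      Complex.ofReal_natCast]
  have hsum : Summable fun n : ℕ => a (p ^ n) * ((p ^ n : ℕ) : ℝ) ^ (-σ) := by
    refine Summable.of_norm_bounded (summable_localBound.mul_left K) fun n => ?_
    have := norm_localTerm_le_localBound ha hp hK hσ n
    rwa [hterm, Complex.norm_real] at this
  refine ⟨hsum, ?_, ?_⟩
  · rw [localSeries, Complex.ofReal_tsum]
    exact tsum_congr hterm
  · have := hsum.le_tsum 0 fun n _ => mul_nonneg (ha _) (by positivity)
    simpa [h1] using this

end LocalFactors

/-! ### Second-order error of an Euler factor -/

section Perturbation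

/-- The first-order terms cancel. With `ε = p ^ (-3/4)` the remaining error `ε² = p ^ (-3/2)` is
summable over the primes. -/
theorem norm_one_add_mul_sub_one_le {ε C : ℝ} {u w r : ℂ} (hε : ε ≤ 1) (hu : ‖u‖ ≤ ε)
    (hw : ‖w‖ ≤ ε) (hr : ‖r‖ ≤ C * ε ^ 2) :
    ‖(1 + u + w + r) * ((1 - u) * (1 - w)) - 1‖ ≤ (4 * C + 7) * ε ^ 2 := by
  have hε0 : 0 ≤ ε := (norm_nonneg u).trans hu
  have e : (1 + u + w + r) * ((1 - u) * (1 - w)) - 1 =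
      -((u + w) * (u + w)) + u * w * (1 + u + w) + r * ((1 - u) * (1 - w)) := by ring
  have hsum : ‖u + w‖ ≤ 2 * ε := (norm_add_le _ _).trans (by linarith)
  have h1 : ‖(u + w) * (u + w)‖ ≤ 4 * ε ^ 2 := by
    rw [norm_mul]
    nlinarith [norm_nonneg (u + w)]
  have h2 : ‖u * w * (1 + u + w)‖ ≤ ε ^ 2 * 3 := by
    rw [norm_mul, norm_mul, sq]
    have h3 : ‖1 + u + w‖ ≤ 3 := by
      refine (norm_add_le _ _).trans ?_
      have := norm_add_le 1 u
      rw [norm_one] at this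
      linarith
    gcongr
  have h3 : ∀ {z : ℂ}, ‖z‖ ≤ ε → ‖1 - z‖ ≤ 2 := fun {z} hz => by
    have := norm_sub_le 1 z
    rw [norm_one] at this
    linarith
  have h4 : ‖r * ((1 - u) * (1 - w))‖ ≤ C * ε ^ 2 * (2 * 2) := by
    rw [norm_mul, norm_mul]
    have hC : 0 ≤ C * ε ^ 2 := (norm_nonneg r).trans hr
    gcongr
    · exact h3 hu
    · exact h3 hw
  rw [e]
  refine (norm_add_le _ _).trans ((add_le_add ((norm_add_le _ _).trans
    (add_le_add (norm_neg _).le le_rfl)) le_rfl).trans ?_)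
  linarith

end Perturbation

/-! ### From convergent Euler products to Dirichlet series -/

section EulerProducts

/-- The Dirichlet series with coefficients `a` converges absolutely for `Re s > x`, and its sum has
a meromorphic continuation beyond that half-plane, with a pole of order `k` at `x`. -/
def DirichletSeriesHasPole (a : ℕ → ℝ) (x : ℝ) (k : ℕ) : Prop :=
  (∀ s : ℂ, x < s.re → Summable fun n : ℕ => (a n : ℂ) * (n : ℂ) ^ (-s)) ∧
  ∃ δ : ℝ, 0 < δ ∧ ∃ F : ℂ → ℂ,
    MeromorphicOn F {s : ℂ | x - δ < s.re} ∧
    (∀ s : ℂ, x < s.re → F s = ∑' n : ℕ, (a n : ℂ) * (n : ℂ) ^ (-s)) ∧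
    meromorphicOrderAt F (x : ℂ) = ((-(k : ℤ) : ℤ) : WithTop ℤ)

variable {a : ℕ → ℝ}

/-- A series with nonnegative multiplicative coefficients converges if its Euler product does. -/
theorem summable_of_hasProd_localSeries (ha : ∀ n, 0 ≤ a n) (h0 : a 0 = 0) (h1 : a 1 = 1)
    (hmul : ∀ m n : ℕ, m.Coprime n → a (m * n) = a m * a n) {K : ℝ}
    (hK : ∀ p : ℕ, p.Prime → ∀ n : ℕ, a (p ^ n) ≤ K * ((n : ℝ) + 1) ^ 2 * (p : ℝ) ^ (n + n / 2))
    {σ : ℝ} (hσ : (σ : ℂ) ∈ polarStrip) {V : ℂ}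
    (hV : HasProd (fun p : Nat.Primes => localSeries a p σ) V) :
    Summable fun n : ℕ => a n * (n : ℝ) ^ (-σ) := by
  set f : ℕ → ℝ := fun n => a n * (n : ℝ) ^ (-σ) with hf
  have hf0 : 0 ≤ f := fun n => mul_nonneg (ha n) (by positivity)
  have hD := fun (p : ℕ) (hp : p.Prime) =>
    exists_localSeries_ofReal ha h1 hp.two_le (hK p hp) hσ
  have hnorm : HasProd (fun p : Nat.Primes => ∑' n : ℕ, f ((p : ℕ) ^ n)) ‖V‖ := by
    refine hV.norm.congr_fun fun p => ?_
    rw [(hD p p.2).2.1, Complex.norm_real, Real.norm_of_nonneg (zero_le_one.trans (hD p p.2).2.2)]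
  -- At a real point every local factor is at least 1, so partial products increase to the full
  -- product.
  have hbound : ∀ S : Finset Nat.Primes, ∏ p ∈ S, ∑' n : ℕ, f ((p : ℕ) ^ n) ≤ ‖V‖ := fun S =>
    ge_of_tendsto hnorm ((Filter.eventually_ge_atTop S).mono fun S' hS =>
      Finset.prod_le_prod_of_subset_of_one_le hS
        (fun p _ => zero_le_one.trans (hD p p.2).2.2) fun p _ _ => (hD p p.2).2.2)
  -- Positive integers below `N` are `N`-smooth, so each finite partial sum is bounded by the
  -- product over the primes below `N`.
  refine summable_of_sum_le hf0 (c := ‖V‖) fun u => ?_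
  obtain ⟨N, hN⟩ := u.exists_nat_subset_range
  have hf1 : f 1 = 1 := by simp [hf, h1]
  have hfmul : ∀ {m n : ℕ}, m.Coprime n → f (m * n) = f m * f n := fun {m n} hmn => by
    simp only [hf, hmul m n hmn, Nat.cast_mul]
    rw [Real.mul_rpow (Nat.cast_nonneg _) (Nat.cast_nonneg _)]
    ring
  have hsm := (EulerProduct.summable_and_hasSum_smoothNumbers_prod_primesBelow_tsum hf1 hfmul
    (fun {p} hp => (hD p hp).1.norm) N).2
  have hsm' : HasSum ((N.smoothNumbers : Set ℕ).indicator f) _ :=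
    hasSum_subtype_iff_indicator.1 hsm
  have hle := sum_le_hasSum u (fun n _ => Set.indicator_nonneg (fun n _ => hf0 n) n) hsm'
  have hprod : ∏ p ∈ N.primesBelow, ∑' n : ℕ, f (p ^ n) ≤ ‖V‖ := by
    have h := hbound (N.primesBelow.subtype Nat.Prime)
    have e := Finset.prod_subtype_eq_prod_filter (s := N.primesBelow) (p := Nat.Prime)
      (fun p : ℕ => ∑' n : ℕ, f (p ^ n))
    rw [Finset.filter_true_of_mem fun p hp => Nat.prime_of_mem_primesBelow hp] at e
    exact e.ge.trans h
  refine le_trans (le_of_eq (Finset.sum_congr rfl fun n hn => ?_)) (hle.trans hprod)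
  rcases Nat.eq_zero_or_pos n with rfl | hn0
  · have : f 0 = 0 := by simp [hf, h0]
    rw [this, Set.indicator_apply]
    simp [this]
  · rw [Set.indicator_of_mem]
    exact Nat.mem_smoothNumbers_of_lt hn0 (Finset.mem_range.1 (hN hn))

theorem norm_term_eq (ha : ∀ n, 0 ≤ a n) (h0 : a 0 = 0) (s : ℂ) (n : ℕ) :
    ‖(a n : ℂ) * (n : ℂ) ^ (-s)‖ = a n * (n : ℝ) ^ (-s.re) := by
  rcases Nat.eq_zero_or_pos n with rfl | hn
  · simp [h0]
  · rw [norm_mul, Complex.norm_natCast_cpow_of_pos hn, Complex.norm_real,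
      Real.norm_of_nonneg (ha n), Complex.neg_re]

/-- An Euler product that converges at real points is the Dirichlet series. -/
theorem summable_and_tsum_eq_of_hasProd (ha : ∀ n, 0 ≤ a n) (h0 : a 0 = 0) (h1 : a 1 = 1)
    (hmul : ∀ m n : ℕ, m.Coprime n → a (m * n) = a m * a n) {K : ℝ}
    (hK : ∀ p : ℕ, p.Prime → ∀ n : ℕ, a (p ^ n) ≤ K * ((n : ℝ) + 1) ^ 2 * (p : ℝ) ^ (n + n / 2))
    {F : ℂ → ℂ}
    (hF : ∀ s : ℂ, 2 < s.re → HasProd (fun p : Nat.Primes => localSeries a p s) (F s))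
    {s : ℂ} (hs : 2 < s.re) :
    (Summable fun n : ℕ => (a n : ℂ) * (n : ℂ) ^ (-s)) ∧
      F s = ∑' n : ℕ, (a n : ℂ) * (n : ℂ) ^ (-s) := by
  have hσ : ((s.re : ℝ) : ℂ) ∈ polarStrip := by
    change 2 - (1 / 10 : ℝ) < ((s.re : ℝ) : ℂ).re
    rw [Complex.ofReal_re]
    linarith
  have hsum := summable_of_hasProd_localSeries ha h0 h1 hmul hK hσ
    (hF _ (by rwa [Complex.ofReal_re]))
  have hnorm : Summable fun n : ℕ => ‖(a n : ℂ) * (n : ℂ) ^ (-s)‖ :=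
    hsum.congr fun n => (norm_term_eq ha h0 s n).symm
  refine ⟨hnorm.of_norm, (hF s hs).unique ?_⟩
  refine EulerProduct.eulerProduct_hasProd (f := fun n : ℕ => (a n : ℂ) * (n : ℂ) ^ (-s))
    (by simp [h1]) (fun {m n} hmn => ?_) hnorm (by simp [h0])
  simp only [hmul m n hmn, Nat.cast_mul, Complex.ofReal_mul]
  rw [Complex.natCast_mul_natCast_cpow]
  ring

end EulerProducts

end CotypeZeta

namespace CotypeZeta

open Complex

/-! ### The shifted zeta function near `s = 2` -/

section ZetaShift

/-- The entire function `(s - 1) ζ(s)`. -/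
noncomputable def entireZeta : ℂ → ℂ := DirichletCharacter.LFunctionTrivChar₁ 1

theorem differentiable_entireZeta : Differentiable ℂ entireZeta :=
  DirichletCharacter.differentiable_LFunctionTrivChar₁ 1

theorem entireZeta_one_ne_zero : entireZeta 1 ≠ 0 :=
  DirichletCharacter.LFunctionTrivChar₁_apply_one_ne_zero 1

theorem entireZeta_eq {s : ℂ} (hs : s ≠ 1) : entireZeta s = (s - 1) * riemannZeta s := by
  rw [entireZeta, DirichletCharacter.LFunctionTrivChar₁, Function.update_of_ne hs,
    DirichletCharacter.LFunctionTrivChar, DirichletCharacter.LFunction_modOne_eq]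

theorem riemannZeta_sub_one_eq {s : ℂ} (hs : 2 < s.re) :
    riemannZeta (s - 1) = entireZeta (s - 1) / (s - 2) := by
  have h1 : s - 1 ≠ 1 := fun h => by
    have := congrArg Complex.re h
    rw [Complex.sub_re, Complex.one_re] at this
    linarith
  have h2 : s - 2 ≠ 0 := fun h => by
    have := congrArg Complex.re h
    rw [Complex.sub_re, Complex.zero_re] at this
    norm_num at this
    linarith
  rw [entireZeta_eq h1, eq_div_iff h2]
  ring

theorem hasProd_riemannZeta_sub_one {s : ℂ} (hs : 2 < s.re) :
    HasProd (fun p : Nat.Primes => (1 - (p : ℂ) ^ (1 - s))⁻¹) (riemannZeta (s - 1)) := by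
  have h := riemannZeta_eulerProduct_hasProd (s := s - 1) (by
    rw [Complex.sub_re, Complex.one_re]
    linarith)
  simpa only [neg_sub] using h

end ZetaShift

/-! ### Meromorphic continuation past `Re s = 2` -/

section Continuation

variable {a : ℕ → ℝ}

theorem norm_prime_cpow_one_sub_le {p : ℕ} (hp : p.Prime) {s : ℂ} (hs : s ∈ polarStrip) :
    ‖(p : ℂ) ^ (1 - s)‖ ≤ (p : ℝ) ^ (-(3 / 4) : ℝ) := by
  rw [Complex.norm_natCast_cpow_of_pos hp.pos]
  refine Real.rpow_le_rpow_of_exponent_le (by exact_mod_cast hp.one_le) ?_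
  have : 2 - (1 / 10 : ℝ) < s.re := hs
  rw [Complex.sub_re, Complex.one_re]
  linarith

/-- The pole at `2` of a Dirichlet series whose local factors agree, up to `O(p ^ (-3/2))`, with
those of a product `ζ(s - 1) W(s)`, where `W` is given by an Euler product for `Re s > 2` and has a
pole of order `j` at `2`. -/
theorem dirichletSeriesHasPole_of_local (ha : ∀ n, 0 ≤ a n) (h0 : a 0 = 0) (h1 : a 1 = 1)
    (hmul : ∀ m n : ℕ, m.Coprime n → a (m * n) = a m * a n) {K : ℝ}
    (hK : ∀ p : ℕ, p.Prime → ∀ n : ℕ, a (p ^ n) ≤ K * ((n : ℝ) + 1) ^ 2 * (p : ℝ) ^ (n + n / 2))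
    {w : ℕ → ℂ → ℂ} (hw : ∀ p : ℕ, p.Prime → DifferentiableOn ℂ (w p) polarStrip)
    (hwb : ∀ p : ℕ, p.Prime → ∀ s ∈ polarStrip, ‖w p s‖ ≤ (p : ℝ) ^ (-(3 / 4) : ℝ)) {C : ℝ}
    (hC : ∀ p : ℕ, p.Prime → ∀ s ∈ polarStrip,
      ‖(a p : ℂ) * (p : ℂ) ^ (-s) + (a (p ^ 2) : ℂ) * ((p ^ 2 : ℕ) : ℂ) ^ (-s) -
        ((p : ℂ) ^ (1 - s) + w p s)‖ ≤ C * (p : ℝ) ^ (-(3 / 2) : ℝ))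
    {h : ℂ → ℂ} (hh : DifferentiableOn ℂ h polarStrip) (hh2 : h 2 ≠ 0) (j : ℕ)
    (hW : ∀ s : ℂ, 2 < s.re →
      HasProd (fun p : Nat.Primes => (1 - w p s)⁻¹) (h s / (s - 2) ^ j)) :
    DirichletSeriesHasPole a 2 (j + 1) := by
  -- `E` collects the inverse Euler factors of `ζ(s - 1) W(s)`, so that `1 + f = D E` is the local
  -- factor of the quotient of the series by this product.
  set D : Nat.Primes → ℂ → ℂ := fun p s => localSeries a p s with hD
  set E : Nat.Primes → ℂ → ℂ := fun p s => (1 - (p : ℂ) ^ (1 - s)) * (1 - w p s) with hE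
  set f : Nat.Primes → ℂ → ℂ := fun p s => D p s * E p s - 1 with hf
  have hlt : ∀ p : Nat.Primes, ∀ z : ℂ, ‖z‖ ≤ ((p : ℕ) : ℝ) ^ (-(3 / 4) : ℝ) → 1 - z ≠ 0 := by
    intro p z hz hz1
    have h2 : ((p : ℕ) : ℝ) ^ (-(3 / 4) : ℝ) < 1 :=
      Real.rpow_lt_one_of_one_lt_of_neg (by exact_mod_cast p.2.one_lt) (by norm_num)
    rw [← sub_eq_zero.1 hz1, norm_one] at hz
    linarith
  have hE0 : ∀ p : Nat.Primes, ∀ s ∈ polarStrip, 1 - ((p : ℕ) : ℂ) ^ (1 - s) ≠ 0 ∧ 1 - w p s ≠ 0 :=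
    fun p s hs => ⟨hlt p _ (norm_prime_cpow_one_sub_le p.2 hs), hlt p _ (hwb p p.2 s hs)⟩
  obtain ⟨M, hM⟩ : ∃ M : ℝ, ∀ p : Nat.Primes, ∀ s ∈ polarStrip,
      ‖f p s‖ ≤ M * ((p : ℕ) : ℝ) ^ (-(3 / 2) : ℝ) := by
    set C' := K * (((2 : ℝ) ^ (-(1 / 10) : ℝ)) ^ 3)⁻¹ * (∑' n, localBound (n + 3)) with hC'
    refine ⟨4 * (C' + C) + 7, fun p s hs => ?_⟩
    have hε : (((p : ℕ) : ℝ) ^ (-(3 / 4) : ℝ)) ^ 2 = ((p : ℕ) : ℝ) ^ (-(3 / 2) : ℝ) := by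
      rw [← Real.rpow_natCast, ← Real.rpow_mul (Nat.cast_nonneg _)]
      norm_num
    have hr := norm_localSeries_sub_le ha h1 p.2.two_le (hK p p.2) hs
    have hr' := hC p p.2 s hs
    have key := norm_one_add_mul_sub_one_le (ε := ((p : ℕ) : ℝ) ^ (-(3 / 4) : ℝ)) (C := C' + C)
      (u := ((p : ℕ) : ℂ) ^ (1 - s)) (w := w p s)
      (r := D p s - 1 - ((p : ℕ) : ℂ) ^ (1 - s) - w p s)
      (Real.rpow_le_one_of_one_le_of_nonpos (by exact_mod_cast p.2.one_le) (by norm_num))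
      (norm_prime_cpow_one_sub_le p.2 hs) (hwb p p.2 s hs) (by
        rw [hε, add_mul]
        refine le_trans ?_ (add_le_add hr hr')
        refine le_trans (le_of_eq ?_) (norm_add_le _ _)
        congr 1
        simp only [hD]
        ring)
    rw [hε] at key
    refine le_trans (le_of_eq ?_) key
    congr 1
    simp only [hf, hE]
    ring
  have hu : Summable fun p : Nat.Primes => M * ((p : ℕ) : ℝ) ^ (-(3 / 2) : ℝ) :=
    (Nat.Primes.summable_rpow.2 (by norm_num)).mul_left M
  have hDd : ∀ p : Nat.Primes, DifferentiableOn ℂ (D p) polarStrip := fun p =>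
    differentiableOn_localSeries ha p.2.two_le (hK p p.2)
  have hfd : ∀ p, DifferentiableOn ℂ (f p) polarStrip := by
    intro p
    have hp0 : ((p : ℕ) : ℂ) ≠ 0 := by exact_mod_cast p.2.ne_zero
    have hπ : Differentiable ℂ fun s : ℂ => ((p : ℕ) : ℂ) ^ (1 - s) := fun s =>
      DifferentiableAt.const_cpow (by fun_prop) (Or.inl hp0)
    exact ((hDd p).mul ((hπ.differentiableOn.const_sub 1).mul ((hw p p.2).const_sub 1))).sub_const 1
  set G : ℂ → ℂ := fun s => ∏' p, (1 + f p s) with hG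
  have hGprod : HasProdLocallyUniformlyOn (fun p s => 1 + f p s) G polarStrip :=
    hu.hasProdLocallyUniformlyOn_one_add isOpen_polarStrip
      (Filter.Eventually.of_forall fun p s hs => hM p s hs) fun p => (hfd p).continuousOn
  have hGd : DifferentiableOn ℂ G polarStrip := by
    have ht := hasProdLocallyUniformlyOn_iff_tendstoLocallyUniformlyOn.1 hGprod
    refine ht.differentiableOn (Filter.Eventually.of_forall fun S => ?_) isOpen_polarStrip
    exact DifferentiableOn.fun_finsetProd fun p _ => (hfd p).const_add 1
  have h2mem : (2 : ℂ) ∈ polarStrip := by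
    change 2 - (1 / 10 : ℝ) < (2 : ℂ).re
    norm_num
  -- An absolutely convergent product vanishes only if some factor does. Here `D p 2` is a real
  -- number that is at least 1, and `E p 2` is a product of two nonzero factors.
  have hG2 : G 2 ≠ 0 := by
    refine tprod_one_add_ne_zero_of_summable (fun p => ?_)
      (Summable.of_nonneg_of_le (fun p => norm_nonneg _) (fun p => hM p 2 h2mem) hu)
    have e : 1 + f p 2 = D p 2 * E p 2 := by simp only [hf]; ring
    have hD2 : D p 2 ≠ 0 := by
      have := (exists_localSeries_ofReal ha h1 p.2.two_le (hK p p.2) (σ := 2)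
        (by exact_mod_cast h2mem)).2
      rw [show D p 2 = localSeries a p ((2 : ℝ) : ℂ) by simp [hD], this.1]
      exact_mod_cast (lt_of_lt_of_le zero_lt_one this.2).ne'
    rw [e]
    exact mul_ne_zero hD2 (mul_ne_zero (hE0 p 2 h2mem).1 (hE0 p 2 h2mem).2)
  have hmem : ∀ s : ℂ, 2 < s.re → s ∈ polarStrip := fun s hs => by
    change 2 - (1 / 10 : ℝ) < s.re
    linarith
  -- For `Re s > 2`, `ζ(s - 1) = entireZeta (s - 1) / (s - 2)`. Together with `h s / (s - 2) ^ j`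
  -- this accounts for the pole of order `j + 1`, with `H` holomorphic and nonzero at `2`.
  set H : ℂ → ℂ := fun s => G s * (entireZeta (s - 1) * h s) with hH
  set F : ℂ → ℂ := fun s => (s - 2) ^ (-((j + 1 : ℕ) : ℤ)) • H s with hF
  have hHd : DifferentiableOn ℂ H polarStrip := by
    have : Differentiable ℂ fun s : ℂ => entireZeta (s - 1) :=
      differentiable_entireZeta.comp (by fun_prop)
    exact hGd.mul (this.differentiableOn.mul hh)
  have hHa : ∀ s ∈ polarStrip, AnalyticAt ℂ H s := fun s hs =>
    hHd.analyticAt (isOpen_polarStrip.mem_nhds hs)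
  have hFprod : ∀ s : ℂ, 2 < s.re →
      HasProd (fun p : Nat.Primes => localSeries a p s) (F s) := by
    intro s hs
    have hs' := hmem s hs
    have e := (hGprod.hasProd hs').mul ((hasProd_riemannZeta_sub_one hs).mul (hW s hs))
    have e2 : G s * (riemannZeta (s - 1) * (h s / (s - 2) ^ j)) = F s := by
      rw [riemannZeta_sub_one_eq hs]
      simp only [hF, hH, smul_eq_mul, zpow_neg, zpow_natCast, pow_succ]
      rw [mul_inv]
      ring
    rw [e2] at e
    refine e.congr_fun fun p => ?_
    obtain ⟨e3, e4⟩ := hE0 p s hs'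
    simp only [hf, hE, hD]
    field_simp
    ring
  have hsum := fun (s : ℂ) (hs : 2 < s.re) =>
    summable_and_tsum_eq_of_hasProd ha h0 h1 hmul hK hFprod hs
  have hFm : ∀ s ∈ polarStrip, MeromorphicAt F s := fun s hs =>
    MeromorphicAt.fun_smul (MeromorphicAt.fun_zpow (f := fun s : ℂ => s - 2) (by fun_prop) _)
      (hHa s hs).meromorphicAt
  refine ⟨fun s hs => (hsum s hs).1, 1 / 10, by norm_num, F, hFm, fun s hs => (hsum s hs).2, ?_⟩
  rw [show ((2 : ℝ) : ℂ) = 2 by norm_num, meromorphicOrderAt_eq_int_iff (hFm 2 h2mem)]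
  refine ⟨H, hHa 2 h2mem, ?_, Filter.Eventually.of_forall fun s => rfl⟩
  simp only [hH]
  refine mul_ne_zero hG2 (mul_ne_zero ?_ hh2)
  rw [show (2 : ℂ) - 1 = 1 by norm_num]
  exact entireZeta_one_ne_zero

end Continuation

end CotypeZeta

namespace CotypeZeta

/-! ### The quadratic character of a nonsquare integer -/

section JacobiCharacter

open NumberTheorySymbols

/-- Any prime factor `q` of the squarefree part occurs to an odd power. -/
theorem exists_odd_prime_power_of_not_isSquare {k : ℕ} (hk : ¬ IsSquare k) :
    ∃ q e m : ℕ, q.Prime ∧ Odd e ∧ ¬ q ∣ m ∧ k = q ^ e * m := by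
  obtain ⟨a, b, h, ha⟩ := Nat.sq_mul_squarefree k
  have ha1 : a ≠ 1 := by
    rintro rfl
    exact hk ⟨b, by rw [← h]; ring⟩
  have hb0 : b ≠ 0 := by
    rintro rfl
    exact hk ⟨0, by rw [← h]; ring⟩
  have hq := Nat.minFac_prime ha1
  obtain ⟨a', ha'⟩ := Nat.minFac_dvd a
  set q := a.minFac
  obtain ⟨i, b', hb', hb⟩ := Nat.exists_eq_pow_mul_and_not_dvd hb0 q hq.ne_one
  refine ⟨q, 2 * i + 1, b' ^ 2 * a', hq, ⟨i, rfl⟩, fun hdvd => ?_, ?_⟩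
  · rcases hq.dvd_mul.1 hdvd with h1 | h1
    · exact hb' (hq.dvd_of_dvd_pow h1)
    · obtain ⟨c, rfl⟩ := h1
      exact hq.ne_one (Nat.isUnit_iff.1 (ha q ⟨c, by rw [mul_assoc]; exact ha'⟩))
  · rw [← h, hb, ha']
    ring

theorem jacobiSym_eq_one_of_modEq {m : ℤ} {n : ℕ} (hn : Odd n)
    (h : n ≡ 1 [MOD 4 * m.natAbs]) : J(m | n) = 1 := by
  rw [jacobiSym.mod_right m hn, h, ← jacobiSym.mod_right m odd_one, jacobiSym.one_right]

/-- The Jacobi symbol of a nonsquare is not always `1`. -/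
theorem exists_jacobiSym_eq_neg_one {d : ℤ} (hd : ¬ IsSquare d) :
    ∃ n : ℕ, Odd n ∧ J(d | n) = -1 := by
  by_cases hsq : IsSquare d.natAbs
  · obtain ⟨t, ht⟩ := hsq
    have hdt : d = -((t : ℤ) ^ 2) := by
      rcases Int.natAbs_eq d with h | h
      · exact absurd ⟨(t : ℤ), by rw [h, ht]; push_cast; ring⟩ hd
      · rw [h, ht]; push_cast; ring
    have ht0 : 0 < t := by
      rcases Nat.eq_zero_or_pos t with rfl | h
      · exact absurd ⟨0, by rw [hdt]; simp⟩ hd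
      · exact h
    have hpos : 0 < t * t := Nat.mul_pos ht0 ht0
    -- For `d = -t²` the choice `n = 4t² - 1` is prime to `t` and is 3 modulo 4, so the symbol
    -- equals `(-1 / n) = -1`.
    obtain ⟨n, hn⟩ : ∃ n, n + 1 = 4 * (t * t) := ⟨4 * (t * t) - 1, by lia⟩
    have hn4 : n % 4 = 3 := by lia
    have hodd : Odd n := Nat.odd_iff.2 (by lia)
    refine ⟨n, hodd, ?_⟩
    have hcop : (t : ℤ).gcd n = 1 := by
      rw [Int.gcd_natCast_natCast]
      exact Nat.Coprime.coprime_dvd_left (⟨4 * t, by rw [hn]; ring⟩ : t ∣ n + 1) (by simp)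
    rw [hdt, jacobiSym.neg _ hodd, jacobiSym.sq_one' hcop, ZMod.χ₄_nat_three_mod_four hn4, mul_one]
  · obtain ⟨q, e, m, hq, he, hqm, hk⟩ := exists_odd_prime_power_of_not_isSquare hsq
    have hq' : Fact q.Prime := ⟨hq⟩
    obtain ⟨m', hm', hdm⟩ : ∃ m' : ℤ, m'.natAbs = m ∧ d = (q : ℤ) ^ e * m' := by
      rcases Int.natAbs_eq d with h | h
      · exact ⟨m, Int.natAbs_natCast m, by rw [h, hk]; push_cast; ring⟩
      · exact ⟨-m, by simp, by rw [h, hk]; push_cast; ring⟩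
    have hcopq : q.Coprime m := (Nat.Prime.coprime_iff_not_dvd hq).2 hqm
    -- The congruence modulo `4m` makes the symbol of `m'` trivial, and only the odd power of `q`
    -- matters. By the Chinese remainder theorem one may also ask for `n ≡ 5` modulo 8 if `q = 2`.
    -- If `q` is odd, `n` is taken to be 1 modulo 8 and a nonresidue modulo `q`, and reciprocity
    -- applies.
    suffices H : ∃ n : ℕ, Odd n ∧ n ≡ 1 [MOD 4 * m] ∧ J(q | n) = -1 by
      obtain ⟨n, hn, h1, hJ⟩ := H
      refine ⟨n, hn, ?_⟩
      rw [hdm, jacobiSym.mul_left, jacobiSym.pow_left, hJ, he.neg_one_pow,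
        jacobiSym_eq_one_of_modEq hn (by rwa [hm']), mul_one]
    rcases hq.eq_two_or_odd' with rfl | hqo
    · have hco : Nat.Coprime 8 m := Nat.Coprime.pow_left (n := 3) hcopq
      obtain ⟨n, hn8, hnm⟩ := Nat.chineseRemainder hco 5 1
      have hn8' : n % 8 = 5 := hn8
      have hodd : Odd n := Nat.odd_iff.2 (by lia)
      refine ⟨n, hodd, ?_, ?_⟩
      · refine (Nat.modEq_and_modEq_iff_modEq_mul (Nat.Coprime.pow_left (n := 2) hcopq)).1 ⟨?_, hnm⟩
        change n % 4 = 1 % 4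
        lia
      · rw [Nat.cast_ofNat, jacobiSym.at_two hodd, ZMod.χ₈_nat_eq_if_mod_eight]
        simp [hn8', show n % 2 = 1 by lia]
    · obtain ⟨g, hg⟩ := FiniteField.exists_nonsquare (F := ZMod q) (by
        rw [ZMod.ringChar_zmod_n]
        rintro rfl
        exact absurd hqo (by decide))
      have hco : q.Coprime (8 * m) :=
        Nat.Coprime.mul_right (Nat.Coprime.pow_right 3 (Nat.coprime_two_right.2 hqo)) hcopq
      obtain ⟨n, hnq, hnm⟩ := Nat.chineseRemainder hco g.val 1
      have hn8 : n % 8 = 1 := (hnm.of_mul_right m : n ≡ 1 [MOD 8])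
      have hodd : Odd n := Nat.odd_iff.2 (by lia)
      refine ⟨n, hodd, hnm.of_dvd ⟨2, by ring⟩, ?_⟩
      rw [← jacobiSym.quadratic_reciprocity_one_mod_four (by lia) hqo,
        ← jacobiSym.legendreSym.to_jacobiSym]
      refine (legendreSym.eq_neg_one_iff' q).2 ?_
      rw [(ZMod.natCast_eq_natCast_iff _ _ _).2 hnq, ZMod.natCast_zmod_val]
      exact hg

theorem odd_and_gcd_of_coprime {d : ℤ} {n : ℕ} (h : n.Coprime (4 * d.natAbs)) :
    Odd n ∧ d.gcd n = 1 := by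
  refine ⟨Nat.coprime_two_right.1 (h.coprime_dvd_right ⟨2 * d.natAbs, by ring⟩), ?_⟩
  exact (h.coprime_dvd_right ⟨4, by ring⟩).symm

/-- The Dirichlet character modulo `4 |d|` given by the Jacobi symbol `(d / ·)`. -/
noncomputable def jacobiCharacter (d : ℤ) [NeZero (4 * d.natAbs)] :
    DirichletCharacter ℂ (4 * d.natAbs) :=
  MulChar.ofUnitHom
    { toFun := fun u => Units.mk0 ((J(d | (u : ZMod (4 * d.natAbs)).val) : ℤ) : ℂ) (by
        have h := odd_and_gcd_of_coprime (ZMod.val_coe_unit_coprime u)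
        exact_mod_cast jacobiSym.ne_zero h.2)
      map_one' := by
        ext
        simp only [Units.val_mk0, Units.val_one]
        rw [ZMod.val_one_eq_one_mod, ← jacobiSym.mod_right d odd_one, jacobiSym.one_right,
          Int.cast_one]
      map_mul' := fun u v => by
        ext
        simp only [Units.val_mk0, Units.val_mul]
        have hu := (odd_and_gcd_of_coprime (ZMod.val_coe_unit_coprime u)).1
        have hv := (odd_and_gcd_of_coprime (ZMod.val_coe_unit_coprime v)).1
        have h1 : (u : ZMod (4 * d.natAbs)).val ≠ 0 := fun h => by simp [h] at hu
        have h2 : (v : ZMod (4 * d.natAbs)).val ≠ 0 := fun h => by simp [h] at hv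
        have : NeZero (u : ZMod (4 * d.natAbs)).val := ⟨h1⟩
        have : NeZero (v : ZMod (4 * d.natAbs)).val := ⟨h2⟩
        rw [ZMod.val_mul, ← jacobiSym.mod_right d (hu.mul hv), jacobiSym.mul_right, Int.cast_mul] }

theorem jacobiCharacter_natCast {d : ℤ} [NeZero (4 * d.natAbs)] {n : ℕ}
    (h : n.Coprime (4 * d.natAbs)) : jacobiCharacter d n = (J(d | n) : ℤ) := by
  rw [← ZMod.coe_unitOfCoprime n h, jacobiCharacter, MulChar.ofUnitHom_coe]
  simp only [MonoidHom.coe_mk, OneHom.coe_mk, Units.val_mk0, ZMod.coe_unitOfCoprime]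
  rw [ZMod.val_natCast, ← jacobiSym.mod_right d (odd_and_gcd_of_coprime h).1]

theorem jacobiCharacter_prime {d : ℤ} [NeZero (4 * d.natAbs)] {p : ℕ} [hp : Fact p.Prime]
    (h2 : p ≠ 2) (hd : ¬ (p : ℤ) ∣ d) : jacobiCharacter d p = (legendreSym p d : ℤ) := by
  rw [jacobiSym.legendreSym.to_jacobiSym]
  refine jacobiCharacter_natCast ((Nat.Prime.coprime_iff_not_dvd hp.out).2 fun h => ?_)
  rcases hp.out.dvd_mul.1 h with h | h
  · exact h2 ((Nat.prime_dvd_prime_iff_eq hp.out Nat.prime_two).1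
      (hp.out.dvd_of_dvd_pow (n := 2) h))
  · exact hd (Int.natCast_dvd.2 h)

theorem jacobiCharacter_ne_one {d : ℤ} [NeZero (4 * d.natAbs)] (hd : ¬ IsSquare d) :
    jacobiCharacter d ≠ 1 := by
  obtain ⟨n, hn, hJ⟩ := exists_jacobiSym_eq_neg_one hd
  have hn0 : NeZero n := ⟨fun h => by simp [h] at hn⟩
  have hgcd : d.gcd n = 1 := by
    by_contra h
    rw [(jacobiSym.eq_zero_iff_not_coprime).2 h] at hJ
    norm_num at hJ
  have hco : n.Coprime (4 * d.natAbs) :=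
    Nat.Coprime.mul_right (Nat.Coprime.pow_right 2 (Nat.coprime_two_right.2 hn))
      (Nat.Coprime.symm hgcd)
  intro h1
  have h := jacobiCharacter_natCast hco
  rw [h1, hJ, ← ZMod.coe_unitOfCoprime n hco, MulChar.one_apply_coe] at h
  norm_num at h

end JacobiCharacter

end CotypeZeta

namespace CotypeZeta

/-! ### Poles from the coefficients at `p` and `p²` -/

section Coefficients

variable {a : ℕ → ℝ}

/-- The finitely many primes dividing `N` only enlarge the constant. -/
theorem exists_bound_of_forall_not_dvd {g : ℕ → ℝ} {N : ℕ} (hN : N ≠ 0) {C : ℝ}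
    (h : ∀ p : ℕ, p.Prime → ¬ p ∣ N → g p ≤ C) : ∃ C', ∀ p : ℕ, p.Prime → g p ≤ C' := by
  refine ⟨max C (∑ p ∈ Finset.range (N + 1), |g p|), fun p hp => ?_⟩
  by_cases hd : p ∣ N
  · refine le_trans (le_trans (le_abs_self _) ?_) (le_max_right _ _)
    exact Finset.single_le_sum (f := fun p => |g p|) (fun p _ => abs_nonneg _)
      (Finset.mem_range.2 (Nat.lt_succ_of_le (Nat.le_of_dvd (Nat.pos_of_ne_zero hN) hd)))
  · exact (h p hp hd).trans (le_max_left _ _)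

/-- For `Re s > 19/10` an error `O(1)` in `a(p)` contributes `p ^ (-19/10)`, and an error `O(p²)` in
`a(p²)` contributes `p ^ (2 - 19/5)`; both are below `p ^ (-3/2)`. -/
theorem norm_first_terms_sub_le {p : ℕ} (hp : p.Prime) {s : ℂ} (hs : s ∈ polarStrip) {b₁ b₂ : ℂ}
    {C₁ C₂ : ℝ} (h₁ : ‖(a p : ℂ) - b₁‖ ≤ C₁) (h₂ : ‖(a (p ^ 2) : ℂ) - b₂‖ ≤ C₂ * (p : ℝ) ^ 2)
    {t : ℂ} (ht : b₁ * (p : ℂ) ^ (-s) + b₂ * ((p ^ 2 : ℕ) : ℂ) ^ (-s) = t) :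
    ‖(a p : ℂ) * (p : ℂ) ^ (-s) + (a (p ^ 2) : ℂ) * ((p ^ 2 : ℕ) : ℂ) ^ (-s) - t‖ ≤
      (C₁ + C₂) * (p : ℝ) ^ (-(3 / 2) : ℝ) := by
  have hp1 : (1 : ℝ) ≤ p := by exact_mod_cast hp.one_le
  have hp0 : (0 : ℝ) < p := by linarith
  have hs' : 2 - (1 / 10 : ℝ) < s.re := hs
  have hC₁ : 0 ≤ C₁ := (norm_nonneg _).trans h₁
  have hC₂ : 0 ≤ C₂ := nonneg_of_mul_nonneg_left ((norm_nonneg _).trans h₂) (by positivity)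
  have e : (a p : ℂ) * (p : ℂ) ^ (-s) + (a (p ^ 2) : ℂ) * ((p ^ 2 : ℕ) : ℂ) ^ (-s) - t =
      ((a p : ℂ) - b₁) * (p : ℂ) ^ (-s) +
        ((a (p ^ 2) : ℂ) - b₂) * ((p ^ 2 : ℕ) : ℂ) ^ (-s) := by
    rw [← ht]
    ring
  rw [e, add_mul]
  refine (norm_add_le _ _).trans (add_le_add ?_ ?_)
  · rw [norm_mul, Complex.norm_natCast_cpow_of_pos hp.pos, Complex.neg_re]
    exact mul_le_mul h₁ (Real.rpow_le_rpow_of_exponent_le hp1 (by linarith)) (by positivity) hC₁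
  · rw [norm_mul, norm_natCast_pow_cpow hp.pos]
    refine (mul_le_mul_of_nonneg_right h₂ (by positivity)).trans ?_
    rw [mul_assoc, ← Real.rpow_natCast, ← Real.rpow_add hp0]
    refine mul_le_mul_of_nonneg_left (Real.rpow_le_rpow_of_exponent_le hp1 ?_) hC₂
    push_cast
    linarith

/-- The pole at `2` of a Dirichlet series whose coefficients at `p` and `p²` agree, up to `O(1)` and
`O(p²)`, with those of a product `ζ(s - 1) W(s)`, for almost all primes. -/
theorem dirichletSeriesHasPole_of_coefficients (ha : ∀ n, 0 ≤ a n) (h0 : a 0 = 0) (h1 : a 1 = 1)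
    (hmul : ∀ m n : ℕ, m.Coprime n → a (m * n) = a m * a n) {K : ℝ}
    (hK : ∀ p : ℕ, p.Prime → ∀ n : ℕ, a (p ^ n) ≤ K * ((n : ℝ) + 1) ^ 2 * (p : ℝ) ^ (n + n / 2))
    {w : ℕ → ℂ → ℂ} (hw : ∀ p : ℕ, p.Prime → DifferentiableOn ℂ (w p) polarStrip)
    (hwb : ∀ p : ℕ, p.Prime → ∀ s ∈ polarStrip, ‖w p s‖ ≤ (p : ℝ) ^ (-(3 / 4) : ℝ))
    {b₁ b₂ : ℕ → ℂ}
    (hb : ∀ p : ℕ, p.Prime → ∀ s : ℂ,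
      b₁ p * (p : ℂ) ^ (-s) + b₂ p * ((p ^ 2 : ℕ) : ℂ) ^ (-s) = (p : ℂ) ^ (1 - s) + w p s)
    {N : ℕ} (hN : N ≠ 0) {C₁ C₂ : ℝ}
    (h₁ : ∀ p : ℕ, p.Prime → ¬ p ∣ N → ‖(a p : ℂ) - b₁ p‖ ≤ C₁)
    (h₂ : ∀ p : ℕ, p.Prime → ¬ p ∣ N → ‖(a (p ^ 2) : ℂ) - b₂ p‖ ≤ C₂ * (p : ℝ) ^ 2)
    {h : ℂ → ℂ} (hh : DifferentiableOn ℂ h polarStrip) (hh2 : h 2 ≠ 0) (j : ℕ)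
    (hW : ∀ s : ℂ, 2 < s.re →
      HasProd (fun p : Nat.Primes => (1 - w p s)⁻¹) (h s / (s - 2) ^ j)) :
    DirichletSeriesHasPole a 2 (j + 1) := by
  obtain ⟨C₁', h₁'⟩ := exists_bound_of_forall_not_dvd (g := fun p => ‖(a p : ℂ) - b₁ p‖) hN h₁
  obtain ⟨C₂', h₂'⟩ := exists_bound_of_forall_not_dvd
    (g := fun p => ‖(a (p ^ 2) : ℂ) - b₂ p‖ / (p : ℝ) ^ 2) hN (C := C₂) fun p hp hd => by
      have : (0 : ℝ) < (p : ℝ) ^ 2 := pow_pos (by exact_mod_cast hp.pos) 2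
      rw [div_le_iff₀ this]
      exact h₂ p hp hd
  refine dirichletSeriesHasPole_of_local ha h0 h1 hmul hK hw hwb (C := C₁' + C₂')
    (fun p hp s hs => norm_first_terms_sub_le hp hs (h₁' p hp) ?_ (hb p hp s)) hh hh2 j hW
  have : (0 : ℝ) < (p : ℝ) ^ 2 := pow_pos (by exact_mod_cast hp.pos) 2
  exact (div_le_iff₀ this).1 (h₂' p hp)

theorem prime_cpow_one_sub {p : ℕ} (hp : p.Prime) (s : ℂ) :
    (p : ℂ) ^ (1 - s) = p * (p : ℂ) ^ (-s) := by
  rw [sub_eq_add_neg, Complex.cpow_add _ _ (by exact_mod_cast hp.ne_zero), Complex.cpow_one]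

theorem differentiable_prime_cpow {p : ℕ} (hp : p.Prime) {g : ℂ → ℂ} (hg : Differentiable ℂ g) :
    Differentiable ℂ fun s : ℂ => (p : ℂ) ^ g s := fun s =>
  DifferentiableAt.const_cpow (hg s) (Or.inl (by exact_mod_cast hp.ne_zero))

/-- Comparison with `ζ(s - 1)`. -/
theorem dirichletSeriesHasPole_zeta (ha : ∀ n, 0 ≤ a n) (h0 : a 0 = 0) (h1 : a 1 = 1)
    (hmul : ∀ m n : ℕ, m.Coprime n → a (m * n) = a m * a n) {K : ℝ}
    (hK : ∀ p : ℕ, p.Prime → ∀ n : ℕ, a (p ^ n) ≤ K * ((n : ℝ) + 1) ^ 2 * (p : ℝ) ^ (n + n / 2))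
    {N : ℕ} (hN : N ≠ 0) {C₁ C₂ : ℝ}
    (h₁ : ∀ p : ℕ, p.Prime → ¬ p ∣ N → |a p - p| ≤ C₁)
    (h₂ : ∀ p : ℕ, p.Prime → ¬ p ∣ N → a (p ^ 2) ≤ C₂ * (p : ℝ) ^ 2) :
    DirichletSeriesHasPole a 2 1 := by
  refine dirichletSeriesHasPole_of_coefficients ha h0 h1 hmul hK (w := fun _ _ => 0)
    (fun _ _ => differentiableOn_const 0) (fun p hp s _ => ?_) (b₁ := fun p => p)
    (b₂ := fun _ => 0) (fun p hp s => ?_) hN (C₁ := C₁) (C₂ := C₂) (fun p hp hd => ?_)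
    (fun p hp hd => ?_) (h := fun _ => 1) (differentiableOn_const 1) one_ne_zero 0 fun s _ => ?_
  · rw [norm_zero]; positivity
  · rw [prime_cpow_one_sub hp]; ring
  · have := h₁ p hp hd
    rwa [← Complex.ofReal_natCast, ← Complex.ofReal_sub, Complex.norm_real]
  · rw [sub_zero, Complex.norm_real, Real.norm_of_nonneg (ha _)]
    exact h₂ p hp hd
  · simp

/-- Comparison with `ζ(s - 1) ζ(2 s - 3)`. -/
theorem dirichletSeriesHasPole_zeta_mul_zeta (ha : ∀ n, 0 ≤ a n) (h0 : a 0 = 0) (h1 : a 1 = 1)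
    (hmul : ∀ m n : ℕ, m.Coprime n → a (m * n) = a m * a n) {K : ℝ}
    (hK : ∀ p : ℕ, p.Prime → ∀ n : ℕ, a (p ^ n) ≤ K * ((n : ℝ) + 1) ^ 2 * (p : ℝ) ^ (n + n / 2))
    {N : ℕ} (hN : N ≠ 0) {C₁ C₂ : ℝ}
    (h₁ : ∀ p : ℕ, p.Prime → ¬ p ∣ N → |a p - p| ≤ C₁)
    (h₂ : ∀ p : ℕ, p.Prime → ¬ p ∣ N → |a (p ^ 2) - (p : ℝ) ^ 3| ≤ C₂ * (p : ℝ) ^ 2) :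
    DirichletSeriesHasPole a 2 2 := by
  refine dirichletSeriesHasPole_of_coefficients ha h0 h1 hmul hK
    (w := fun p s => (p : ℂ) ^ (3 - 2 * s))
    (fun p hp => (differentiable_prime_cpow hp (by fun_prop)).differentiableOn)
    (fun p hp s hs => ?_) (b₁ := fun p => p)
    (b₂ := fun p => (p : ℂ) ^ 3) (fun p hp s => ?_) hN (C₁ := C₁) (C₂ := C₂) (fun p hp hd => ?_)
    (fun p hp hd => ?_) (h := fun s => entireZeta (2 * s - 3) / 2) ?_ ?_ 1 fun s hs => ?_
  · rw [Complex.norm_natCast_cpow_of_pos hp.pos]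
    refine Real.rpow_le_rpow_of_exponent_le (by exact_mod_cast hp.one_le) ?_
    have : 2 - (1 / 10 : ℝ) < s.re := hs
    have e : (3 - 2 * s).re = 3 - 2 * s.re := by simp
    rw [e]
    linarith
  · have hp0 : (p : ℂ) ≠ 0 := by exact_mod_cast hp.ne_zero
    rw [prime_cpow_one_sub hp, sub_eq_add_neg (3 : ℂ), Complex.cpow_add _ _ hp0, sq, Nat.cast_mul,
      Complex.natCast_mul_natCast_cpow, ← Complex.cpow_add _ _ hp0,
      show -s + -s = -(2 * s) by ring]
    congr 2
    exact_mod_cast (Complex.cpow_natCast (p : ℂ) 3).symm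
  · have := h₁ p hp hd
    rwa [← Complex.ofReal_natCast, ← Complex.ofReal_sub, Complex.norm_real]
  · have := h₂ p hp hd
    rwa [← Complex.ofReal_natCast, ← Complex.ofReal_pow, ← Complex.ofReal_sub, Complex.norm_real]
  · have : Differentiable ℂ fun s : ℂ => entireZeta (2 * s - 3) :=
      differentiable_entireZeta.comp (by fun_prop)
    exact (this.div_const 2).differentiableOn
  · rw [show (2 : ℂ) * 2 - 3 = 1 by norm_num]
    exact div_ne_zero entireZeta_one_ne_zero two_ne_zero
  · have hre : (2 * s - 3).re = 2 * s.re - 3 := by simp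
    have h := riemannZeta_eulerProduct_hasProd (s := 2 * s - 3) (by rw [hre]; linarith)
    have hne : 2 * s - 3 ≠ 1 := fun h => by
      rw [h, Complex.one_re] at hre
      linarith
    have hne' : s - 2 ≠ 0 := fun h => hne (by linear_combination 2 * h)
    -- The denominator of `ζ(2s - 3)` is `2s - 4 = 2 (s - 2)`, whence the factor `1 / 2` in `h`.
    have e : riemannZeta (2 * s - 3) = entireZeta (2 * s - 3) / 2 / (s - 2) ^ 1 := by
      rw [entireZeta_eq hne]
      field_simp
      ring
    rw [e] at h
    simpa only [neg_sub] using h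

/-- Comparison with `ζ(s - 1)` times a degree one Euler product with coefficients `l p`. -/
theorem dirichletSeriesHasPole_zeta_mul (ha : ∀ n, 0 ≤ a n) (h0 : a 0 = 0) (h1 : a 1 = 1)
    (hmul : ∀ m n : ℕ, m.Coprime n → a (m * n) = a m * a n) {K : ℝ}
    (hK : ∀ p : ℕ, p.Prime → ∀ n : ℕ, a (p ^ n) ≤ K * ((n : ℝ) + 1) ^ 2 * (p : ℝ) ^ (n + n / 2))
    {N : ℕ} (hN : N ≠ 0) {C₁ C₂ : ℝ} {l : ℕ → ℂ} (hl : ∀ p, ‖l p‖ ≤ 1)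
    (h₁ : ∀ p : ℕ, p.Prime → ¬ p ∣ N → ‖(a p : ℂ) - (p + l p * p)‖ ≤ C₁)
    (h₂ : ∀ p : ℕ, p.Prime → ¬ p ∣ N → a (p ^ 2) ≤ C₂ * (p : ℝ) ^ 2)
    {h : ℂ → ℂ} (hh : Differentiable ℂ h) (hh2 : h 2 ≠ 0) (j : ℕ)
    (hW : ∀ s : ℂ, 2 < s.re →
      HasProd (fun p : Nat.Primes => (1 - l p * (p : ℂ) ^ (1 - s))⁻¹) (h s / (s - 2) ^ j)) :
    DirichletSeriesHasPole a 2 (j + 1) := by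
  refine dirichletSeriesHasPole_of_coefficients ha h0 h1 hmul hK
    (w := fun p s => l p * (p : ℂ) ^ (1 - s))
    (fun p hp => ((differentiable_prime_cpow hp (by fun_prop)).const_mul _).differentiableOn)
    (fun p hp s hs => ?_) (b₁ := fun p => p + l p * p)
    (b₂ := fun _ => 0) (fun p hp s => ?_) hN (C₁ := C₁) (C₂ := C₂) h₁
    (fun p hp hd => ?_) hh.differentiableOn hh2 j hW
  · rw [norm_mul]
    exact (mul_le_of_le_one_left (norm_nonneg _) (hl p)).trans (norm_prime_cpow_one_sub_le hp hs)
  · rw [prime_cpow_one_sub hp]; ring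
  · rw [sub_zero, Complex.norm_real, Real.norm_of_nonneg (ha _)]
    exact h₂ p hp hd

/-- Dividing the coefficients by `n` amounts to replacing `s` by `s + 1`. -/
theorem DirichletSeriesHasPole.of_div {k : ℕ}
    (h : DirichletSeriesHasPole (fun n => a n / n) 2 k) : DirichletSeriesHasPole a 3 k := by
  obtain ⟨hsum, δ, hδ, F, hF, hFs, hord⟩ := h
  have hterm : ∀ s : ℂ, 3 < s.re → ∀ n : ℕ,
      ((a n / n : ℝ) : ℂ) * (n : ℂ) ^ (-(s - 1)) = (a n : ℂ) * (n : ℂ) ^ (-s) := by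
    intro s hs n
    rcases Nat.eq_zero_or_pos n with rfl | hn
    · have : -s ≠ 0 := fun h => by
        have := congrArg Complex.re h
        rw [Complex.neg_re, Complex.zero_re] at this
        linarith
      simp [Complex.zero_cpow this]
    · have hn0 : (n : ℂ) ≠ 0 := by exact_mod_cast hn.ne'
      rw [neg_sub, sub_eq_add_neg, Complex.cpow_add _ _ hn0, Complex.cpow_one, Complex.ofReal_div,
        Complex.ofReal_natCast]
      field_simp
  have hre : ∀ s : ℂ, (s - 1).re = s.re - 1 := fun s => by simp
  have h2 : ∀ s : ℂ, 3 < s.re → 2 < (s - 1).re := fun s hs => by rw [hre]; linarith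
  refine ⟨fun s hs => (hsum (s - 1) (h2 s hs)).congr fun n => hterm s hs n, δ, hδ,
    fun s => F (s - 1), fun s hs => ?_, fun s hs => ?_, ?_⟩
  · have hmem : s - 1 ∈ {s : ℂ | 2 - δ < s.re} := by
      have : 3 - δ < s.re := hs
      change 2 - δ < (s - 1).re
      rw [hre]
      linarith
    exact (hF _ hmem).comp_analyticAt (g := fun s => s - 1) (by fun_prop)
  · exact (hFs _ (h2 s hs)).trans (tsum_congr (hterm s hs))
  · have hc := meromorphicOrderAt_comp_of_deriv_ne_zero (f := F) (g := fun s : ℂ => s - 1)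
      (x := ((3 : ℝ) : ℂ)) (by fun_prop) (by simp)
    rw [← hord, show ((2 : ℝ) : ℂ) = ((3 : ℝ) : ℂ) - 1 by norm_num]
    exact hc

end Coefficients

end CotypeZeta

namespace CotypeZeta

open Matrix

/-! ### The poles for each type of form -/

section Poles

variable {A : Matrix (Fin 3) (Fin 3) ℤ} {m : ℕ}

theorem prime_not_dvd_of_not_dvd_two_mul_natAbs {p : ℕ} {c : ℤ} (h : ¬ p ∣ 2 * c.natAbs) :
    p ≠ 2 ∧ ¬ (p : ℤ) ∣ c :=
  ⟨fun h2 => h (by rw [h2]; exact dvd_mul_right 2 _), fun hc =>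
    h ((Int.natCast_dvd.1 hc).mul_left 2)⟩

theorem exists_finset_of_forall_not_dvd {P : ∀ p : ℕ, [Fact p.Prime] → Prop} {c : ℤ} (hc : c ≠ 0)
    (h : ∀ (p : ℕ) [Fact p.Prime], p ≠ 2 → ¬ (p : ℤ) ∣ c → P p) :
    ∃ B : Finset ℕ, ∀ (p : ℕ) [Fact p.Prime], p ∉ B → P p := by
  refine ⟨(2 * c.natAbs).primeFactors, fun p hp hpB => ?_⟩
  obtain ⟨h2, hd⟩ := prime_not_dvd_of_not_dvd_two_mul_natAbs (p := p) (c := c) fun hd =>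
    hpB (Nat.mem_primeFactors.2 ⟨hp.out, hd, by simpa using hc⟩)
  exact h p h2 hd

theorem subCount_mul_cast (A : Matrix (Fin 3) (Fin 3) ℤ) (m : ℕ) (n₁ n₂ : ℕ)
    (h : n₁.Coprime n₂) :
    ((subCount A m (n₁ * n₂) : ℕ) : ℝ) = (subCount A m n₁ : ℝ) * (subCount A m n₂ : ℝ) := by
  rw [subCount_mul A m h, Nat.cast_mul]

theorem subCount_le_cast (hα : A 0 0 ≠ 0) (m : ℕ) (p : ℕ) (hp : p.Prime) (n : ℕ) :
    ((subCount A m (p ^ n) : ℕ) : ℝ) ≤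
      (2 * (A 0 0).natAbs : ℕ) * ((n : ℝ) + 1) ^ 2 * (p : ℝ) ^ (n + n / 2) := by
  exact_mod_cast subCount_le hα hp m n

theorem subCount_prime_bounds {p : ℕ} (hp : p.Prime) (hα : ¬ (p : ℤ) ∣ A 0 0) (hm : 1 ≤ m) :
    (affineCount A p 1 : ℤ) ≤ subCount A m p ∧
      (subCount A m p : ℤ) ≤ (affineCount A p 1 : ℤ) + 3 := by
  have h1 := affineCount_le_subCount A hp hm 1
  rw [pow_one] at h1
  exact ⟨by exact_mod_cast h1, by exact_mod_cast subCount_prime_le hp hα m⟩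

theorem subCount_prime_sq_le_of_not_dvd {p : ℕ} (hp : p.Prime) (h2 : p ≠ 2)
    (hα : ¬ (p : ℤ) ∣ A 0 0) (h₁ : ¬ (p : ℤ) ∣ disc₁ A) (m : ℕ) :
    ((subCount A m (p ^ 2) : ℕ) : ℝ) ≤ 14 * (p : ℝ) ^ 2 := by
  have := (subCount_prime_sq_le hp hα m).trans
    (Nat.add_le_add_right (affineCount_two_le hp h2 hα h₁) _)
  have h : subCount A m (p ^ 2) ≤ 14 * p ^ 2 := by lia
  exact_mod_cast h

theorem legendreSym_eq_zero_or (p : ℕ) [Fact p.Prime] (d : ℤ) :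
    legendreSym p d = 0 ∨ legendreSym p d = 1 ∨ legendreSym p d = -1 := by
  by_cases h : (d : ZMod p) = 0
  · exact Or.inl ((legendreSym.eq_zero_iff p d).2 h)
  · exact Or.inr (legendreSym.eq_one_or_neg_one p h)

/-- The zero form. -/
theorem hasPole_of_quadForm_eq_zero (h : ∀ x, quadForm A x = 0) (hm : 1 ≤ m) :
    DirichletSeriesHasPole (fun n => (subCount A m n : ℝ)) 3 1 := by
  have haff : ∀ p e : ℕ, affineCount A p e = p ^ e * p ^ e := by
    intro p e
    unfold affineCount
    simp only [h, dvd_zero]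
    rw [Finset.filter_true, Finset.card_product, Finset.card_range]
  -- For the zero form `a(p) = p² + O(p)` and `a(p²) = O(p⁴)`. After division by the index these
  -- become `p + O(1)` and `O(p²)`, so the comparison with `ζ(s - 1)` applies.
  refine DirichletSeriesHasPole.of_div (dirichletSeriesHasPole_zeta (K := 1) (N := 1) (C₁ := 2)
    (C₂ := 9) (fun n => by positivity) (by simp) (by simp [subCount_one]) (fun n₁ n₂ hn => ?_)
    (fun p hp n => ?_) one_ne_zero (fun p hp _ => ?_) fun p hp _ => ?_)
  · rw [subCount_mul_cast A m n₁ n₂ hn, Nat.cast_mul, mul_div_mul_comm]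
  · have hp0 : (0 : ℝ) < p := by exact_mod_cast hp.pos
    have h1 : ((subCount A m (p ^ n) : ℕ) : ℝ) ≤ ((n : ℝ) + 1) ^ 2 * (p : ℝ) ^ (2 * n) := by
      exact_mod_cast subCount_le_trivial A hp m n
    rw [Nat.cast_pow, div_le_iff₀ (pow_pos hp0 n), one_mul, mul_assoc, ← pow_add]
    refine h1.trans (mul_le_mul_of_nonneg_left ?_ (by positivity))
    exact pow_le_pow_right₀ (by exact_mod_cast hp.one_le) (by lia)
  · have hp0 : (0 : ℝ) < p := by exact_mod_cast hp.pos
    have hp1 : (1 : ℝ) ≤ p := by exact_mod_cast hp.one_le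
    have h1 := affineCount_le_subCount A hp hm 1
    have h2 := subCount_prime_le_trivial A hp m
    rw [haff, pow_one] at h1 h2
    have h1' : (p : ℝ) * p ≤ (subCount A m p : ℝ) := by exact_mod_cast h1
    have h2' : (subCount A m p : ℝ) ≤ p * p + (p + 1) := by exact_mod_cast h2
    have e : (subCount A m p : ℝ) / p - p = ((subCount A m p : ℝ) - p * p) / p := by
      field_simp
    rw [e, abs_of_nonneg (div_nonneg (by linarith) hp0.le), div_le_iff₀ hp0]
    linarith
  · have hp0 : (0 : ℝ) < p := by exact_mod_cast hp.pos
    have h1 : ((subCount A m (p ^ 2) : ℕ) : ℝ) ≤ ((2 : ℕ) + 1 : ℝ) ^ 2 * (p : ℝ) ^ (2 * 2) := by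
      exact_mod_cast subCount_le_trivial A hp m 2
    rw [Nat.cast_pow, div_le_iff₀ (pow_pos hp0 2)]
    refine h1.trans (le_of_eq ?_)
    push_cast
    ring

/-- Forms of rank one. -/
theorem hasPole_of_disc_eq_zero (hα : A 0 0 ≠ 0) (h₁ : disc₁ A = 0) (h₂ : disc₂ A = 0)
    (h₃ : disc₃ A = 0) (hm : 1 ≤ m) :
    DirichletSeriesHasPole (fun n => (subCount A m n : ℝ)) 2 2 := by
  refine dirichletSeriesHasPole_zeta_mul_zeta (N := 2 * (A 0 0).natAbs) (C₁ := 3) (C₂ := 8)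
    (fun n => by positivity) (by simp [subCount_zero]) (by simp [subCount_one])
    (subCount_mul_cast A m) (subCount_le_cast hα m) (by simpa using hα)
    (fun p hp hd => ?_) fun p hp hd => ?_
  · obtain ⟨h2, hd⟩ := prime_not_dvd_of_not_dvd_two_mul_natAbs hd
    obtain ⟨h4, h5⟩ := subCount_prime_bounds (m := m) hp hd hm
    rw [affineCount_of_disc_eq_zero hp h2 hd h₁ h₂ h₃ (Or.inl rfl)] at h4 h5
    have h6 : |(subCount A m p : ℤ) - p| ≤ 3 := by
      rw [abs_le]
      push_cast at h4 h5
      constructor <;> lia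
    exact_mod_cast h6
  · obtain ⟨h2, hd⟩ := prime_not_dvd_of_not_dvd_two_mul_natAbs hd
    have h4 := affineCount_le_subCount A hp hm 2
    have h5 := subCount_prime_sq_le hp hd m
    rw [affineCount_of_disc_eq_zero hp h2 hd h₁ h₂ h₃ (Or.inr rfl)] at h4 h5
    have h4' : (p : ℝ) ^ 2 * p ≤ (subCount A m (p ^ 2) : ℝ) := by
      have : p ^ 2 * p ≤ subCount A m (p ^ 2) := by simpa using h4
      exact_mod_cast this
    have h5' : (subCount A m (p ^ 2) : ℝ) ≤ (p : ℝ) ^ 2 * p + 8 * (p : ℝ) ^ 2 := by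
      have : subCount A m (p ^ 2) ≤ p ^ 2 * p + 8 * p ^ 2 := by simpa using h5
      exact_mod_cast this
    rw [abs_le]
    constructor
    · nlinarith [sq_nonneg (p : ℝ)]
    · nlinarith

/-- Forms of rank three. -/
theorem hasPole_of_doubleDisc_ne_zero (hα : A 0 0 ≠ 0) (h₁ : disc₁ A ≠ 0)
    (hD : doubleDisc A ≠ 0) (hm : 1 ≤ m) :
    DirichletSeriesHasPole (fun n => (subCount A m n : ℝ)) 2 1 := by
  -- The constant 4 is 3 from the remaining Hermite forms plus 1 from the Legendre symbol; 14 is 6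
  -- from the zeros modulo `p²` plus 8 from the remaining Hermite forms.
  refine dirichletSeriesHasPole_zeta (N := 2 * (A 0 0 * disc₁ A * doubleDisc A).natAbs) (C₁ := 4)
    (C₂ := 14) (fun n => by positivity) (by simp [subCount_zero]) (by simp [subCount_one])
    (subCount_mul_cast A m) (subCount_le_cast hα m)
    (by simp [hα, h₁, hD]) (fun p hp hd => ?_) fun p hp hd => ?_
  · obtain ⟨h2, hd⟩ := prime_not_dvd_of_not_dvd_two_mul_natAbs hd
    have hp' : Fact p.Prime := ⟨hp⟩
    have hd0 : ¬ (p : ℤ) ∣ A 0 0 := fun h => hd ((h.mul_right _).mul_right _)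
    have hd1 : ¬ (p : ℤ) ∣ disc₁ A := fun h => hd ((h.mul_left _).mul_right _)
    have hd2 : ¬ (p : ℤ) ∣ doubleDisc A := fun h => hd (h.mul_left _)
    obtain ⟨h4, h5⟩ := subCount_prime_bounds (m := m) hp hd0 hm
    rw [affineCount_one_of_not_dvd_doubleDisc h2 hd0 hd1 hd2] at h4 h5
    have h6 : |(subCount A m p : ℤ) - p| ≤ 4 := by
      rw [abs_le]
      rcases legendreSym_eq_zero_or p (disc₁ A) with hl | hl | hl <;> rw [hl] at h4 h5 <;>
        constructor <;> lia
    exact_mod_cast h6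
  · obtain ⟨h2, hd⟩ := prime_not_dvd_of_not_dvd_two_mul_natAbs hd
    exact subCount_prime_sq_le_of_not_dvd hp h2 (fun h => hd ((h.mul_right _).mul_right _))
      (fun h => hd ((h.mul_left _).mul_right _)) m

/-- Forms of rank two, relative to an Euler product for the Legendre symbol of the discriminant. -/
theorem hasPole_of_doubleDisc_eq_zero (hα : A 0 0 ≠ 0) (h₁ : disc₁ A ≠ 0)
    (hD : doubleDisc A = 0) (hm : 1 ≤ m) {l : ℕ → ℂ} (hl : ∀ p, ‖l p‖ ≤ 1)
    (hlp : ∀ (p : ℕ) [Fact p.Prime], p ≠ 2 → ¬ (p : ℤ) ∣ disc₁ A →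
      l p = (legendreSym p (disc₁ A) : ℤ))
    {h : ℂ → ℂ} (hh : Differentiable ℂ h) (hh2 : h 2 ≠ 0) (j : ℕ)
    (hW : ∀ s : ℂ, 2 < s.re →
      HasProd (fun p : Nat.Primes => (1 - l p * (p : ℂ) ^ (1 - s))⁻¹) (h s / (s - 2) ^ j)) :
    DirichletSeriesHasPole (fun n => (subCount A m n : ℝ)) 2 (j + 1) := by
  refine dirichletSeriesHasPole_zeta_mul (N := 2 * (A 0 0 * disc₁ A).natAbs) (C₁ := 4)
    (C₂ := 14) (fun n => by positivity) (by simp [subCount_zero]) (by simp [subCount_one])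
    (subCount_mul_cast A m) (subCount_le_cast hα m)
    (by simp [hα, h₁]) hl (fun p hp hd => ?_) (fun p hp hd => ?_) hh hh2 j hW
  · obtain ⟨h2, hd⟩ := prime_not_dvd_of_not_dvd_two_mul_natAbs hd
    have hp' : Fact p.Prime := ⟨hp⟩
    have hd0 : ¬ (p : ℤ) ∣ A 0 0 := fun h => hd (h.mul_right _)
    have hd1 : ¬ (p : ℤ) ∣ disc₁ A := fun h => hd (h.mul_left _)
    obtain ⟨h4, h5⟩ := subCount_prime_bounds (m := m) hp hd0 hm
    rw [affineCount_one_of_doubleDisc_eq_zero h2 hd0 hd1 hD] at h4 h5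
    rw [hlp p h2 hd1]
    -- The number of zeros is `p + χ(p)(p - 1)`; replacing `p - 1` by `p` costs at most 1.
    have h6 : |(subCount A m p : ℤ) - (p + legendreSym p (disc₁ A) * p)| ≤ 4 := by
      rw [abs_le]
      rcases legendreSym_eq_zero_or p (disc₁ A) with hl | hl | hl <;> rw [hl] at h4 h5 ⊢ <;>
        constructor <;> lia
    have e : ((subCount A m p : ℝ) : ℂ) - (p + ((legendreSym p (disc₁ A) : ℤ) : ℂ) * p) =
        (((subCount A m p : ℤ) - (p + legendreSym p (disc₁ A) * p) : ℤ) : ℂ) := by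
      push_cast
      ring
    rw [e, Complex.norm_intCast]
    exact_mod_cast h6
  · obtain ⟨h2, hd⟩ := prime_not_dvd_of_not_dvd_two_mul_natAbs hd
    exact subCount_prime_sq_le_of_not_dvd hp h2 (fun h => hd (h.mul_right _))
      (fun h => hd (h.mul_left _)) m

/-- The Legendre symbol is 1 at almost all primes, so the second factor is another `ζ(s - 1)`. -/
theorem hasPole_of_disc₁_eq_sq (hα : A 0 0 ≠ 0) (h₁ : disc₁ A ≠ 0)
    (hD : doubleDisc A = 0) {t : ℤ} (ht : disc₁ A = t ^ 2) (hm : 1 ≤ m) :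
    DirichletSeriesHasPole (fun n => (subCount A m n : ℝ)) 2 2 := by
  refine hasPole_of_doubleDisc_eq_zero hα h₁ hD hm (l := fun _ => 1) (fun _ => by simp)
    (fun p hp _ hd => ?_) (h := fun s => entireZeta (s - 1))
    (differentiable_entireZeta.comp (by fun_prop)) ?_ 1 fun s hs => ?_
  · have hd' : ((t : ℤ) : ZMod p) ≠ 0 := fun h0 => hd (by
      rw [ht]
      exact Dvd.dvd.pow ((ZMod.intCast_zmod_eq_zero_iff_dvd t p).1 h0) two_ne_zero)
    rw [ht, legendreSym.sq_one' p hd', Int.cast_one]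
  · rw [show (2 : ℂ) - 1 = 1 by norm_num]
    exact entireZeta_one_ne_zero
  · have h := hasProd_riemannZeta_sub_one hs
    rw [riemannZeta_sub_one_eq hs] at h
    simpa only [one_mul, pow_one] using h

/-- The character is nontrivial, so its `L`-function is entire and, by Dirichlet, nonzero at 1. Only
`ζ(s - 1)` contributes to the pole. -/
theorem hasPole_of_not_isSquare_disc₁ (hα : A 0 0 ≠ 0) (hD : doubleDisc A = 0)
    (hsq : ¬ IsSquare (disc₁ A)) (hm : 1 ≤ m) :
    DirichletSeriesHasPole (fun n => (subCount A m n : ℝ)) 2 1 := by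
  have h₁ : disc₁ A ≠ 0 := fun h => hsq (h ▸ IsSquare.zero)
  have : NeZero (4 * (disc₁ A).natAbs) := ⟨by simpa using h₁⟩
  have hχ := jacobiCharacter_ne_one hsq
  refine hasPole_of_doubleDisc_eq_zero hα h₁ hD hm (l := fun p => jacobiCharacter (disc₁ A) p)
    (fun p => DirichletCharacter.norm_le_one _ _) (fun p hp h2 hd => jacobiCharacter_prime h2 hd)
    (h := fun s => DirichletCharacter.LFunction (jacobiCharacter (disc₁ A)) (s - 1))
    ((DirichletCharacter.differentiable_LFunction hχ).comp (by fun_prop)) ?_ 0 fun s hs => ?_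
  · rw [show (2 : ℂ) - 1 = 1 by norm_num]
    exact DirichletCharacter.LFunction_apply_one_ne_zero hχ
  · have hs' : 1 < (s - 1).re := by
      rw [Complex.sub_re, Complex.one_re]
      linarith
    have h := DirichletCharacter.LSeries_eulerProduct_hasProd (jacobiCharacter (disc₁ A)) hs'
    rw [← DirichletCharacter.LFunction_eq_LSeries _ hs'] at h
    simpa only [pow_zero, div_one, neg_sub] using h

theorem corankZetaHasPole_of_conj {L : Type*} [LieRing L] (b : Module.Basis (Fin 3) ℤ L)
    {Q : Matrix (Fin 3) (Fin 3) ℤ} (hQ : IsUnit Q.det) {m k : ℕ} {x : ℝ}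
    (h : DirichletSeriesHasPole
      (fun n => (subCount (Qᵀ * structureMatrix b * Q) m n : ℝ)) x k) :
    CorankZetaHasPole ℤ L 3 m x k := by
  have e : ∀ n, subCount (Qᵀ * structureMatrix b * Q) m n = subCount (structureMatrix b) m n :=
    fun n => (subCount_eq_of_quadForm hQ (fun x => (quadForm_conj _ _ x).symm) m n).symm
  simp only [e] at h
  obtain ⟨hsum, δ, hδ, F, hF, hFs, hord⟩ := h
  have hsum' : ∀ s : ℂ, x < s.re → Summable (corankTerm ℤ L 3 m s) := fun s hs =>
    (summable_corankTerm_iff b m s).2 (by simpa only [Complex.ofReal_natCast] using hsum s hs)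
  refine ⟨hsum', δ, hδ, F, hF, fun s hs => ?_, hord⟩
  rw [hFs s hs, corankZeta_eq_tsum b m (hsum' s hs)]
  simp only [Complex.ofReal_natCast]

end Poles

end CotypeZeta

theorem mainTheorem5 {L : Type*} [LieRing L] (b : Module.Basis (Fin 3) ℤ L) :
    (quadRank (structureMatrix b) = 0 →
      SameCotypeZeta ℤ L Abelian3 3 ∧
      ∀ m ∈ Finset.Icc 1 3, CorankZetaHasPole ℤ L 3 m 3 1) ∧
    (quadRank (structureMatrix b) = 1 →
      (∃ B : Finset ℕ, ∀ (p : ℕ) [Fact p.Prime], p ∉ B →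
        SameCotypeZeta ℤ_[p] (AtPrime p L) (AtPrime p Heisenberg) 3) ∧
      ∀ m ∈ Finset.Icc 1 3, CorankZetaHasPole ℤ L 3 m 2 2) ∧
    (quadRank (structureMatrix b) = 3 →
      (∃ B : Finset ℕ, ∀ (p : ℕ) [Fact p.Prime], p ∉ B →
        SameCotypeZeta ℤ_[p] (AtPrime p L) (AtPrime p SL2) 3) ∧
      ∀ m ∈ Finset.Icc 1 3, CorankZetaHasPole ℤ L 3 m 2 1) ∧
    (quadRank (structureMatrix b) = 2 → IsReducibleForm (quadPoly (structureMatrix b)) →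
      (∃ B : Finset ℕ, ∀ (p : ℕ) [Fact p.Prime], p ∉ B →
        SameCotypeZeta ℤ_[p] (AtPrime p L) (AtPrime p L1) 3) ∧
      ∀ m ∈ Finset.Icc 1 3, CorankZetaHasPole ℤ L 3 m 2 2) ∧
    (quadRank (structureMatrix b) = 2 → ¬ IsReducibleForm (quadPoly (structureMatrix b)) →
      ∀ m ∈ Finset.Icc 1 3, CorankZetaHasPole ℤ L 3 m 2 1) := by
  have hm : ∀ {m : ℕ}, m ∈ Finset.Icc 1 3 → 1 ≤ m := fun h => (Finset.mem_Icc.1 h).1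
  -- In each normalized case the rank is known, so the clauses for other ranks are vacuous. The
  -- exceptional primes divide 2 or one of the nonzero quantities `A 0 0`, `disc₁`, `doubleDisc` of
  -- the normalized form, or the square root `t` of `disc₁`.
  rcases exists_normalization (structureMatrix b) with ⟨h, hr⟩ | ⟨Q, hQ, hα, h⟩
  · refine ⟨fun _ => ⟨sameCotypeZeta_abelian b h, fun m hm' => ?_⟩, by simp [hr], by simp [hr],
      by simp [hr], by simp [hr]⟩
    refine corankZetaHasPole_of_conj b (Q := 1) (by simp)
      (hasPole_of_quadForm_eq_zero (fun x => ?_) (hm hm'))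
    rw [quadForm_conj, h]
  rcases h with ⟨h₁, h₂, h₃, hr⟩ | ⟨h₁, hr⟩
  · refine ⟨by simp [hr], fun _ => ⟨exists_finset_of_forall_not_dvd hα fun p hp h2 hd => ?_,
      fun m hm' => ?_⟩, by simp [hr], by simp [hr], by simp [hr]⟩
    · exact sameCotypeZeta_heisenberg hQ rfl h2 hd h₁ h₂ h₃
    · exact corankZetaHasPole_of_conj b hQ (hasPole_of_disc_eq_zero hα h₁ h₂ h₃ (hm hm'))
  by_cases hD : doubleDisc (Q.transpose * structureMatrix b * Q) = 0
  · rw [if_pos hD] at hr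
    refine ⟨by simp [hr], by simp [hr], by simp [hr], fun _ hred => ?_, fun _ hred m hm' => ?_⟩
    -- In rank 2, `f` is reducible exactly when `disc₁` of the normalized form is a square; this
    -- separates the two clauses.
    · obtain ⟨t, ht⟩ := isSquare_disc₁_of_isReducibleForm hred hα
      have ht0 : t ≠ 0 := fun h0 => h₁ (by rw [ht, h0]; rfl)
      refine ⟨exists_finset_of_forall_not_dvd (mul_ne_zero hα ht0) fun p hp h2 hd => ?_,
        fun m hm' => corankZetaHasPole_of_conj b hQ
          (hasPole_of_disc₁_eq_sq hα h₁ hD ht (hm hm'))⟩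
      exact sameCotypeZeta_l1 hQ rfl h2 (fun h => hd (h.mul_right _)) (fun h => hd (h.mul_left _))
        ht hD
    · refine corankZetaHasPole_of_conj b hQ (hasPole_of_not_isSquare_disc₁ hα hD ?_ (hm hm'))
      rintro ⟨t, ht⟩
      exact hred (isReducibleForm_of_disc₁_eq_sq hQ hα h₁ hD (ht.trans (sq t).symm))
  · rw [if_neg hD] at hr
    refine ⟨by simp [hr], by simp [hr], fun _ => ⟨exists_finset_of_forall_not_dvd
      (mul_ne_zero (mul_ne_zero hα h₁) hD) fun p hp h2 hd => ?_, fun m hm' => ?_⟩,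
      by simp [hr], by simp [hr]⟩
    · exact sameCotypeZeta_sl2 hQ rfl h2 (fun h => hd ((h.mul_right _).mul_right _))
        (fun h => hd ((h.mul_left _).mul_right _)) (fun h => hd (h.mul_left _))
    · exact corankZetaHasPole_of_conj b hQ (hasPole_of_doubleDisc_ne_zero hα h₁ hD (hm hm'))
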